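/- Let $d\ge 1$, let $\Omega\subset\mathbb R^d$ be a bounded open set, $T>0$, $\gamma\in(-1,1)\setminus\{0\}$, $\alpha_0>0$, and $$a_\gamma=-\alpha_0\tfrac4\pi\,\Gamma(-\gamma-1)\Gamma(\gamma+2)\cos\big((\gamma+1)\tfrac{\pi}{2}\big).$$ Let $(\cdot,\cdot)$, $\|\cdot\|$ be the $L^2(\Omega)$ inner product and norm, $\|\cdot\|_1$ the $H^1(\Omega)$ norm, and $H^1_0(\Omega)$ the closure of $C_c^\infty(\Omega)$ in $H^1(\Omega)$. $\partial_t^\beta$ denotes the Caputo derivative: with $I^\beta g(t)=\frac1{\Gamma(\beta)}\int_0^t(t-\tau)^{\beta-1}g(\tau)\,d\tau$, $\partial_t^\beta g=I^{-\beta}g$ for $-1<\beta<0$ and $\partial_t^\beta g=I^{\lceil\beta\rceil-\beta}g^{(\lceil\beta\rceil)}$ for non-integer $\beta>0$. *Continuous problem.* Let $f:[0,T]\to L^2(\Omega)$, $u_0,v_0\in H^1_0(\Omega)$, and let $u:[0,T]\to H^1_0(\Omega)$ satisfy $u(0)=u_0$, $\partial_tu(0)=v_0$ and, for $t\in(0,T]$,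 $$(\partial_t^2u,v)+(\nabla u,\nabla v)+a_\gamma(\partial_t^{\gamma+1}u,v)=(f,v)\qquad\text{for all }v\in H^1_0(\Omega).$$ *Smoothness assumption.* $u\in C^2([0,T];H^1(\Omega))\cap C^4((0,T];H^1(\Omega))$ and $$\|\partial_t^{k}u(t)\|_1\le C_0(1+c_kt^{2+\alpha-k}),\qquad 0<t\le T,\ k=0,\dots,4,$$ with $C_0>0$, $c_k\ge0$, and $\alpha\ge-\gamma$ if $\gamma<0$, $\alpha\ge1-\gamma$ if $\gamma>0$. Moreover $\alpha\neq1$ or $c_4=0$. *Discretization.* Let $h>0$ and let $V_h\subset H^1_0(\Omega)$ be a finite-dimensional space (e.g. piecewise linear finite elements) satisfying the inverse inequality $\|\nabla v\|\le C_{\rm inv}h^{-1}\|v\|$ for $v\in V_h$, with $C_{\rm inv}>0$. Let $R_h:H^1_0(\Omega)\to V_h$ be the Ritz projection, $(\nabla R_hw,\nabla v)=(\nabla w,\nabla v)$ for all $v\in V_h$, and $P_h:L^2(\Omega)\to V_h$ the $L^2$ projection. Let $\kappa>0$, $N\kappa=T$, $t_n=n\kappa$. The BDF2 convolution quadrature weights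 are defined by $$\Big(\frac{\delta(\zeta)}\kappa\Big)^\gamma=\sum_{j\ge0}\omega_j\zeta^j,\qquad \delta(\zeta)=\tfrac32-2\zeta+\tfrac12\zeta^2,$$ and for a sequence $g$ put $(\partial_\kappa^\gamma g)_n=\sum_{j=0}^n\omega_{n-j}(g_j-\chi_\gamma g_0)$, where $\chi_\gamma=1$ for $\gamma>0$ and $\chi_\gamma=0$ for $\gamma<0$. The discrete solution $u_0^h,\dots,u_N^h\in V_h$ is given by $u^h_0=R_hu_0$, $u_1^h=R_h(u_0+\kappa v_0)+\frac12\kappa^2P_h\partial_t^2u(0)$ and $$\tfrac1{\kappa^2}(u^h_{n+1}-2u^h_n+u^h_{n-1},v)+(\nabla u^h_n,\nabla v)+a_\gamma\big((\partial^\gamma_\kappa\bar\partial_tu^h)_n,v\big)=(f(t_n),v)\quad\text{for all }v\in V_h,$$ $n=1,\dots,N-1$, where $\bar\partial_tu^h_0=R_hv_0$ and $\bar\partial_tu^h_n=\frac1{2\kappa}(u^h_{n+1}-u^h_{n-1})$ for $n\ge1$. Assume the CFL condition $\kappa\le\sqrt2\,h/C_{\rm inv}$. *Claim.* There are $C,\bar\kappa>0$,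 depending only on $\Omega,T,\gamma,\alpha_0,\alpha$, and $\tilde C>0$, depending in addition only on $C_0$ and $c_0,\dots,c_4$, such that, if $\kappa<\bar\kappa$, then for all $n=1,\dots,N$, with $t_{n-1/2}=t_n-\frac12\kappa$, $$\begin{aligned}\Big\|\frac{u^h_n-u^h_{n-1}}\kappa-u'(t_{n-\frac12})\Big\|+\Big\|\frac{u^h_n+u^h_{n-1}}2-u(t_{n-\frac12})\Big\|\le{}&C\mathcal E_h+\|(R_h-I)u'(t_{n-\frac12})\|+\|(R_h-I)u(t_{n-\frac12})\|\\&+C\mathcal A_\gamma+C\,C_0(c_3+c_4)\kappa^{1+\alpha}+\tilde C\kappa^2\end{aligned}$$ and $$\Big\|\frac{u^h_n+u^h_{n-1}}2-u(t_{n-\frac12})\Big\|_1\le C\mathcal E_h+\|(R_h-I)u(t_{n-\frac12})\|_1+C\mathcal A_\gamma+C\,C_0(c_3+c_4)\kappa^{1+\alpha}+\tilde C\kappa^2,$$ where $$\mathcal E_h=\kappa\sum_{j=1}^{N-1}\|(R_h-I)\partial_t^2u(t_j)\|+\|(R_h-I)v_0\|+\frac\kappa2\|(R_h-I)u''(0)\|+\kappa\sum_{j=1}^{N-1}\|(R_h-I)\partial_t^\gamma\partial_tu(t_j)\|,$$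 and $\mathcal A_\gamma=\|\partial_tR_hu(\kappa)\|\,\kappa$ for $\gamma\in(-1,0)$, $\mathcal A_\gamma=\|\partial_t^2R_hu(\kappa)\|\,\kappa^{2-\gamma}$ for $\gamma\in(0,1)$. -/

import Mathlib

open MeasureTheory Set
open scoped ContDiff RealInnerProductSpace

noncomputable section

namespace FracWave

/-! ### The spaces `L²(Ω)` and `H¹₀(Ω)` -/

/-- The Euclidean space `ℝ^d`. -/
abbrev Euc (d : ℕ) := EuclideanSpace ℝ (Fin d)

/-- `L²(Ω; F)` with respect to Lebesgue measure. -/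
abbrev L2 {d : ℕ} (F : Type) [NormedAddCommGroup F] (Ω : Set (Euc d)) :=
  Lp F 2 (volume.restrict Ω)

/-- The Hilbert space `L²(Ω) × L²(Ω; ℝ^d)` with norm `(‖w‖² + ‖g‖²)^{1/2}`. A Sobolev function
`w` is represented in it by the pair `(w, ∇w)`, whose norm is the `H¹(Ω)` norm of `w`. -/
abbrev PairSpace {d : ℕ} (Ω : Set (Euc d)) := WithLp 2 (L2 ℝ Ω × L2 (Euc d) Ω)

/-- `φ ∈ C_c^∞(Ω)`. -/
structure IsTestFunction {d : ℕ} (Ω : Set (Euc d)) (φ : Euc d → ℝ) : Prop where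
  smooth : ContDiff ℝ ∞ φ
  compact : HasCompactSupport φ
  support : tsupport φ ⊆ Ω

/-- The pairs `(φ, ∇φ)` with `φ ∈ C_c^∞(Ω)`. -/
def testPairs {d : ℕ} (Ω : Set (Euc d)) : Submodule ℝ (PairSpace Ω) where
  carrier := {p | ∃ φ : Euc d → ℝ, IsTestFunction Ω φ ∧
    (p.fst : Euc d → ℝ) =ᵐ[volume.restrict Ω] φ ∧
    (p.snd : Euc d → Euc d) =ᵐ[volume.restrict Ω] gradient φ}
  zero_mem' := by
    refine ⟨fun _ => 0, ⟨contDiff_const, HasCompactSupport.zero, ?_⟩, ?_, ?_⟩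
    · simp [tsupport]
    · exact Lp.coeFn_zero _ _ _
    · refine (Lp.coeFn_zero _ _ _).trans (Filter.Eventually.of_forall fun x => ?_)
      simp [gradient]
  add_mem' := by
    rintro p q ⟨φ, hφ, hp1, hp2⟩ ⟨ψ, hψ, hq1, hq2⟩
    refine ⟨φ + ψ, ⟨hφ.smooth.add hψ.smooth, hφ.compact.add hψ.compact, ?_⟩, ?_, ?_⟩
    · exact (tsupport_add φ ψ).trans (union_subset hφ.support hψ.support)
    · exact (Lp.coeFn_add _ _).trans (hp1.add hq1)
    · refine (Lp.coeFn_add _ _).trans ((hp2.add hq2).trans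
        (Filter.Eventually.of_forall fun x => ?_))
      have h1 : DifferentiableAt ℝ φ x := hφ.smooth.differentiable (by simp) x
      have h2 : DifferentiableAt ℝ ψ x := hψ.smooth.differentiable (by simp) x
      simp [gradient, fderiv_add h1 h2]
  smul_mem' := by
    rintro a p ⟨φ, hφ, hp1, hp2⟩
    refine ⟨a • φ, ⟨hφ.smooth.const_smul a, ?_, ?_⟩, ?_, ?_⟩
    · exact hφ.compact.smul_left
    · exact (tsupport_smul_subset_right (fun _ => a) φ).trans hφ.support
    · exact (Lp.coeFn_smul _ _).trans (hp1.const_smul a)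
    · refine (Lp.coeFn_smul _ _).trans ((hp2.const_smul a).trans
        (Filter.Eventually.of_forall fun x => ?_))
      have h1 : DifferentiableAt ℝ φ x := hφ.smooth.differentiable (by simp) x
      simp [gradient, fderiv_const_smul h1]

/-- `H¹₀(Ω)`: the closure of `C_c^∞(Ω)` in the `H¹` norm. Its norm is the `H¹(Ω)` norm. -/
def H10 {d : ℕ} (Ω : Set (Euc d)) : Submodule ℝ (PairSpace Ω) := (testPairs Ω).topologicalClosure

instance {d : ℕ} (Ω : Set (Euc d)) : CompleteSpace (H10 Ω) :=
  inferInstanceAs (CompleteSpace (testPairs Ω).topologicalClosure)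

/-- The embedding `H¹₀(Ω) → L²(Ω)`, `w ↦ w`. -/
def toL2 {d : ℕ} {Ω : Set (Euc d)} (w : H10 Ω) : L2 ℝ Ω := (w : PairSpace Ω).fst

/-- The gradient `H¹₀(Ω) → L²(Ω; ℝ^d)`, `w ↦ ∇w`. -/
def grad {d : ℕ} {Ω : Set (Euc d)} (w : H10 Ω) : L2 (Euc d) Ω := (w : PairSpace Ω).snd

/-! ### Fractional calculus -/

/-- The Riemann–Liouville integral `I_t^β g(t)`, for `β > 0`. -/
def rlIntegral {X : Type} [NormedAddCommGroup X] [NormedSpace ℝ X] (β : ℝ) (g : ℝ → X) (t : ℝ) :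
    X :=
  (Real.Gamma β)⁻¹ • ∫ τ in (0 : ℝ)..t, (t - τ) ^ (β - 1) • g τ

/-- The `k`-th time derivative of a function on `[0,T]` (one-sided at the end points). -/
def timeDeriv {X : Type} [NormedAddCommGroup X] [NormedSpace ℝ X] (T : ℝ) (k : ℕ) (g : ℝ → X)
    (t : ℝ) : X :=
  iteratedDerivWithin k g (Icc 0 T) t

/-- The Caputo derivative `∂_t^γ g(t)` of order `γ > -1` of a function on `[0,T]`. -/
def caputo {X : Type} [NormedAddCommGroup X] [NormedSpace ℝ X] (T γ : ℝ) (g : ℝ → X) (t : ℝ) :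
    X :=
  if γ < 0 then rlIntegral (-γ) g t
  else if γ = (⌈γ⌉₊ : ℝ) then timeDeriv T ⌈γ⌉₊ g t
  else rlIntegral ((⌈γ⌉₊ : ℝ) - γ) (timeDeriv T ⌈γ⌉₊ g) t

/-- The coefficient `a_γ` of the damping term. -/
def aCoeff (α₀ γ : ℝ) : ℝ :=
  -α₀ * (4 / Real.pi) * Real.Gamma (-γ - 1) * Real.Gamma (γ + 2) *
    Real.cos ((γ + 1) * Real.pi / 2)

/-! ### The continuous problem -/

/-- `u` is a weak solution of `∂_t² u - Δu + a ∂_t^{γ+1} u = f` in `Ω × (0,T]`, `u = 0` on `∂Ω`,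
`u(0) = u₀`, `∂_t u(0) = v₀`. -/
structure IsWeakSolution {d : ℕ} {Ω : Set (Euc d)} (T γ a : ℝ) (f : ℝ → L2 ℝ Ω) (u₀ v₀ : H10 Ω)
    (u : ℝ → H10 Ω) : Prop where
  init : u 0 = u₀
  init_deriv : timeDeriv T 1 u 0 = v₀
  weak_eq : ∀ t ∈ Ioc 0 T, ∀ v : H10 Ω,
    ⟪toL2 (timeDeriv T 2 u t), toL2 v⟫ + ⟪grad (u t), grad v⟫
      + a * ⟪toL2 (caputo T (γ + 1) u t), toL2 v⟫ = ⟪f t, toL2 v⟫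

/-- The smoothness assumption: `u` is `C²` on `[0,T]` and `C⁴` on `(0,T]` with values in `H¹`,
with derivatives bounded by `C₀ (1 + c_k t^{2+α-k})` for `k = 0, …, 4`. -/
structure SmoothnessAssumption {d : ℕ} {Ω : Set (Euc d)} (T γ α C₀ : ℝ) (c : Fin 5 → ℝ)
    (u : ℝ → H10 Ω) : Prop where
  contDiff_two : ContDiffOn ℝ 2 u (Icc 0 T)
  contDiff_four : ContDiffOn ℝ 4 u (Ioc 0 T)
  bound : ∀ k : Fin 5, ∀ t ∈ Ioc 0 T,
    ‖timeDeriv T (k : ℕ) u t‖ ≤ C₀ * (1 + c k * t ^ (2 + α - ((k : ℕ) : ℝ)))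
  exponent_neg : γ < 0 → -γ ≤ α
  exponent_pos : 0 < γ → 1 - γ ≤ α

/-! ### The fully discrete scheme -/

/-- The Ritz projection `R_h` onto `V`: `(∇ R_h w, ∇ v) = (∇ w, ∇ v)` for all `v ∈ V`. -/
def ritz {d : ℕ} {Ω : Set (Euc d)} (V : Submodule ℝ (H10 Ω)) (w : H10 Ω) : H10 Ω :=
  Classical.epsilon fun r => r ∈ V ∧ ∀ v ∈ V, ⟪grad r, grad v⟫ = ⟪grad w, grad v⟫

/-- The `L²(Ω)` projection `P_h` onto `V`: `(P_h w, v) = (w, v)` for all `v ∈ V`. -/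
def l2Proj {d : ℕ} {Ω : Set (Euc d)} (V : Submodule ℝ (H10 Ω)) (w : L2 ℝ Ω) : H10 Ω :=
  Classical.epsilon fun r => r ∈ V ∧ ∀ v ∈ V, ⟪toL2 r, toL2 v⟫ = ⟪w, toL2 v⟫

/-- The BDF2 symbol `δ(ζ) = 3/2 - 2ζ + ζ²/2`. -/
def bdf2 (ζ : ℝ) : ℝ := 3 / 2 - 2 * ζ + ζ ^ 2 / 2

/-- The convolution quadrature weights: `ω_j` is the `j`-th Taylor coefficient at `ζ = 0` of
`(δ(ζ)/κ)^γ`. -/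
def cqWeight (γ κ : ℝ) (j : ℕ) : ℝ :=
  iteratedDeriv j (fun ζ : ℝ => (bdf2 ζ / κ) ^ γ) 0 / (j.factorial : ℝ)

/-- The convolution quadrature `∑_{j=0}^n ω_{n-j} (g_j - χ_γ g_0)`, where `χ_γ = 1` if `γ > 0` and
`χ_γ = 0` otherwise. -/
def cq {X : Type} [AddCommGroup X] [Module ℝ X] (γ κ : ℝ) (g : ℕ → X) (n : ℕ) : X :=
  ∑ j ∈ Finset.range (n + 1),
    cqWeight γ κ (n - j) • (g j - (if 0 < γ then (1 : ℝ) else 0) • g 0)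

/-- The central difference of a sequence, with prescribed value `z` at `n = 0`. -/
def centralDiff {X : Type} [AddCommGroup X] [Module ℝ X] (κ : ℝ) (z : X) (U : ℕ → X) (n : ℕ) :
    X :=
  if n = 0 then z else (2 * κ)⁻¹ • (U (n + 1) - U (n - 1))

/-- The inverse inequality `‖∇v‖ ≤ C_inv h⁻¹ ‖v‖` on `V`. -/
def InverseInequality {d : ℕ} {Ω : Set (Euc d)} (V : Submodule ℝ (H10 Ω)) (h Cinv : ℝ) : Prop :=
  ∀ v ∈ V, ‖grad v‖ ≤ Cinv * h⁻¹ * ‖toL2 v‖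

/-- `U_0, …, U_N ∈ V` solves the leapfrog / convolution quadrature scheme with time step `κ`,
with initial data computed from `u₀`, `v₀` and `w₀ = ∂_t² u(0)`. -/
structure IsFullyDiscrete {d : ℕ} {Ω : Set (Euc d)} (V : Submodule ℝ (H10 Ω)) (γ a κ : ℝ) (N : ℕ)
    (f : ℝ → L2 ℝ Ω) (u₀ v₀ w₀ : H10 Ω) (U : ℕ → H10 Ω) : Prop where
  mem : ∀ n ≤ N, U n ∈ V
  init_zero : U 0 = ritz V u₀
  init_one : U 1 = ritz V (u₀ + κ • v₀) + (κ ^ 2 / 2) • l2Proj V (toL2 w₀)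
  step : ∀ n : ℕ, 1 ≤ n → n + 1 ≤ N → ∀ v ∈ V,
    ⟪toL2 ((κ ^ 2)⁻¹ • (U (n + 1) - (2 : ℝ) • U n + U (n - 1))), toL2 v⟫
      + ⟪grad (U n), grad v⟫
      + a * ⟪toL2 (cq γ κ (centralDiff κ (ritz V v₀) U) n), toL2 v⟫
      = ⟪f (n * κ), toL2 v⟫

/-! ### The terms of the error bound -/

/-- The `L²(Ω)` norm of the projection error `(R_h - I) w`. -/
def projErr {d : ℕ} {Ω : Set (Euc d)} (V : Submodule ℝ (H10 Ω)) (w : H10 Ω) : ℝ :=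
  ‖toL2 (ritz V w - w)‖

/-- `κ ∑_{j=1}^{N-1} ‖(R_h-I) ∂_t²u(t_j)‖ + ‖(R_h-I) ∂_t u(0)‖ + (κ/2) ‖(R_h-I) ∂_t²u(0)‖
  + κ ∑_{j=1}^{N-1} ‖(R_h-I) ∂_t^γ ∂_t u(t_j)‖`. -/
def spaceError {d : ℕ} {Ω : Set (Euc d)} (V : Submodule ℝ (H10 Ω)) (T γ κ : ℝ) (N : ℕ)
    (u : ℝ → H10 Ω) : ℝ :=
  κ * ∑ j ∈ Finset.Ico 1 N, projErr V (timeDeriv T 2 u (j * κ))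
    + projErr V (timeDeriv T 1 u 0)
    + κ / 2 * projErr V (timeDeriv T 2 u 0)
    + κ * ∑ j ∈ Finset.Ico 1 N, projErr V (caputo T γ (timeDeriv T 1 u) (j * κ))

/-- `‖∂_t R_h u(κ)‖ κ` if `γ < 0`, and `‖∂_t² R_h u(κ)‖ κ^{2-γ}` if `γ > 0`. -/
def dampingError {d : ℕ} {Ω : Set (Euc d)} (V : Submodule ℝ (H10 Ω)) (T γ κ : ℝ)
    (u : ℝ → H10 Ω) : ℝ :=
  if γ < 0 then ‖toL2 (ritz V (timeDeriv T 1 u κ))‖ * κ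
  else ‖toL2 (ritz V (timeDeriv T 2 u κ))‖ * κ ^ (2 - γ)

end FracWave

end

/-!
The error bound follows from stability of the scheme and consistency of its three ingredients: the
second difference quotient, the convolution quadrature, and the first step.

*Stability.* The discrete error `e = U - R_h u` solves the scheme with a residual on the right-hand
side (`error_equation`) and starts at zero. Testing with its central difference gives an energy
identity (`energy_succ_sub`). The damping term contributes with a nonnegative sign because the
generating series `δ(ζ)^γ` of the quadrature weights is accretive, meaning that its Toeplitz matrices
have nonnegative symmetric part, for every `γ ∈ [-1, 1]` (`accretive_bdfPow`). This is shown without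
complex analysis: `δ` itself is accretive by the `G`-stability of BDF2, inverses of accretive series
are accretive, and so are geometric means (`Accretive.of_sq_eq_mul`), as limits of the
arithmetic-harmonic mean iteration; hence the set of admissible exponents contains `±1` and is closed
under midpoints and limits. The CFL condition makes the energy dominate the velocity and the averaged
gradient (`le_energy`), so both are bounded by the first step and the sum of the residuals
(`energy_stability`). Poincaré's inequality (`exists_poincare`) passes from the gradient to the `L²`
and `H¹` norms, and bounds the Ritz projection in these norms.

*Consistency of the quadrature.* Since `δ(ζ) = (1 - ζ)(3 - ζ)/2`, the weights are those of
`(1 - ζ)^γ (1 + (γ/2)(1 - ζ) + …)` with a remainder that is analytic beyond the unit disc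
(`exists_bdfSeries_eq`). Together with the asymptotics of binomial coefficients this shows that the
quadrature reproduces constant, linear and quadratic functions up to decaying errors
(`isBigO_quadrature_const`, `isBigO_quadrature_linear`, `isBigO_quadrature_quadratic`). Piecewise
linear interpolation reduces a general function to these, so that the error is a multiple of the
initial value plus a discrete convolution of local errors with the kernel `t^{β-1}`
(`norm_rlIntegral_sub_quadrature_le`), which is summable over the grid by a discrete Young
inequality (`exists_sum_kernelSum_le`). For `γ < 0` this is applied to `u'`; for `γ > 0` a summation
by parts turns the quadrature into one of the increments of `u'`, and it is applied to `u''`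
(`exists_cq_truncation_of_neg`, `exists_cq_truncation_of_pos`). The multiples of `u'(0)` or `u''(0)`,
traded for the values at `κ`, produce the term `A_γ` of the bound (`sum_ritz_truncation_le`).

*Singular derivatives.* Near `t = 0` only the oscillation of `u''` over a few steps is used, which is
`O(κ + κ^α)`. After the first step the fourth derivative is available; its bound `t^{α-2}` is summed
over the grid and yields `κ^{1+α}` or `κ²` (`exists_stepBounds_timeError`), and `α ≠ 1` or `c₄ = 0`
excludes a logarithm.
-/


namespace FracWave

/-! ### Accretive power series -/

open PowerSeries in
/-- A real power series is accretive if all truncated lower triangular Toeplitz matrices built from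
its coefficients have a positive semidefinite symmetric part. -/
def Accretive (f : PowerSeries ℝ) : Prop :=
  ∀ (y : PowerSeries ℝ) (M : ℕ),
    0 ≤ ∑ n ∈ Finset.range (M + 1), coeff n (f * y) * coeff n y

namespace Accretive

open PowerSeries

lemma add {f g : PowerSeries ℝ} (hf : Accretive f) (hg : Accretive g) : Accretive (f + g) := by
  intro y M
  have := add_nonneg (hf y M) (hg y M)
  rw [← Finset.sum_add_distrib] at this
  simpa only [add_mul, map_add] using this

lemma smul {f : PowerSeries ℝ} (hf : Accretive f) {c : ℝ} (hc : 0 ≤ c) : Accretive (c • f) := by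
  intro y M
  have := mul_nonneg hc (hf y M)
  rw [Finset.mul_sum] at this
  simpa only [smul_mul_assoc, coeff_smul, smul_eq_mul, mul_assoc] using this

/-- The inverse of an accretive series is accretive: substitute `y = f z` in the quadratic form. -/
lemma of_mul_eq_one {f g : PowerSeries ℝ} (hf : Accretive f) (h : f * g = 1) : Accretive g := by
  intro y M
  have := hf (g * y) M
  rw [← mul_assoc, h, one_mul] at this
  simpa only [mul_comm] using this

/-- Accretivity only involves finitely many coefficients at a time. -/
lemma of_approx {f : PowerSeries ℝ}
    (h : ∀ M : ℕ, ∃ g, Accretive g ∧ ∀ n ≤ M, coeff n g = coeff n f) : Accretive f := by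
  intro y M
  obtain ⟨g, hg, hgf⟩ := h M
  refine (hg y M).trans_eq (Finset.sum_congr rfl fun n hn => ?_)
  rw [coeff_mul, coeff_mul]
  congr 1
  refine Finset.sum_congr rfl fun ij hij => ?_
  replace hij := Finset.HasAntidiagonal.mem_antidiagonal.mp hij
  rw [Finset.mem_range] at hn
  rw [hgf _ (by omega)]

/-- The geometric mean of two commuting accretive series is accretive. The arithmetic-harmonic
mean iteration preserves accretivity and doubles the order of contact with `R` in each step. -/
lemma of_sq_eq_mul {f g R : PowerSeries ℝ} (hf : Accretive f) (hg : Accretive g)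
    (hf1 : constantCoeff f = 1) (hR1 : constantCoeff R = 1) (h : f * g = R * R) :
    Accretive R := by
  have key : ∀ k : ℕ, ∃ p q : PowerSeries ℝ, Accretive p ∧ Accretive q ∧ p * q = R * R ∧
      X ^ (k + 1) ∣ p - R := by
    intro k
    induction k with
    | zero =>
      refine ⟨f, g, hf, hg, h, ?_⟩
      rw [zero_add, pow_one, X_dvd_iff]
      simp [hf1, hR1]
    | succ k ih =>
      obtain ⟨p, q, hp, hq, hpq, hd⟩ := ih
      have hp1 : constantCoeff p = 1 := by
        have : X ∣ p - R := (dvd_pow_self X (by omega)).trans hd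
        rw [X_dvd_iff, map_sub, hR1] at this
        linarith
      have hq1 : constantCoeff q = 1 := by
        have := congrArg constantCoeff hpq
        simpa [hp1, hR1] using this
      have hpi : p * p⁻¹ = 1 := PowerSeries.mul_inv_cancel p (by simp [hp1])
      have hqi : q * q⁻¹ = 1 := PowerSeries.mul_inv_cancel q (by simp [hq1])
      set m : PowerSeries ℝ := (1 / 2 : ℝ) • (p + q) with hm
      have hm1 : constantCoeff m = 1 := by
        rw [hm, ← coeff_zero_eq_constantCoeff_apply, coeff_smul, map_add,
          coeff_zero_eq_constantCoeff_apply, coeff_zero_eq_constantCoeff_apply, hp1, hq1]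
        norm_num
      have hmi : m * m⁻¹ = 1 := PowerSeries.mul_inv_cancel m (by simp [hm1])
      have h2 : (2 : PowerSeries ℝ) * m = p + q := by
        rw [hm, show (2 : PowerSeries ℝ) = C (2 : ℝ) from (map_ofNat C 2).symm, ← smul_eq_C_mul, smul_smul]
        norm_num
      refine ⟨m, p * q * m⁻¹, (hp.add hq).smul (by norm_num), ?_, ?_, ?_⟩
      · have hh : Accretive ((1 / 2 : ℝ) • (p⁻¹ + q⁻¹)) :=
          ((hp.of_mul_eq_one hpi).add (hq.of_mul_eq_one hqi)).smul (by norm_num)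
        refine hh.of_mul_eq_one ?_
        have h3 : (1 / 2 : ℝ) • (p⁻¹ + q⁻¹) * (p * q) = m := by
          rw [smul_mul_assoc, hm]
          congr 1
          linear_combination q * hpi + p * hqi
        rw [← mul_assoc, h3, hmi]
      · linear_combination (p * q) * hmi + hpq
      · obtain ⟨s, hs⟩ := hd
        -- Newton's iteration for the square root: the new error is quadratic in the old one
        have h4 : m - R = p⁻¹ * C (1 / 2 : ℝ) * (p - R) ^ 2 := by
          have hC : (2 : PowerSeries ℝ) * C (1 / 2 : ℝ) = 1 := by
            rw [show (2 : PowerSeries ℝ) = C (2 : ℝ) from (map_ofNat C 2).symm, ← map_mul]; norm_num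
          linear_combination (m - R) * (-hpi) - (m - R) * p * p⁻¹ * hC +
            C (1 / 2 : ℝ) * p⁻¹ * p * h2 + C (1 / 2 : ℝ) * p⁻¹ * hpq
        rw [h4, hs, mul_pow, ← pow_mul]
        refine Dvd.dvd.mul_left (Dvd.dvd.mul_right (pow_dvd_pow _ (by omega)) _) _
  refine of_approx fun M => ?_
  obtain ⟨p, q, hp, -, -, hd⟩ := key M
  refine ⟨p, hp, fun n hn => ?_⟩
  rw [X_pow_dvd_iff] at hd
  have := hd n (by omega)
  rw [map_sub] at this
  linarith

end Accretive

/-! ### The generating series of the quadrature weights -/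

/-- The power series `(1 - X)^r`. -/
noncomputable def oneSubPow (r : ℝ) : PowerSeries ℝ :=
  PowerSeries.rescale (-1 : ℝ) (PowerSeries.binomialSeries ℝ r)

lemma oneSubPow_add (r s : ℝ) : oneSubPow (r + s) = oneSubPow r * oneSubPow s := by
  simp [oneSubPow]

lemma coeff_oneSubPow (r : ℝ) (n : ℕ) :
    PowerSeries.coeff n (oneSubPow r) = (-1) ^ n * Ring.choose r n := by
  simp [oneSubPow, PowerSeries.coeff_rescale]

lemma oneSubPow_zero : oneSubPow 0 = 1 := by
  simp [oneSubPow]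

lemma oneSubPow_one : oneSubPow 1 = 1 - PowerSeries.X := by
  have := PowerSeries.binomialSeries_nat (R := ℝ) (A := ℝ) 1
  rw [Nat.cast_one, pow_one] at this
  rw [oneSubPow, this, map_add, map_one, PowerSeries.rescale_X]
  simp [sub_eq_add_neg]

/-- The power series `(1 - X)^r (1 - X/3)^r`, a multiple of the `r`-th power of the symbol of the
BDF2 method. -/
noncomputable def bdfPow (r : ℝ) : PowerSeries ℝ :=
  oneSubPow r * PowerSeries.rescale (1 / 3 : ℝ) (oneSubPow r)

lemma bdfPow_add (r s : ℝ) : bdfPow (r + s) = bdfPow r * bdfPow s := by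
  simp only [bdfPow, oneSubPow_add, map_mul]
  ring

lemma bdfPow_zero : bdfPow 0 = 1 := by
  simp [bdfPow, oneSubPow_zero]

lemma constantCoeff_bdfPow (r : ℝ) : PowerSeries.constantCoeff (bdfPow r) = 1 := by
  simp [bdfPow, ← PowerSeries.coeff_zero_eq_constantCoeff_apply, PowerSeries.coeff_mul,
    PowerSeries.coeff_rescale, coeff_oneSubPow]

lemma continuous_coeff_bdfPow (n : ℕ) : Continuous fun r => PowerSeries.coeff n (bdfPow r) := by
  have h : ∀ k : ℕ, Continuous fun r : ℝ => Ring.choose r k := by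
    intro k
    have : ∀ r : ℝ, Ring.choose r k =
        (k.factorial : ℝ)⁻¹ * Polynomial.aeval r (descPochhammer ℤ k) := by
      intro r
      rw [Ring.choose_eq_smul, Polynomial.aeval_eq_smeval, smul_eq_mul]
    simp only [this]
    exact continuous_const.mul (Polynomial.continuous_aeval _)
  simp only [bdfPow, PowerSeries.coeff_mul, PowerSeries.coeff_rescale, coeff_oneSubPow]
  fun_prop

open PowerSeries in
/-- The `G`-stability of the BDF2 method. -/
lemma accretive_bdfPow_one : Accretive (bdfPow 1) := by
  intro y M
  have hc : ∀ n, coeff (n + 2) (bdfPow 1 * y)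
      = coeff (n + 2) y - 4 / 3 * coeff (n + 1) y + 1 / 3 * coeff n y := by
    intro n
    have : bdfPow 1 * y = y - C (4 / 3 : ℝ) * (X * y) + C (1 / 3 : ℝ) * (X * (X * y)) := by
      rw [bdfPow, oneSubPow_one, map_sub, map_one, rescale_X,
        show (4 / 3 : ℝ) = 1 + 1 / 3 by norm_num, map_add, map_one]
      ring
    rw [this, map_add, map_sub, coeff_C_mul, coeff_C_mul, coeff_succ_X_mul, coeff_succ_X_mul,
      coeff_succ_X_mul]
  have hc1 : coeff 1 (bdfPow 1 * y) = coeff 1 y - 4 / 3 * coeff 0 y := by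
    have : bdfPow 1 * y = y - C (4 / 3 : ℝ) * (X * y) + C (1 / 3 : ℝ) * (X * (X * y)) := by
      rw [bdfPow, oneSubPow_one, map_sub, map_one, rescale_X,
        show (4 / 3 : ℝ) = 1 + 1 / 3 by norm_num, map_add, map_one]
      ring
    have e := coeff_succ_X_mul 0 y
    have e' := coeff_succ_X_mul 0 (X * y)
    rw [zero_add] at e e'
    rw [this, map_add, map_sub, coeff_C_mul, coeff_C_mul, e, e', coeff_zero_X_mul]
    ring
  have hc0 : coeff 0 (bdfPow 1 * y) = coeff 0 y := by
    simp [constantCoeff_bdfPow]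
  -- the accumulated quadratic form dominates the `G`-norm of `(y_m, y_{m+1})`
  have key : ∀ m, 1 / 6 * ((coeff (m + 1) y) ^ 2 + (2 * coeff (m + 1) y - coeff m y) ^ 2) ≤
      ∑ n ∈ Finset.range (m + 1 + 1), coeff n (bdfPow 1 * y) * coeff n y := by
    intro m
    induction m with
    | zero =>
      rw [Finset.sum_range_succ, Finset.sum_range_succ, Finset.sum_range_zero, hc0, hc1]
      nlinarith [sq_nonneg (coeff 1 y - 2 * coeff 0 y), sq_nonneg (coeff 0 y)]
    | succ m ih =>
      rw [Finset.sum_range_succ, hc]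
      nlinarith [sq_nonneg (coeff (m + 2) y - 2 * coeff (m + 1) y + coeff m y)]
  rcases M with _ | M
  · rw [Finset.sum_range_one, hc0]
    exact mul_self_nonneg _
  · exact le_trans (by positivity) (key M)

/-- The powers of the BDF2 symbol with exponents in `[-1, 1]` are accretive: the set of these
exponents is closed, stable under midpoints and contains `-1` and `1`. -/
lemma accretive_bdfPow {r : ℝ} (h₁ : -1 ≤ r) (h₂ : r ≤ 1) : Accretive (bdfPow r) := by
  have hneg : Accretive (bdfPow (-1)) :=
    accretive_bdfPow_one.of_mul_eq_one (by rw [← bdfPow_add]; simp [bdfPow_zero])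
  have hmid : ∀ a b, Accretive (bdfPow a) → Accretive (bdfPow b) →
      Accretive (bdfPow ((a + b) / 2)) := fun a b ha hb =>
    ha.of_sq_eq_mul hb (constantCoeff_bdfPow a) (constantCoeff_bdfPow _) (by
      rw [← bdfPow_add, ← bdfPow_add]; congr 1; ring)
  have hdy : ∀ k j : ℕ, j ≤ 2 ^ k → Accretive (bdfPow (-1 + 2 * j / 2 ^ k)) := by
    intro k
    induction k with
    | zero =>
      intro j hj
      have : j = 0 ∨ j = 1 := by simp at hj; omega
      rcases this with rfl | rfl
      · simpa using hneg
      · convert accretive_bdfPow_one using 2; norm_num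
    | succ k ih =>
      intro j hj
      rw [pow_succ] at hj
      rcases Nat.even_or_odd' j with ⟨i, rfl | rfl⟩
      · convert ih i (by omega) using 2
        push_cast
        rw [pow_succ]
        field_simp
      · convert hmid _ _ (ih i (by omega)) (ih (i + 1) (by omega)) using 2
        push_cast
        rw [pow_succ]
        field_simp
        ring
  intro y M
  -- dyadic approximations of `r`
  have hlim : Filter.Tendsto (fun k : ℕ => -1 + 2 * ((⌊((r + 1) / 2) * 2 ^ k⌋₊ : ℕ) : ℝ) / 2 ^ k)
      Filter.atTop (nhds r) := by
    have h := (tendsto_nat_floor_mul_div_atTop (R := ℝ) (a := (r + 1) / 2) (by linarith)).comp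
      (tendsto_pow_atTop_atTop_of_one_lt (one_lt_two : (1 : ℝ) < 2))
    have h2 := (h.const_mul 2).const_add (-1)
    rw [show -1 + 2 * ((r + 1) / 2) = r by ring] at h2
    refine h2.congr fun k => ?_
    simp only [Function.comp, mul_div_assoc]
  have hcont : Continuous fun r : ℝ =>
      ∑ n ∈ Finset.range (M + 1), PowerSeries.coeff n (bdfPow r * y) * PowerSeries.coeff n y := by
    simp only [PowerSeries.coeff_mul]
    refine continuous_finsetSum _ fun n _ => Continuous.mul (continuous_finsetSum _ fun i _ =>
      (continuous_coeff_bdfPow _).mul continuous_const) continuous_const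
  refine ge_of_tendsto' ((hcont.tendsto r).comp hlim) fun k => hdy k _ ?_ y M
  rw [← Nat.cast_le (α := ℝ)]
  refine (Nat.floor_le (by have : (0:ℝ) ≤ r + 1 := by linarith
                           positivity)).trans ?_
  push_cast
  have : (0 : ℝ) < 2 ^ k := by positivity
  nlinarith

/-- Finitely many vectors of an inner product space have coordinates that represent their Gram
matrix. -/
lemma exists_coords_inner {L : Type*} [NormedAddCommGroup L] [InnerProductSpace ℝ L] (g : ℕ → L)
    (M : ℕ) : ∃ (m : ℕ) (c : ℕ → Fin m → ℝ), ∀ i ≤ M, ∀ j ≤ M, ⟪g i, g j⟫ = ∑ k, c i k * c j k := by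
  let S : Submodule ℝ L := Submodule.span ℝ (g '' (Finset.range (M + 1) : Set ℕ))
  have : FiniteDimensional ℝ S :=
    FiniteDimensional.span_of_finite ℝ ((Finset.finite_toSet _).image g)
  have hmem : ∀ i ≤ M, g i ∈ S := fun i hi =>
    Submodule.subset_span ⟨i, by simpa using Nat.lt_succ_of_le hi, rfl⟩
  let b := stdOrthonormalBasis ℝ S
  refine ⟨_, fun i k => if h : i ≤ M then ⟪(⟨g i, hmem i h⟩ : S), b k⟫ else 0, fun i hi j hj => ?_⟩
  have := b.sum_inner_mul_inner (⟨g i, hmem i hi⟩ : S) ⟨g j, hmem j hj⟩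
  simp only [hi, hj, dif_pos]
  rw [Submodule.coe_inner] at this
  rw [← this]
  refine Finset.sum_congr rfl fun k _ => ?_
  rw [real_inner_comm (⟨g j, hmem j hj⟩ : S)]

/-- Accretivity, stated for scalar sequences, passes to sequences in an inner product space. -/
lemma Accretive.inner_nonneg {f : PowerSeries ℝ} (hf : Accretive f) {L : Type*}
    [NormedAddCommGroup L] [InnerProductSpace ℝ L] (g : ℕ → L) (M : ℕ) :
    0 ≤ ∑ n ∈ Finset.range (M + 1),
      ⟪∑ j ∈ Finset.range (n + 1), PowerSeries.coeff (n - j) f • g j, g n⟫ := by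
  obtain ⟨m, c, hc⟩ := exists_coords_inner g M
  have h : ∑ n ∈ Finset.range (M + 1),
      ⟪∑ j ∈ Finset.range (n + 1), PowerSeries.coeff (n - j) f • g j, g n⟫ =
      ∑ k, ∑ n ∈ Finset.range (M + 1), PowerSeries.coeff n (f * PowerSeries.mk fun n => c n k) *
        PowerSeries.coeff n (PowerSeries.mk fun n => c n k) := by
    rw [Finset.sum_comm]
    refine Finset.sum_congr rfl fun n hn => ?_
    rw [Finset.mem_range] at hn
    rw [sum_inner]
    have h1 : ∀ j ∈ Finset.range (n + 1), ⟪PowerSeries.coeff (n - j) f • g j, g n⟫ =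
        ∑ k, PowerSeries.coeff (n - j) f * c j k * c n k := by
      intro j hj
      rw [Finset.mem_range] at hj
      rw [real_inner_smul_left, hc j (by omega) n (by omega), Finset.mul_sum]
      exact Finset.sum_congr rfl fun k _ => by ring
    rw [Finset.sum_congr rfl h1, Finset.sum_comm]
    refine Finset.sum_congr rfl fun k _ => ?_
    rw [mul_comm f, PowerSeries.coeff_mul, Finset.Nat.sum_antidiagonal_eq_sum_range_succ
      (fun i j => PowerSeries.coeff i (PowerSeries.mk fun n => c n k) * PowerSeries.coeff j f),
      Finset.sum_mul]
    refine Finset.sum_congr rfl fun j _ => ?_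
    simp only [PowerSeries.coeff_mk]
    ring
  rw [h]
  exact Finset.sum_nonneg fun k _ => hf _ _

end FracWave

namespace FracWave

/-! ### The quadrature weights as Taylor coefficients -/

lemma succ_mul_choose_succ (r : ℝ) (n : ℕ) :
    ((n : ℝ) + 1) * Ring.choose r (n + 1) = (r - n) * Ring.choose r n := by
  have h := Ring.descPochhammer_eq_factorial_smul_choose r (n + 1)
  have h' := Ring.descPochhammer_eq_factorial_smul_choose r n
  rw [← Polynomial.aeval_eq_smeval, nsmul_eq_mul] at h h'
  rw [descPochhammer_succ_right, map_mul, h', Nat.factorial_succ] at h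
  have hn : (n.factorial : ℝ) ≠ 0 := by positivity
  simp at h
  apply mul_left_cancel₀ hn
  linear_combination -h

/-- The derivatives are computed on a neighbourhood of `0`, as the induction requires. -/
lemma iteratedDeriv_one_add_mul_rpow (c r : ℝ) (n : ℕ) :
    ∀ᶠ x in nhds (0 : ℝ), iteratedDeriv n (fun x : ℝ => (1 + c * x) ^ r) x =
      c ^ n * (n.factorial * Ring.choose r n) * (1 + c * x) ^ (r - n) := by
  induction n with
  | zero => simp
  | succ n ih =>
    have hpos : ∀ᶠ x in nhds (0 : ℝ), 0 < 1 + c * x := by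
      have : ContinuousAt (fun x : ℝ => 1 + c * x) 0 := by fun_prop
      exact this.eventually (lt_mem_nhds (by simp))
    filter_upwards [ih.eventually_nhds, hpos] with x hx hx0
    rw [iteratedDeriv_succ, Filter.EventuallyEq.deriv_eq hx]
    have hd : HasDerivAt (fun x : ℝ => (1 + c * x)) c x := by
      simpa using ((hasDerivAt_id x).const_mul c).const_add 1
    rw [((hd.rpow_const (p := r - n) (Or.inl hx0.ne')).const_mul _).deriv, Nat.factorial_succ]
    have := succ_mul_choose_succ r n
    push_cast
    rw [show r - (n + 1 : ℝ) = r - n - 1 by ring]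
    linear_combination (-(c ^ (n + 1) * n.factorial * (1 + c * x) ^ (r - n - 1))) * this

/-- The Taylor coefficients that define the weights are those of a formal power series: the symbol
factors as `δ(ζ) = (3/2) (1 - ζ) (1 - ζ/3)`. -/
lemma cqWeight_eq (γ : ℝ) {κ : ℝ} (hκ : 0 < κ) (n : ℕ) :
    cqWeight γ κ n = (3 / (2 * κ)) ^ γ * PowerSeries.coeff n (bdfPow γ) := by
  have hpos : ∀ c : ℝ, ∀ᶠ x in nhds (0 : ℝ), 0 < 1 + c * x := by
    intro c
    have : ContinuousAt (fun x : ℝ => 1 + c * x) 0 := by fun_prop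
    exact this.eventually (lt_mem_nhds (by simp))
  have h1 : (fun ζ : ℝ => (bdf2 ζ / κ) ^ γ) =ᶠ[nhds 0] fun ζ =>
      (3 / (2 * κ)) ^ γ * ((fun ζ : ℝ => (1 + -1 * ζ) ^ γ) * (fun ζ : ℝ => (1 + -(1 / 3) * ζ) ^ γ) : ℝ → ℝ) ζ := by
    filter_upwards [hpos (-1), hpos (-(1 / 3))] with x hx hx'
    rw [Pi.mul_apply, ← Real.mul_rpow hx.le hx'.le, ← Real.mul_rpow (by positivity) (by positivity),
      bdf2]
    congr 1
    field_simp
    ring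
  have hcd : ∀ c : ℝ, ContDiffAt ℝ n (fun ζ : ℝ => (1 + c * ζ) ^ γ) 0 := fun c =>
    ContDiffAt.rpow_const_of_ne (by fun_prop) (by simp)
  rw [cqWeight, h1.iteratedDeriv_eq, iteratedDeriv_const_mul_field,
    iteratedDeriv_mul (hcd _) (hcd _), mul_div_assoc, bdfPow, PowerSeries.coeff_mul,
    Finset.Nat.sum_antidiagonal_eq_sum_range_succ (fun i j =>
      PowerSeries.coeff i (oneSubPow γ) *
        PowerSeries.coeff j (PowerSeries.rescale (1 / 3 : ℝ) (oneSubPow γ))), Finset.sum_div]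
  congr 1
  refine Finset.sum_congr rfl fun i hi => ?_
  rw [Finset.mem_range] at hi
  rw [(iteratedDeriv_one_add_mul_rpow (-1) γ i).self_of_nhds,
    (iteratedDeriv_one_add_mul_rpow (-(1 / 3)) γ (n - i)).self_of_nhds, PowerSeries.coeff_rescale,
    coeff_oneSubPow, coeff_oneSubPow, Nat.cast_choose ℝ (by omega : i ≤ n)]
  have a1 : (n.factorial : ℝ) ≠ 0 := by positivity
  have a2 : (i.factorial : ℝ) ≠ 0 := by positivity
  have a3 : ((n - i).factorial : ℝ) ≠ 0 := by positivity
  rw [neg_eq_neg_one_mul (1 / 3 : ℝ), mul_pow]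
  simp only [mul_zero, add_zero, Real.one_rpow, mul_one]
  field_simp

end FracWave

namespace FracWave

/-! ### Asymptotics of binomial coefficients -/

open Filter Asymptotics Topology

/-- The `n`-th Taylor coefficient of `(1 - ζ)^(-μ)`. -/
noncomputable def risingCoeff (μ : ℝ) (n : ℕ) : ℝ := PowerSeries.coeff n (oneSubPow (-μ))

lemma risingCoeff_zero (μ : ℝ) : risingCoeff μ 0 = 1 := by
  simp [risingCoeff, coeff_oneSubPow]

lemma succ_mul_risingCoeff_succ (μ : ℝ) (n : ℕ) :
    ((n : ℝ) + 1) * risingCoeff μ (n + 1) = (n + μ) * risingCoeff μ n := by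
  have := succ_mul_choose_succ (-μ) n
  rw [risingCoeff, risingCoeff, coeff_oneSubPow, coeff_oneSubPow, pow_succ]
  linear_combination (-(-1 : ℝ) ^ n) * this

lemma add_mul_risingCoeff_sub_one (μ : ℝ) (n : ℕ) :
    (n + μ - 1) * risingCoeff (μ - 1) n = (μ - 1) * risingCoeff μ n := by
  induction n with
  | zero => simp [risingCoeff_zero]
  | succ n ih =>
    have h1 := succ_mul_risingCoeff_succ (μ - 1) n
    have h2 := succ_mul_risingCoeff_succ μ n
    have hn : ((n : ℝ) + 1) ≠ 0 := by positivity
    apply mul_left_cancel₀ hn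
    push_cast
    linear_combination (n + μ) * h1 - (μ - 1) * h2 + (n + μ) * ih

lemma risingCoeff_eq_prod (μ : ℝ) (n : ℕ) :
    risingCoeff μ n * n.factorial = ∏ j ∈ Finset.range n, (μ + j) := by
  induction n with
  | zero => simp [risingCoeff_zero]
  | succ n ih =>
    have h2 := succ_mul_risingCoeff_succ μ n
    rw [Finset.prod_range_succ, ← ih, Nat.factorial_succ]
    push_cast
    linear_combination (n.factorial : ℝ) * h2

lemma risingCoeff_pos {μ : ℝ} (hμ : 0 < μ) (n : ℕ) : 0 < risingCoeff μ n := by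
  have h := risingCoeff_eq_prod μ n
  have : 0 < ∏ j ∈ Finset.range n, (μ + j) := Finset.prod_pos fun j _ => by positivity
  rw [← h] at this
  exact pos_of_mul_pos_left this (by positivity)

/-- Euler's limit formula for the Gamma function. -/
lemma tendsto_risingCoeff {μ : ℝ} (hμ : 0 < μ) :
    Tendsto (fun n : ℕ => risingCoeff μ n * (n : ℝ) ^ (1 - μ)) atTop (𝓝 (Real.Gamma μ)⁻¹) := by
  have h1 := (Real.GammaSeq_tendsto_Gamma μ).inv₀ (Real.Gamma_pos_of_pos hμ).ne'
  have h2 : Tendsto (fun n : ℕ => (n : ℝ) / (n + μ)) atTop (𝓝 1) := tendsto_natCast_div_add_atTop μ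
  have h3 := h1.mul h2
  rw [mul_one] at h3
  refine h3.congr' ?_
  filter_upwards [eventually_gt_atTop 0] with n hn
  have hn' : (0 : ℝ) < n := by exact_mod_cast hn
  have h4 := risingCoeff_eq_prod μ n
  rw [Real.GammaSeq, Finset.prod_range_succ, ← h4, Real.rpow_sub hn', Real.rpow_one]
  have : (0 : ℝ) < n.factorial := by positivity
  have := Real.rpow_pos_of_pos hn' μ
  have := risingCoeff_pos hμ n
  field_simp
  ring

lemma isTheta_add_one_rpow (s : ℝ) :
    (fun n : ℕ => (n : ℝ) ^ s) =Θ[atTop] fun n : ℕ => ((n : ℝ) + 1) ^ s := by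
  have h : Tendsto (fun n : ℕ => ((n : ℝ) / (n + 1)) ^ s) atTop (𝓝 1) := by
    have := (tendsto_natCast_div_add_atTop (1 : ℝ)).rpow_const (p := s) (Or.inl one_ne_zero)
    rwa [Real.one_rpow] at this
  refine IsEquivalent.isTheta ((isEquivalent_iff_tendsto_one ?_).mpr (h.congr fun n => ?_))
  · exact Eventually.of_forall fun n => (by positivity : (0 : ℝ) < ((n : ℝ) + 1) ^ s).ne'
  · rw [Real.div_rpow (by positivity) (by positivity)]
    rfl

lemma isBigO_risingCoeff_of_pos {μ : ℝ} (hμ : 0 < μ) :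
    risingCoeff μ =O[atTop] fun n : ℕ => ((n : ℝ) + 1) ^ (μ - 1) := by
  refine IsBigO.trans_isTheta ?_ (isTheta_add_one_rpow (μ - 1))
  have h := ((tendsto_risingCoeff hμ).isBigO_one ℝ).mul
    (isBigO_refl (fun n : ℕ => (n : ℝ) ^ (μ - 1)) atTop)
  refine h.congr' ?_ (by simp)
  filter_upwards [eventually_gt_atTop 0] with n hn
  have hn' : (0 : ℝ) < n := by exact_mod_cast hn
  rw [mul_assoc, ← Real.rpow_add hn']
  simp

lemma isBigO_risingCoeff {μ : ℝ} (hμ : -1 < μ) :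
    risingCoeff μ =O[atTop] fun n : ℕ => ((n : ℝ) + 1) ^ (μ - 1) := by
  have h := isBigO_risingCoeff_of_pos (by linarith : 0 < μ + 1)
  have h1 : (fun n : ℕ => μ / ((n : ℝ) + μ)) =O[atTop] fun n : ℕ => ((n : ℝ) + 1)⁻¹ := by
    have h0 : Tendsto (fun n : ℕ => ((n : ℝ) + 1) / (n + μ)) atTop (𝓝 1) :=by
      have := (tendsto_natCast_div_add_atTop μ).div (tendsto_natCast_div_add_atTop (1 : ℝ))
        one_ne_zero
      rw [div_one] at this
      refine this.congr' ?_
      filter_upwards [eventually_gt_atTop 0, eventually_gt_atTop ⌈|μ|⌉₊] with n hn hn2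
      have hn' : (0 : ℝ) < n := by exact_mod_cast hn
      simp only [Pi.div_apply]
      field_simp
    have := ((h0.isBigO_one ℝ).const_mul_left μ).mul
      (isBigO_refl (fun n : ℕ => ((n : ℝ) + 1)⁻¹) atTop)
    refine this.congr (fun n => ?_) (by simp)
    have : (n : ℝ) + 1 ≠ 0 := by positivity
    field_simp
  refine (h1.mul h).congr' ?_ ?_
  · filter_upwards [eventually_gt_atTop 0] with n hn
    have hn' : (1 : ℝ) ≤ n := by exact_mod_cast hn
    have := add_mul_risingCoeff_sub_one (μ + 1) n
    rw [add_sub_cancel_right] at this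
    have h3 : (n : ℝ) + μ ≠ 0 := by linarith
    field_simp
    linear_combination -this
  · refine Eventually.of_forall fun n => ?_
    have : (0 : ℝ) < n + 1 := by positivity
    simp only []
    rw [show μ + 1 - 1 = (μ - 1) + 1 by ring, Real.rpow_add_one this.ne']
    field_simp

lemma isBigO_log_one_add_mul (a : ℝ) :
    (fun n : ℕ => Real.log (1 + a * (n : ℝ)⁻¹) - a * (n : ℝ)⁻¹ + a ^ 2 * ((n : ℝ)⁻¹) ^ 2 / 2)
      =O[atTop] fun n : ℕ => ((n : ℝ)⁻¹) ^ 3 := by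
  have hx : Tendsto (fun n : ℕ => (n : ℝ)⁻¹) atTop (𝓝 0) := tendsto_inv_atTop_nhds_zero_nat
  have hax : Tendsto (fun n : ℕ => |-a * (n : ℝ)⁻¹|) atTop (𝓝 0) := by
    simpa using (hx.const_mul (-a)).abs
  refine IsBigO.of_bound (2 * |a| ^ 3) ?_
  filter_upwards [hax.eventually (gt_mem_nhds (by norm_num : (0 : ℝ) < 1 / 2))] with n hn
  have := Real.abs_log_sub_add_sum_range_le (x := -a * (n : ℝ)⁻¹) (by linarith) 2
  rw [Finset.sum_range_succ, Finset.sum_range_one] at this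
  have e : Real.log (1 + a * (n : ℝ)⁻¹) - a * (n : ℝ)⁻¹ + a ^ 2 * ((n : ℝ)⁻¹) ^ 2 / 2 =
      (-a * (n : ℝ)⁻¹) ^ (0 + 1) / ((0 : ℕ) + 1) + (-a * (n : ℝ)⁻¹) ^ (1 + 1) / ((1 : ℕ) + 1) +
        Real.log (1 - -a * (n : ℝ)⁻¹) := by
    rw [show 1 - -a * (n : ℝ)⁻¹ = 1 + a * (n : ℝ)⁻¹ by ring]
    push_cast
    ring
  rw [e, Real.norm_eq_abs]
  refine this.trans ?_
  rw [div_le_iff₀ (by linarith), Real.norm_eq_abs, abs_pow, ]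
  rw [abs_mul, abs_neg] at *
  rw [mul_pow]
  have : 0 ≤ |a| ^ 3 * |(n : ℝ)⁻¹| ^ 3 := by positivity
  nlinarith

/-- A sequence tending to `1` whose consecutive quotients are `1 + O(n⁻³)` is `1 + O(n⁻²)`. -/
lemma isBigO_sub_one_of_log_ratio {r : ℕ → ℝ} (hr : Tendsto r atTop (𝓝 1))
    (h : (fun n => Real.log (r (n + 1)) - Real.log (r n)) =O[atTop] fun n : ℕ => ((n : ℝ)⁻¹) ^ 3) :
    (fun n => r n - 1) =O[atTop] fun n : ℕ => (n : ℝ) ^ (-2 : ℝ) := by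
  obtain ⟨C, hC0, hC⟩ := h.exists_pos
  have hL : Tendsto (fun n => Real.log (r n)) atTop (𝓝 0) := by
    simpa using hr.log one_ne_zero
  obtain ⟨n₀, hn₀⟩ := eventually_atTop.mp (hC.bound.and (eventually_gt_atTop 0))
  have hstep : ∀ n ≥ n₀, |Real.log (r (n + 1)) - Real.log (r n)| ≤
      8 * C * (((n : ℝ)⁻¹) ^ 2 - (((n + 1 : ℕ) : ℝ)⁻¹) ^ 2) := by
    intro n hn
    obtain ⟨h1, h2⟩ := hn₀ n hn
    have hn1 : (1 : ℝ) ≤ n := by exact_mod_cast h2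
    refine h1.trans ?_
    rw [Real.norm_of_nonneg (by positivity)]
    have : ((n : ℝ)⁻¹) ^ 3 ≤ 8 * (((n : ℝ)⁻¹) ^ 2 - (((n + 1 : ℕ) : ℝ)⁻¹) ^ 2) := by
      push_cast
      rw [← sub_nonneg]
      have : 8 * (((n : ℝ)⁻¹) ^ 2 - (((n + 1 : ℝ))⁻¹) ^ 2) - ((n : ℝ)⁻¹) ^ 3
        = (8 * n * (2 * n + 1) - (n + 1) ^ 2) / (n ^ 3 * (n + 1) ^ 2) := by
        field_simp
        ring
      rw [this]
      apply div_nonneg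
      · nlinarith
      · positivity
    nlinarith
  have hx : Tendsto (fun n : ℕ => 8 * C * ((n : ℝ)⁻¹) ^ 2) atTop (𝓝 0) := by
    simpa using ((tendsto_inv_atTop_nhds_zero_nat (𝕜 := ℝ)).pow 2).const_mul (8 * C)
  have hbd : ∀ n ≥ n₀, |Real.log (r n)| ≤ 8 * C * ((n : ℝ)⁻¹) ^ 2 := by
    intro n hn
    have h1 : ∀ m ≥ n, Real.log (r m) + 8 * C * ((m : ℝ)⁻¹) ^ 2 ≤
        Real.log (r n) + 8 * C * ((n : ℝ)⁻¹) ^ 2 := by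
      intro m hm
      induction m, hm using Nat.le_induction with
      | base => rfl
      | succ m hm ih =>
        have := (abs_le.mp (hstep m (hn.trans hm))).2
        linarith
    have h2 : ∀ m ≥ n, Real.log (r n) - 8 * C * ((n : ℝ)⁻¹) ^ 2 ≤
        Real.log (r m) - 8 * C * ((m : ℝ)⁻¹) ^ 2 := by
      intro m hm
      induction m, hm using Nat.le_induction with
      | base => rfl
      | succ m hm ih =>
        have := (abs_le.mp (hstep m (hn.trans hm))).1
        linarith
    have h3 := le_of_tendsto (hL.add hx) (eventually_atTop.mpr ⟨n, h1⟩)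
    have h4 := ge_of_tendsto (hL.sub hx) (eventually_atTop.mpr ⟨n, h2⟩)
    rw [abs_le]
    constructor <;> linarith
  refine IsBigO.of_bound (2 * (8 * C)) ?_
  have hL1 := hL.abs
  rw [abs_zero] at hL1
  filter_upwards [eventually_ge_atTop n₀, hr.eventually (lt_mem_nhds one_pos),
    hL1.eventually (gt_mem_nhds one_pos), eventually_gt_atTop 0] with n hn hpos hlt hn0
  have h5 := Real.abs_exp_sub_one_le hlt.le
  rw [Real.exp_log hpos] at h5
  have hn' : (0 : ℝ) < n := by exact_mod_cast hn0
  rw [Real.norm_eq_abs, Real.rpow_neg hn'.le, Real.norm_of_nonneg (by positivity)]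
  have h6 := hbd n hn
  rw [inv_pow] at h6
  norm_cast at *
  linarith

/-- The expansion of the coefficients of `(1 - ζ)^(-μ)` up to terms of relative order `n⁻²`. -/
lemma isBigO_risingCoeff_sub {μ : ℝ} (hμ : 1 < μ) :
    (fun n : ℕ => risingCoeff μ n - μ / 2 * risingCoeff (μ - 1) n
      - (n : ℝ) ^ (μ - 1) / Real.Gamma μ) =O[atTop] fun n : ℕ => ((n : ℝ) + 1) ^ (μ - 3) := by
  have hΓ : 0 < Real.Gamma μ := Real.Gamma_pos_of_pos (by linarith)
  -- the correction `c / (n + μ - 1)` makes the ratio of consecutive terms `1 + O(n⁻³)`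
  set c : ℝ := μ * (μ - 1) / 2 with hc
  set r : ℕ → ℝ := fun n => Real.Gamma μ * (risingCoeff μ n * (n : ℝ) ^ (1 - μ)) *
    (1 - c / (n + (μ - 1))) with hr
  have hcast : Tendsto (fun n : ℕ => (n : ℝ)) atTop atTop := tendsto_natCast_atTop_atTop
  have hlim : Tendsto r atTop (𝓝 1) := by
    have h1 := (tendsto_risingCoeff (by linarith : 0 < μ)).const_mul (Real.Gamma μ)
    have h2 : Tendsto (fun n : ℕ => 1 - c / ((n : ℝ) + (μ - 1))) atTop (𝓝 (1 - 0)) :=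
      ((tendsto_const_nhds.div_atTop (tendsto_atTop_add_const_right _ _ hcast))).const_sub 1
    have := h1.mul h2
    rwa [mul_inv_cancel₀ hΓ.ne', sub_zero, one_mul] at this
  have hlog : (fun n => Real.log (r (n + 1)) - Real.log (r n)) =O[atTop]
      fun n : ℕ => ((n : ℝ)⁻¹) ^ 3 := by
    have hO := ((((isBigO_log_one_add_mul (μ - 1)).add (isBigO_log_one_add_mul (μ - c))).sub
      ((isBigO_log_one_add_mul 1).const_mul_left μ)).sub (isBigO_log_one_add_mul (μ - 1 - c)))
    refine hO.congr' ?_ EventuallyEq.rfl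
    have hpos : ∀ a : ℝ, ∀ᶠ n : ℕ in atTop, 0 < 1 + a * (n : ℝ)⁻¹ := by
      intro a
      have : Tendsto (fun n : ℕ => 1 + a * (n : ℝ)⁻¹) atTop (𝓝 (1 + a * 0)) :=
        (tendsto_inv_atTop_nhds_zero_nat.const_mul a).const_add 1
      exact this.eventually (lt_mem_nhds (by simp))
    filter_upwards [hpos (μ - 1), hpos (μ - c), hpos 1, hpos (μ - 1 - c), eventually_gt_atTop 0,
      hlim.eventually (lt_mem_nhds one_pos)] with n h1 h2 h3 h4 hn0 hrn
    have hn : (0 : ℝ) < n := by exact_mod_cast hn0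
    have key : r (n + 1) = r n * ((1 + (μ - 1) * (n : ℝ)⁻¹) * (1 + (μ - c) * (n : ℝ)⁻¹) *
        (1 + 1 * (n : ℝ)⁻¹) ^ (-μ) / (1 + (μ - 1 - c) * (n : ℝ)⁻¹)) := by
      have e1 := succ_mul_risingCoeff_succ μ n
      have e2 : ((n + 1 : ℕ) : ℝ) = n * (1 + 1 * (n : ℝ)⁻¹) := by
        push_cast; field_simp
      have e3 : risingCoeff μ (n + 1) = (n + μ) * risingCoeff μ n / (n + 1) := by
        rw [← e1]; field_simp
      have h4' : (n : ℝ) + (μ - 1 - c) ≠ 0 := by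
        intro h0
        have : 1 + (μ - 1 - c) * (n : ℝ)⁻¹ = 0 := by
          field_simp
          linarith
        exact h4.ne' this
      have hμ1 : (n : ℝ) + (μ - 1) ≠ 0 := by linarith
      have hμ2 : (n : ℝ) + μ ≠ 0 := by linarith
      simp only [hr]
      rw [e3, e2, Real.mul_rpow hn.le h3.le, show (1 - μ) = -μ + 1 by ring,
        Real.rpow_add_one h3.ne']
      have g1 : 1 - c / ((n : ℝ) * (1 + 1 * (n : ℝ)⁻¹) + (μ - 1)) = (n + (μ - c)) / (n + μ) := by
        rw [show (n : ℝ) * (1 + 1 * (n : ℝ)⁻¹) + (μ - 1) = n + μ by field_simp; ring]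
        field_simp
        ring
      have g2 : 1 - c / ((n : ℝ) + (μ - 1)) = (n + (μ - 1 - c)) / (n + (μ - 1)) := by
        field_simp
        ring
      have g3 : ∀ a : ℝ, 1 + a * (n : ℝ)⁻¹ = (n + a) / n := fun a => by field_simp
      rw [g1, g2, g3 (μ - 1), g3 (μ - c), g3 (μ - 1 - c)]
      have g4 : 1 + 1 * (n : ℝ)⁻¹ = (n + 1) / n := g3 1
      generalize hw : (1 + 1 * (n : ℝ)⁻¹) ^ (-μ) = w
      generalize (n : ℝ) ^ (-μ + 1) = v
      rw [g4]
      field_simp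
    have hw := Real.rpow_pos_of_pos h3 (-μ)
    rw [key, Real.log_mul hrn.ne' (div_pos (mul_pos (mul_pos h1 h2) hw) h4).ne', add_sub_cancel_left,
      Real.log_div (mul_pos (mul_pos h1 h2) hw).ne' h4.ne',
      Real.log_mul (mul_pos h1 h2).ne' hw.ne', Real.log_mul h1.ne' h2.ne', Real.log_rpow h3]
    simp only [hc]
    ring
  have hO := (isBigO_sub_one_of_log_ratio hlim hlog).mul
    ((isBigO_refl (fun n : ℕ => (n : ℝ) ^ (μ - 1)) atTop).const_mul_left (Real.Gamma μ)⁻¹)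
  refine IsBigO.trans_isTheta ?_ (isTheta_add_one_rpow (μ - 3))
  refine hO.congr' ?_ ?_
  · filter_upwards [eventually_gt_atTop 0] with n hn0
    have hn : (0 : ℝ) < n := by exact_mod_cast hn0
    have e := add_mul_risingCoeff_sub_one μ n
    have hμ1 : (n : ℝ) + (μ - 1) ≠ 0 := by linarith
    have e2 : risingCoeff (μ - 1) n = (μ - 1) * risingCoeff μ n / (n + (μ - 1)) := by
      rw [← e]; field_simp; ring
    have e3 : (n : ℝ) ^ (1 - μ) * (n : ℝ) ^ (μ - 1) = 1 := by
      rw [← Real.rpow_add hn]; simp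
    simp only [hr]
    rw [e2]
    have e4 : (Real.Gamma μ * (risingCoeff μ n * (n : ℝ) ^ (1 - μ)) * (1 - c / (n + (μ - 1))) - 1) *
        ((Real.Gamma μ)⁻¹ * (n : ℝ) ^ (μ - 1)) = (Real.Gamma μ * (Real.Gamma μ)⁻¹) *
        (((n : ℝ) ^ (1 - μ) * (n : ℝ) ^ (μ - 1))) * risingCoeff μ n * (1 - c / (n + (μ - 1)))
         - (n : ℝ) ^ (μ - 1) / Real.Gamma μ := by
      rw [div_eq_mul_inv ((n : ℝ) ^ (μ - 1))]
      ring
    rw [e4, e3, mul_inv_cancel₀ hΓ.ne', hc]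
    ring
  · filter_upwards [eventually_gt_atTop 0] with n hn0
    have hn : (0 : ℝ) < n := by exact_mod_cast hn0
    rw [← Real.rpow_add hn]
    congr 1
    ring

end FracWave

namespace FracWave

/-! ### Asymptotics of the quadrature weights -/

open Filter Asymptotics Topology
open PowerSeries (coeff)

/-- The coefficients of the power series decay at least like `3⁻ⁿ`. -/
def ExpDecay (f : PowerSeries ℝ) : Prop := ∃ C : ℝ, ∀ n, |coeff n f| ≤ C * (1 / 3) ^ n

namespace ExpDecay

lemma add {f g : PowerSeries ℝ} (hf : ExpDecay f) (hg : ExpDecay g) : ExpDecay (f + g) := by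
  obtain ⟨C, hC⟩ := hf
  obtain ⟨D, hD⟩ := hg
  refine ⟨C + D, fun n => ?_⟩
  rw [map_add, add_mul]
  exact (abs_add_le _ _).trans (add_le_add (hC n) (hD n))

lemma smul {f : PowerSeries ℝ} (hf : ExpDecay f) (c : ℝ) : ExpDecay (c • f) := by
  obtain ⟨C, hC⟩ := hf
  refine ⟨|c| * C, fun n => ?_⟩
  rw [PowerSeries.coeff_smul, smul_eq_mul, abs_mul, mul_assoc]
  exact mul_le_mul_of_nonneg_left (hC n) (abs_nonneg c)

lemma one : ExpDecay 1 := by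
  refine ⟨1, fun n => ?_⟩
  rw [PowerSeries.coeff_one, one_mul]
  split_ifs with h
  · simp [h]
  · rw [abs_zero]; positivity

lemma X_mul {f : PowerSeries ℝ} (hf : ExpDecay f) : ExpDecay (PowerSeries.X * f) := by
  obtain ⟨C, hC⟩ := hf
  have hC0 : 0 ≤ C := by simpa using (abs_nonneg _).trans (hC 0)
  refine ⟨3 * C, fun n => ?_⟩
  rcases n with _ | n
  · rw [PowerSeries.coeff_zero_X_mul, abs_zero]; positivity
  · rw [PowerSeries.coeff_succ_X_mul, pow_succ]
    linarith [hC n]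

/-- Division by `1 - X` of a series with value `s` and derivative `t` at `1`. -/
lemma exists_eq_add_one_sub_X_mul {f : PowerSeries ℝ} (hf : ExpDecay f) {s t : ℝ}
    (hs : HasSum (fun n => coeff n f) s) (ht : HasSum (fun n : ℕ => n * coeff n f) t) :
    ∃ g : PowerSeries ℝ, ExpDecay g ∧ f = PowerSeries.C s + (1 - PowerSeries.X) * g ∧
      HasSum (fun n => coeff n g) (-t) := by
  obtain ⟨C, hC⟩ := hf
  have hC0 : 0 ≤ C := by simpa using (abs_nonneg _).trans (hC 0)
  -- the partial sums of `∑ fₖ - s` are minus the tails, hence decay at the same rate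
  set c : ℕ → ℝ := fun n => ∑ k ∈ Finset.range (n + 1), coeff k f - s with hc
  have hbd : ∀ n, |c n| ≤ C / 2 * (1 / 3) ^ n := by
    intro n
    have h1 := (hasSum_nat_add_iff' (n + 1)).mpr hs
    have h2 : HasSum (fun k : ℕ => C * (1 / 3) ^ (n + 1) * (1 / 3 : ℝ) ^ k)
        (C * (1 / 3) ^ (n + 1) * (1 - 1 / 3)⁻¹) :=
      (hasSum_geometric_of_lt_one (by norm_num) (by norm_num)).mul_left _
    have h3 : ‖s - ∑ k ∈ Finset.range (n + 1), coeff k f‖ ≤ C * (1 / 3) ^ (n + 1) * (1 - 1 / 3)⁻¹ := by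
      rw [← h1.tsum_eq]
      refine tsum_of_norm_bounded h2 fun k => ?_
      rw [mul_assoc, ← pow_add, Real.norm_eq_abs, add_comm (n + 1) k]
      exact hC _
    rw [hc, abs_sub_comm, ← Real.norm_eq_abs]
    refine h3.trans_eq ?_
    rw [pow_succ]; ring
  have hcn : ∀ n, c (n + 1) - c n = coeff (n + 1) f := by
    intro n
    simp only [hc]
    rw [Finset.sum_range_succ _ (n + 1)]
    ring
  refine ⟨PowerSeries.mk c, ⟨C / 2, by simpa using hbd⟩, ?_, ?_⟩
  · ext n
    rw [sub_mul, one_mul, map_add, map_sub, PowerSeries.coeff_C]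
    rcases n with _ | n
    · simp [hc]
    · rw [PowerSeries.coeff_succ_X_mul, PowerSeries.coeff_mk, PowerSeries.coeff_mk, hcn]
      simp
  · simp only [PowerSeries.coeff_mk]
    have hsum : Summable c := by
      refine Summable.of_norm_bounded ((summable_geometric_of_lt_one (r := (1 / 3 : ℝ))
        (by norm_num) (by norm_num)).mul_left (C / 2)) hbd
    -- Abel summation: `∑_{n ≤ M} n (c_n - c_{n-1}) = M c_M - ∑_{n < M} c_n`.
    have habel : ∀ M : ℕ, ∑ n ∈ Finset.range M, c n =
        M * c M - ∑ n ∈ Finset.range (M + 1), n * coeff n f := by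
      intro M
      induction M with
      | zero => simp
      | succ M ih =>
        rw [Finset.sum_range_succ, ih, Finset.sum_range_succ _ (M + 1), ← hcn]
        push_cast
        ring
    have h0 : Tendsto (fun M : ℕ => M * c M) atTop (𝓝 0) := by
      have := (tendsto_self_mul_const_pow_of_lt_one (r := (1 / 3 : ℝ)) (by norm_num)
        (by norm_num)).const_mul (C / 2)
      rw [mul_zero] at this
      refine squeeze_zero_norm (fun M => ?_) this
      rw [norm_mul, Real.norm_natCast, Real.norm_eq_abs]
      have := mul_le_mul_of_nonneg_left (hbd M) (Nat.cast_nonneg (α := ℝ) M)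
      linarith
    have h1 := h0.sub (ht.tendsto_sum_nat.comp (tendsto_add_atTop_nat 1))
    rw [zero_sub] at h1
    have h2 := h1.congr (fun M => (habel M).symm)
    exact (hsum.hasSum_iff_tendsto_nat).mpr h2

/-- Convolution with an exponentially decaying sequence preserves algebraic decay. -/
lemma isBigO_coeff_mul {f g : PowerSeries ℝ} (hg : ExpDecay g) {s : ℝ} (hs : -2 ≤ s)
    (hf : (fun n => coeff n f) =O[atTop] fun n : ℕ => ((n : ℝ) + 1) ^ s) :
    (fun n => coeff n (f * g)) =O[atTop] fun n : ℕ => ((n : ℝ) + 1) ^ s := by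
  obtain ⟨D, hD⟩ := hg
  obtain ⟨C, hC0, hC⟩ := bound_of_isBigO_nat_atTop hf
  have hD0 : 0 ≤ D := by simpa using (abs_nonneg _).trans (hD 0)
  have hsum : Summable fun j : ℕ => ((j : ℝ) + 1) ^ 2 * (1 / 3 : ℝ) ^ j := by
    have h := fun k => summable_pow_mul_geometric_of_norm_lt_one (R := ℝ) k (r := 1 / 3)
      (by norm_num)
    refine ((h 2).add (((h 1).mul_left 2).add (h 0))).congr fun j => ?_
    ring
  refine IsBigO.of_bound (C * D * ∑' j : ℕ, ((j : ℝ) + 1) ^ 2 * (1 / 3 : ℝ) ^ j)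
    (Eventually.of_forall fun n => ?_)
  rw [PowerSeries.coeff_mul, Finset.Nat.sum_antidiagonal_eq_sum_range_succ
    (fun i j => coeff i f * coeff j g), ← Finset.sum_range_reflect]
  rw [Real.norm_of_nonneg (by positivity : (0 : ℝ) ≤ ((n : ℝ) + 1) ^ s)]
  have hterm : ∀ j ∈ Finset.range (n + 1), ‖coeff (n + 1 - 1 - j) f *
      coeff (n - (n + 1 - 1 - j)) g‖ ≤
      C * D * ((n : ℝ) + 1) ^ s * (((j : ℝ) + 1) ^ 2 * (1 / 3 : ℝ) ^ j) := by
    intro j hj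
    rw [Finset.mem_range] at hj
    obtain ⟨i, rfl⟩ : ∃ i, n = i + j := ⟨n - j, by omega⟩
    rw [show i + j + 1 - 1 - j = i by omega, show i + j - i = j by omega, norm_mul]
    have h1 := hC (by positivity : ((i : ℝ) + 1) ^ s ≠ 0)
    have h2 := hD j
    rw [Real.norm_of_nonneg (by positivity : (0 : ℝ) ≤ ((i : ℝ) + 1) ^ s)] at h1
    have h3 : ((i : ℝ) + 1) ^ s ≤ (((i + j : ℕ) : ℝ) + 1) ^ s * ((j : ℝ) + 1) ^ 2 := by
      have hi : (0 : ℝ) < (i : ℝ) + 1 := by positivity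
      have hj : (0 : ℝ) < (j : ℝ) + 1 := by positivity
      have hj1 : (1 : ℝ) ≤ (j : ℝ) + 1 := by linarith [(Nat.cast_nonneg j : (0 : ℝ) ≤ j)]
      have hn : (0 : ℝ) < ((i + j : ℕ) : ℝ) + 1 := by positivity
      rcases le_total 0 s with h0 | h0
      · have a1 : ((i : ℝ) + 1) ^ s ≤ (((i + j : ℕ) : ℝ) + 1) ^ s :=
          Real.rpow_le_rpow hi.le (by push_cast; linarith) h0
        have a2 : (1 : ℝ) ≤ ((j : ℝ) + 1) ^ 2 := one_le_pow₀ hj1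
        have := Real.rpow_nonneg hn.le s
        nlinarith
      · have a1 : ((((i + j : ℕ) : ℝ) + 1)) / (j + 1) ≤ (i : ℝ) + 1 := by
          rw [div_le_iff₀ hj]
          push_cast
          nlinarith [(Nat.cast_nonneg i : (0 : ℝ) ≤ i), (Nat.cast_nonneg j : (0 : ℝ) ≤ j),
            mul_nonneg (Nat.cast_nonneg i : (0 : ℝ) ≤ i) (Nat.cast_nonneg j : (0 : ℝ) ≤ j)]
        have a2 := Real.rpow_le_rpow_of_nonpos (by positivity) a1 h0
        refine a2.trans ?_
        rw [Real.div_rpow hn.le hj.le, div_eq_mul_inv, ← Real.rpow_neg hj.le]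
        gcongr
        rw [← Real.rpow_natCast]
        exact Real.rpow_le_rpow_of_exponent_le hj1 (by push_cast; linarith)
    calc ‖coeff i f‖ * ‖coeff j g‖ ≤ (C * ((i : ℝ) + 1) ^ s) * (D * (1 / 3) ^ j) :=
          mul_le_mul h1 h2 (norm_nonneg _) (by positivity)
      _ ≤ (C * ((((i + j : ℕ) : ℝ) + 1) ^ s * ((j : ℝ) + 1) ^ 2)) * (D * (1 / 3) ^ j) := by gcongr
      _ = _ := by ring
  refine (norm_sum_le_of_le _ hterm).trans ?_
  rw [← Finset.mul_sum]
  have := hsum.sum_le_tsum (Finset.range (n + 1)) (fun j _ => by positivity)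
  have h4 : 0 ≤ C * D * ((n : ℝ) + 1) ^ s := by positivity
  calc _ ≤ C * D * ((n : ℝ) + 1) ^ s * ∑' j : ℕ, ((j : ℝ) + 1) ^ 2 * (1 / 3 : ℝ) ^ j :=
        mul_le_mul_of_nonneg_left this h4
    _ = _ := by ring

end ExpDecay

/-- The generating series `δ(ζ)^γ` of the quadrature weights for step size one. -/
noncomputable def bdfSeries (γ : ℝ) : PowerSeries ℝ := ((3 / 2 : ℝ) ^ γ) • bdfPow γ

lemma cqWeight_eq_bdfSeries (γ : ℝ) {κ : ℝ} (hκ : 0 < κ) (n : ℕ) :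
    cqWeight γ κ n = κ ^ (-γ) * coeff n (bdfSeries γ) := by
  rw [cqWeight_eq γ hκ, bdfSeries, PowerSeries.coeff_smul, smul_eq_mul, ← mul_assoc,
    Real.rpow_neg hκ.le, ← Real.inv_rpow hκ.le, ← Real.mul_rpow (by positivity) (by positivity)]
  congr 2
  field_simp

/-- The binomial series at `ζ = 1/3`. -/
lemma hasSum_risingCoeff (μ : ℝ) :
    HasSum (fun n => (1 / 3 : ℝ) ^ n * risingCoeff μ n) ((2 / 3 : ℝ) ^ (-μ)) := by
  have h := (Real.one_add_rpow_hasFPowerSeriesOnBall_zero (a := -μ)).hasSum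
    (y := (-(1 / 3) : ℝ)) (by
      rw [← ENNReal.ofReal_one, Metric.eball_ofReal]
      simp; norm_num)
  rw [zero_add, show (1 : ℝ) + -(1 / 3) = 2 / 3 by norm_num] at h
  have e : ∀ n, (1 / 3 : ℝ) ^ n * risingCoeff μ n =
      binomialSeries ℝ (-μ) n fun _ => -(1 / 3) := fun n => ?_
  · simpa only [e] using h
  rw [binomialSeries_apply, List.ofFn_const, List.prod_replicate, risingCoeff, coeff_oneSubPow,
    neg_eq_neg_one_mul (1 / 3 : ℝ), mul_pow, smul_eq_mul]
  ring

/-- Expansion of `((3 - ζ)/2)^γ` around `ζ = 1` with a remainder that is analytic in `|ζ| < 3`. -/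
lemma exists_bdfSeries_eq {γ : ℝ} (hγ : -1 < γ) (hγ' : γ < 1) :
    ∃ q : PowerSeries ℝ, ExpDecay q ∧ bdfSeries γ = oneSubPow γ *
      (1 + (1 - PowerSeries.X) * (PowerSeries.C (γ / 2) + (1 - PowerSeries.X) * q)) := by
  set b : PowerSeries ℝ := ((3 / 2 : ℝ) ^ γ) • PowerSeries.rescale (1 / 3 : ℝ) (oneSubPow γ) with hb
  have hbn : ∀ n, coeff n b = (3 / 2 : ℝ) ^ γ * ((1 / 3 : ℝ) ^ n * risingCoeff (-γ) n) := by
    intro n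
    rw [hb, PowerSeries.coeff_smul, PowerSeries.coeff_rescale, risingCoeff, neg_neg, smul_eq_mul]
  have hinv : (3 / 2 : ℝ) ^ γ * (2 / 3 : ℝ) ^ γ = 1 := by
    rw [← Real.mul_rpow (by norm_num) (by norm_num)]; norm_num
  have hdec : ExpDecay b := by
    obtain ⟨C, hC0, hC⟩ := bound_of_isBigO_nat_atTop (isBigO_risingCoeff (by linarith : -1 < -γ))
    refine ⟨(3 / 2 : ℝ) ^ γ * C, fun n => ?_⟩
    have hn : (1 : ℝ) ≤ (n : ℝ) + 1 := by linarith [(Nat.cast_nonneg n : (0 : ℝ) ≤ n)]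
    have h1 := hC (x := n) (by positivity)
    rw [Real.norm_eq_abs, Real.norm_of_nonneg (by positivity)] at h1
    have h2 : ((n : ℝ) + 1) ^ (-γ - 1) ≤ 1 := Real.rpow_le_one_of_one_le_of_nonpos hn (by linarith)
    have h3 : |risingCoeff (-γ) n| ≤ C := h1.trans (by nlinarith)
    rw [hbn, abs_mul, abs_mul, abs_of_nonneg (by positivity), abs_of_nonneg (by positivity)]
    calc _ ≤ (3 / 2 : ℝ) ^ γ * ((1 / 3) ^ n * C) := by gcongr
      _ = _ := by ring
  have hs : HasSum (fun n => coeff n b) 1 := by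
    have := (hasSum_risingCoeff (-γ)).mul_left ((3 / 2 : ℝ) ^ γ)
    rw [neg_neg, hinv] at this
    simpa only [hbn] using this
  -- the derivative of `((3 - ζ)/2)^γ` at `ζ = 1`
  have ht : HasSum (fun n : ℕ => n * coeff n b) (-(γ / 2)) := by
    rw [← hasSum_nat_add_iff' 1]
    have := (hasSum_risingCoeff (-γ + 1)).mul_left ((3 / 2 : ℝ) ^ γ * (-γ) / 3)
    rw [show -(-γ + 1) = γ - 1 by ring, Real.rpow_sub_one (by norm_num)] at this
    have e : -(γ / 2) - ∑ i ∈ Finset.range 1, (i : ℝ) * coeff i b =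
        (3 / 2 : ℝ) ^ γ * -γ / 3 * ((2 / 3 : ℝ) ^ γ / (2 / 3)) := by
      rw [Finset.sum_range_one, Nat.cast_zero, zero_mul]
      linear_combination (γ / 2) * hinv
    rw [e]
    have e' : ∀ n : ℕ, ((n + 1 : ℕ) : ℝ) * coeff (n + 1) b =
        (3 / 2 : ℝ) ^ γ * -γ / 3 * ((1 / 3 : ℝ) ^ n * risingCoeff (-γ + 1) n) := fun n => ?_
    · simpa only [e'] using this
    rw [hbn]
    have e1 := succ_mul_risingCoeff_succ (-γ) n
    have e2 := add_mul_risingCoeff_sub_one (-γ + 1) n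
    rw [add_sub_cancel_right] at e2
    push_cast
    rw [pow_succ]
    linear_combination ((3 / 2 : ℝ) ^ γ * (1 / 3) ^ n * (1 / 3)) * (e1 + e2)
  obtain ⟨c, hc, hbc, hcs⟩ := hdec.exists_eq_add_one_sub_X_mul hs ht
  rw [neg_neg] at hcs
  have hcm : Summable fun n : ℕ => (n : ℝ) * coeff n c := by
    obtain ⟨C, hC⟩ := hc
    refine Summable.of_norm_bounded
      ((summable_pow_mul_geometric_of_norm_lt_one (R := ℝ) 1 (r := 1 / 3)
      (by norm_num)).mul_left C) fun n => ?_
    rw [norm_mul, Real.norm_natCast, pow_one]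
    have := mul_le_mul_of_nonneg_left (hC n) (Nat.cast_nonneg (α := ℝ) n)
    rw [Real.norm_eq_abs]
    linarith
  obtain ⟨q, hq, hcq, -⟩ := hc.exists_eq_add_one_sub_X_mul hcs hcm.hasSum
  refine ⟨q, hq, ?_⟩
  rw [bdfSeries, bdfPow, ← mul_smul_comm, ← hb, hbc, hcq, map_one]

end FracWave

namespace FracWave

open Filter Asymptotics Topology
open PowerSeries (coeff)

lemma isBigO_rpow_rpow {s t : ℝ} (h : s ≤ t) :
    (fun n : ℕ => ((n : ℝ) + 1) ^ s) =O[atTop] fun n : ℕ => ((n : ℝ) + 1) ^ t := by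
  refine IsBigO.of_bound 1 (Eventually.of_forall fun n => ?_)
  rw [Real.norm_of_nonneg (by positivity), Real.norm_of_nonneg (by positivity), one_mul]
  exact Real.rpow_le_rpow_of_exponent_le (by linarith [(Nat.cast_nonneg n : (0 : ℝ) ≤ n)]) h

lemma coeff_oneSubPow_eq_risingCoeff (r : ℝ) (n : ℕ) :
    coeff n (oneSubPow r) = risingCoeff (-r) n := by
  rw [risingCoeff, neg_neg]

lemma ExpDecay.C_mul {f : PowerSeries ℝ} (hf : ExpDecay f) (c : ℝ) :
    ExpDecay (PowerSeries.C c * f) := by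
  rw [← PowerSeries.smul_eq_C_mul]
  exact hf.smul c

lemma ExpDecay.const (c : ℝ) : ExpDecay (PowerSeries.C c) := by
  simpa using ExpDecay.one.C_mul c

lemma ExpDecay.one_sub_X_mul {f : PowerSeries ℝ} (hf : ExpDecay f) :
    ExpDecay ((1 - PowerSeries.X) * f) := by
  have : (1 - PowerSeries.X) * f = f + (-1 : ℝ) • (PowerSeries.X * f) := by
    rw [neg_smul, one_smul]; ring
  rw [this]
  exact hf.add (hf.X_mul.smul _)

lemma isBigO_coeff_oneSubPow_mul {r : ℝ} (hr : r < 1) {q : PowerSeries ℝ} (hq : ExpDecay q) {s : ℝ}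
    (hs : -2 ≤ s) (hrs : -r - 1 ≤ s) :
    (fun n => coeff n (oneSubPow r * q)) =O[atTop] fun n : ℕ => ((n : ℝ) + 1) ^ s := by
  refine hq.isBigO_coeff_mul hs ?_
  simp only [coeff_oneSubPow_eq_risingCoeff]
  exact (isBigO_risingCoeff (by linarith)).trans (isBigO_rpow_rpow hrs)

lemma oneSubPow_mul_one_sub_X (r : ℝ) :
    oneSubPow r * (1 - PowerSeries.X) = oneSubPow (r + 1) := by
  rw [oneSubPow_add, oneSubPow_one]

section

variable {γ : ℝ} (hγ : -1 < γ) (hγ' : γ < 1)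

include hγ hγ'

/-- Decay of the quadrature weights. -/
lemma isBigO_coeff_bdfSeries :
    (fun n => coeff n (bdfSeries γ)) =O[atTop] fun n : ℕ => ((n : ℝ) + 1) ^ (-γ - 1) := by
  obtain ⟨q, hq, h⟩ := exists_bdfSeries_eq hγ hγ'
  rw [h]
  exact isBigO_coeff_oneSubPow_mul hγ' (ExpDecay.one.add
    ((ExpDecay.const _).add hq.one_sub_X_mul).one_sub_X_mul) (by linarith) le_rfl

/-- The partial sums of the weights, to leading order. -/
lemma isBigO_coeff_bdfSeries_mul_sub_risingCoeff :
    (fun n => coeff n (bdfSeries γ * oneSubPow (-1)) - risingCoeff (1 - γ) n)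
      =O[atTop] fun n : ℕ => ((n : ℝ) + 1) ^ (-γ - 1) := by
  obtain ⟨q, hq, h⟩ := exists_bdfSeries_eq hγ hγ'
  refine (isBigO_coeff_oneSubPow_mul hγ'
    ((ExpDecay.const (γ / 2)).add hq.one_sub_X_mul) (by linarith) le_rfl).congr_left fun n => ?_
  have h0 := oneSubPow_mul_one_sub_X (-1)
  rw [neg_add_cancel, oneSubPow_zero] at h0
  have h1 : bdfSeries γ * oneSubPow (-1) = oneSubPow (γ - 1) +
      oneSubPow γ * (PowerSeries.C (γ / 2) + (1 - PowerSeries.X) * q) := by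
    rw [h, sub_eq_add_neg γ 1, oneSubPow_add]
    linear_combination (oneSubPow γ * (PowerSeries.C (γ / 2) + (1 - PowerSeries.X) * q)) * h0
  rw [h1, map_add, coeff_oneSubPow_eq_risingCoeff (γ - 1), neg_sub]
  ring

/-- The convolution quadrature applied to the constant `1`, for `γ < 0`: the result differs from the
Riemann–Liouville integral `t ^ (-γ) / Γ(1 - γ)` by `O(t ^ (-γ - 1))`. -/
lemma isBigO_quadrature_const :
    γ < 0 → (fun n : ℕ => coeff n (bdfSeries γ * oneSubPow (-1))
      - (n : ℝ) ^ (-γ) / Real.Gamma (1 - γ)) =O[atTop] fun n : ℕ => ((n : ℝ) + 1) ^ (-γ - 1) := by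
  intro hneg
  have h1 := isBigO_coeff_bdfSeries_mul_sub_risingCoeff hγ hγ'
  have h2 := (isBigO_risingCoeff_sub (μ := 1 - γ) (by linarith)).trans
    (isBigO_rpow_rpow (by linarith : 1 - γ - 3 ≤ -γ - 1))
  have h3 := (isBigO_risingCoeff (μ := -γ) (by linarith)).const_mul_left ((1 - γ) / 2)
  refine ((h1.add h2).add h3).congr_left fun n => ?_
  rw [show 1 - γ - 1 = -γ by ring]
  ring

/-- Decay of the partial sums of the weights. -/
lemma isBigO_coeff_bdfSeries_mul_oneSubPow_neg_one :
    (fun n => coeff n (bdfSeries γ * oneSubPow (-1)))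
      =O[atTop] fun n : ℕ => ((n : ℝ) + 1) ^ (-γ) := by
  have h1 := (isBigO_coeff_bdfSeries_mul_sub_risingCoeff hγ hγ').trans
    (isBigO_rpow_rpow (by linarith : -γ - 1 ≤ -γ))
  have h2 := isBigO_risingCoeff (μ := 1 - γ) (by linarith)
  rw [show 1 - γ - 1 = -γ by ring] at h2
  exact (h1.add h2).congr_left fun n => by ring

/-- The convolution quadrature applied to the linear function `t`, whose coefficients are those of
`ζ (1 - ζ)⁻²`. -/
lemma isBigO_quadrature_linear :
    (fun n : ℕ => coeff n (bdfSeries γ * (PowerSeries.X * oneSubPow (-2)))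
      - (n : ℝ) ^ (1 - γ) / Real.Gamma (2 - γ)) =O[atTop]
        fun n : ℕ => ((n : ℝ) + 1) ^ (-γ - 1) := by
  obtain ⟨q, hq, h⟩ := exists_bdfSeries_eq hγ hγ'
  have hq' : ExpDecay (PowerSeries.X * q + PowerSeries.C (-(γ / 2))) :=
    hq.X_mul.add (ExpDecay.const _)
  have h1 := isBigO_coeff_oneSubPow_mul hγ' hq' (s := -γ - 1) (by linarith) le_rfl
  have h2 := (isBigO_risingCoeff_sub (μ := 2 - γ) (by linarith)).trans
    (isBigO_rpow_rpow (by linarith : 2 - γ - 3 ≤ -γ - 1))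
  refine (h1.add h2).congr_left fun n => ?_
  have e0 := oneSubPow_mul_one_sub_X (-1)
  rw [neg_add_cancel, oneSubPow_zero] at e0
  have e1 := oneSubPow_mul_one_sub_X (-2)
  rw [show (-2 : ℝ) + 1 = -1 by norm_num] at e1
  have e2 : bdfSeries γ * (PowerSeries.X * oneSubPow (-2)) = oneSubPow (γ - 2) -
      PowerSeries.C ((2 - γ) / 2) * oneSubPow (γ - 1) +
      oneSubPow γ * (PowerSeries.X * q + PowerSeries.C (-(γ / 2))) := by
    have hC : PowerSeries.C ((2 - γ) / 2) = 1 - PowerSeries.C (γ / 2) := by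
      rw [← map_one PowerSeries.C, ← map_sub]; congr 1; ring
    rw [h, sub_eq_add_neg γ 1, sub_eq_add_neg γ 2, oneSubPow_add, oneSubPow_add, hC, map_neg]
    generalize oneSubPow γ = A at *
    generalize oneSubPow (-2) = B at *
    generalize oneSubPow (-1) = D at *
    generalize PowerSeries.C (γ / 2) = g at *
    generalize (PowerSeries.X : PowerSeries ℝ) = x at *
    rw [← e1] at e0 ⊢
    linear_combination (A * (x * q - g)) * e0
  rw [e2, map_add, map_sub, PowerSeries.coeff_C_mul, coeff_oneSubPow_eq_risingCoeff (γ - 2),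
    coeff_oneSubPow_eq_risingCoeff (γ - 1), neg_sub, neg_sub, show 2 - γ - 1 = 1 - γ by ring]
  ring

/-- The convolution quadrature applied to the quadratic function `t ^ 2 / 2`, whose coefficients are
those of `ζ (1 + ζ) (1 - ζ)⁻³ / 2`. -/
lemma isBigO_quadrature_quadratic :
    (fun n : ℕ => coeff n (bdfSeries γ * (PowerSeries.X * (1 + PowerSeries.X) *
      PowerSeries.C (1 / 2) * oneSubPow (-3))) - (n : ℝ) ^ (2 - γ) / Real.Gamma (3 - γ)) =O[atTop]
        fun n : ℕ => ((n : ℝ) + 1) ^ (-γ) := by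
  obtain ⟨q, hq, h⟩ := exists_bdfSeries_eq hγ hγ'
  have hq' : ExpDecay (PowerSeries.C (1 / 2) * (PowerSeries.X * (q + PowerSeries.X * q)) +
      (PowerSeries.C (1 / 2 - 3 / 4 * γ) +
        (1 - PowerSeries.X) * PowerSeries.C (γ / 4))) :=
    ((hq.add hq.X_mul).X_mul.C_mul _).add
      ((ExpDecay.const _).add (ExpDecay.const _).one_sub_X_mul)
  have h1 := hq'.isBigO_coeff_mul (s := -γ) (f := oneSubPow (γ - 1)) (by linarith) (by
    simp only [coeff_oneSubPow_eq_risingCoeff, neg_sub]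
    convert isBigO_risingCoeff (μ := 1 - γ) (by linarith) using 3
    ring)
  have h2 := (isBigO_risingCoeff_sub (μ := 3 - γ) (by linarith)).trans
    (isBigO_rpow_rpow (by linarith : 3 - γ - 3 ≤ -γ))
  refine (h1.add h2).congr_left fun n => ?_
  have e0 := oneSubPow_mul_one_sub_X (-1)
  rw [neg_add_cancel, oneSubPow_zero] at e0
  have e1 := oneSubPow_mul_one_sub_X (-2)
  rw [show (-2 : ℝ) + 1 = -1 by norm_num] at e1
  have e3 := oneSubPow_mul_one_sub_X (-3)
  rw [show (-3 : ℝ) + 1 = -2 by norm_num] at e3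
  have e2 : bdfSeries γ * (PowerSeries.X * (1 + PowerSeries.X) *
      PowerSeries.C (1 / 2) * oneSubPow (-3)) = oneSubPow (γ - 3) -
      PowerSeries.C ((3 - γ) / 2) * oneSubPow (γ - 2) +
      oneSubPow (γ - 1) * (PowerSeries.C (1 / 2) * (PowerSeries.X * (q + PowerSeries.X * q)) +
      (PowerSeries.C (1 / 2 - 3 / 4 * γ) + (1 - PowerSeries.X) * PowerSeries.C (γ / 4))) := by
    have hC : PowerSeries.C ((3 - γ) / 2) =
        3 * PowerSeries.C (1 / 2) - 2 * PowerSeries.C (γ / 4) := by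
      rw [show (3 : PowerSeries ℝ) = PowerSeries.C (3 : ℝ) from (map_ofNat PowerSeries.C 3).symm,
        show (2 : PowerSeries ℝ) = PowerSeries.C (2 : ℝ) from (map_ofNat PowerSeries.C 2).symm,
        ← map_mul, ← map_mul, ← map_sub]
      congr 1; ring
    have hC2 : PowerSeries.C (1 / 2 - 3 / 4 * γ) =
        PowerSeries.C (1 / 2) - 3 * PowerSeries.C (γ / 4) := by
      rw [show (3 : PowerSeries ℝ) = PowerSeries.C (3 : ℝ) from (map_ofNat PowerSeries.C 3).symm,
        ← map_mul, ← map_sub]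
      congr 1; ring
    have hC3 : PowerSeries.C (γ / 2) = 2 * PowerSeries.C (γ / 4) := by
      rw [show (2 : PowerSeries ℝ) = PowerSeries.C (2 : ℝ) from (map_ofNat PowerSeries.C 2).symm,
        ← map_mul]
      congr 1; ring
    have hC4 : (2 : PowerSeries ℝ) * PowerSeries.C (1 / 2 : ℝ) = 1 := by
      rw [show (2 : PowerSeries ℝ) = PowerSeries.C (2 : ℝ) from (map_ofNat PowerSeries.C 2).symm,
        ← map_mul]
      norm_num
    rw [h, sub_eq_add_neg γ 1, sub_eq_add_neg γ 2, sub_eq_add_neg γ 3, oneSubPow_add,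
      oneSubPow_add, oneSubPow_add, hC, hC2, hC3]
    generalize oneSubPow γ = A at *
    generalize PowerSeries.C (γ / 4) = g at *
    generalize PowerSeries.C (1 / 2 : ℝ) = t at *
    generalize oneSubPow (-3) = E at *
    generalize oneSubPow (-2) = B at *
    generalize oneSubPow (-1) = D at *
    generalize (PowerSeries.X : PowerSeries ℝ) = x at *
    rw [← e1, ← e3]
    linear_combination (A * E * (1 + 2 * g * (1 - x) - 3 * g * (1 - x) ^ 2 + g * (1 - x) ^ 3)) * hC4
  generalize PowerSeries.C (1 / 2) * (PowerSeries.X * (q + PowerSeries.X * q)) +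
      (PowerSeries.C (1 / 2 - 3 / 4 * γ) + (1 - PowerSeries.X) * PowerSeries.C (γ / 4)) = Q at *
  rw [e2, map_add, map_sub, PowerSeries.coeff_C_mul, coeff_oneSubPow_eq_risingCoeff (γ - 3),
    coeff_oneSubPow_eq_risingCoeff (γ - 2), neg_sub, neg_sub, show 3 - γ - 1 = 2 - γ by ring]
  ring

end

end FracWave

namespace FracWave

/-! ### Discrete sums -/

open Finset in
lemma sum_range_conv_le {a b : ℕ → ℝ} (ha : ∀ n, 0 ≤ a n) (hb : ∀ n, 0 ≤ b n) (N : ℕ) :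
    ∑ n ∈ range N, ∑ j ∈ range (n + 1), a (n - j) * b j ≤
      (∑ n ∈ range N, a n) * ∑ j ∈ range N, b j := by
  rw [Finset.sum_mul_sum, ← Finset.sum_product']
  have h : ∑ n ∈ range N, ∑ j ∈ range (n + 1), a (n - j) * b j =
      ∑ p ∈ (range N ×ˢ range N).filter (fun p => p.1 + p.2 < N), a p.1 * b p.2 := by
    rw [Finset.sum_sigma']
    refine Finset.sum_bij' (fun x _ => (x.1 - x.2, x.2)) (fun p _ => ⟨p.1 + p.2, p.2⟩) ?_ ?_ ?_ ?_ ?_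
    · rintro ⟨n, j⟩ h
      simp only [mem_sigma, Finset.mem_range] at h
      simp only [mem_filter, mem_product, Finset.mem_range]
      omega
    · rintro ⟨i, j⟩ h
      simp only [mem_filter, mem_product, Finset.mem_range] at h
      simp only [mem_sigma, Finset.mem_range]
      omega
    · rintro ⟨n, j⟩ h
      simp only [mem_sigma, Finset.mem_range] at h
      simp only [Sigma.mk.injEq, heq_eq_eq, and_true]
      omega
    · rintro ⟨i, j⟩ h
      simp
    · rintro ⟨n, j⟩ h
      rfl
  rw [h]
  exact Finset.sum_le_sum_of_subset_of_nonneg (Finset.filter_subset _ _)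
    fun p _ _ => mul_nonneg (ha _) (hb _)

/-- The exponent `-1`, for which the sum is logarithmic, is excluded. -/
lemma exists_sum_rpow_le {s : ℝ} (hs : s ≠ -1) :
    ∃ C > 0, ∀ N : ℕ, ∑ j ∈ Finset.range N, ((j : ℝ) + 1) ^ s ≤ C * ((N : ℝ) ^ (s + 1) + 1) := by
  rcases lt_or_gt_of_ne hs with h | h
  · have hsum : Summable fun j : ℕ => ((j : ℝ) + 1) ^ s := by
      have := (summable_nat_add_iff 1).mpr (Real.summable_nat_rpow.mpr h)
      simpa using this
    refine ⟨∑' j : ℕ, ((j : ℝ) + 1) ^ s, ?_, fun N => ?_⟩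
    · exact hsum.tsum_pos (fun j => by positivity) 0 (by simp)
    · have h1 := hsum.sum_le_tsum (Finset.range N) (fun j _ => by positivity)
      have h2 : 0 ≤ ∑' j : ℕ, ((j : ℝ) + 1) ^ s := tsum_nonneg fun j => by positivity
      have h3 : 0 ≤ (N : ℝ) ^ (s + 1) := by positivity
      nlinarith
  rcases le_total 0 s with h0 | h0
  · refine ⟨1, one_pos, fun N => ?_⟩
    have : ∑ j ∈ Finset.range N, ((j : ℝ) + 1) ^ s ≤ ∑ j ∈ Finset.range N, (N : ℝ) ^ s := by
      refine Finset.sum_le_sum fun j hj => ?_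
      rw [Finset.mem_range] at hj
      exact Real.rpow_le_rpow (by positivity) (by exact_mod_cast hj) h0
    refine this.trans ?_
    rw [Finset.sum_const, Finset.card_range, nsmul_eq_mul]
    rcases Nat.eq_zero_or_pos N with rfl | hN
    · simp; positivity
    · rw [Real.rpow_add_one (by positivity)]
      linarith
  · have hp : 0 < s + 1 := by linarith
    refine ⟨(s + 1)⁻¹, by positivity, fun N => ?_⟩
    have hstep : ∀ j : ℕ, ((j : ℝ) + 1) ^ s ≤
        (s + 1)⁻¹ * (((j + 1 : ℕ) : ℝ) ^ (s + 1) - (j : ℝ) ^ (s + 1)) := by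
      intro j
      have hj : (0 : ℝ) < (j : ℝ) + 1 := by positivity
      have h1 := rpow_one_add_le_one_add_mul_self (s := -((j : ℝ) + 1)⁻¹) (p := s + 1) (by
        rw [neg_le_neg_iff]
        exact inv_le_one_of_one_le₀ (by linarith [(Nat.cast_nonneg j : (0 : ℝ) ≤ j)])) hp.le
          (by linarith)
      have h2 : (j : ℝ) = (j + 1) * (1 + -((j : ℝ) + 1)⁻¹) := by field_simp; ring
      have h3 : (j : ℝ) ^ (s + 1) ≤ ((j : ℝ) + 1) ^ (s + 1) * (1 + (s + 1) * -((j : ℝ) + 1)⁻¹) := by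
        conv_lhs => rw [h2]
        rw [Real.mul_rpow hj.le (by
          rw [← sub_eq_add_neg, sub_nonneg]
          exact inv_le_one_of_one_le₀ (by linarith [(Nat.cast_nonneg j : (0 : ℝ) ≤ j)]))]
        exact mul_le_mul_of_nonneg_left h1 (by positivity)
      rw [Real.rpow_add_one hj.ne'] at h3
      push_cast
      rw [Real.rpow_add_one hj.ne', ← div_eq_inv_mul, le_div_iff₀ hp]
      have h4 : ((j : ℝ) + 1) ^ s * (j + 1) * (1 + (s + 1) * -((j : ℝ) + 1)⁻¹) =
        ((j : ℝ) + 1) ^ s * (j + 1) - ((j : ℝ) + 1) ^ s * (s + 1) := by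
        field_simp
        ring
      linarith
    refine (Finset.sum_le_sum fun j _ => hstep j).trans ?_
    rw [← Finset.mul_sum, Finset.sum_range_sub (fun j : ℕ => (j : ℝ) ^ (s + 1))]
    gcongr
    have : (0 : ℝ) ≤ ((0 : ℕ) : ℝ) ^ (s + 1) := by positivity
    linarith

/-- The discrete convolution of a nonnegative grid function with the kernel `t ^ (β - 1)`. -/
noncomputable def kernelSum (β κ : ℝ) (ν : ℕ → ℝ) (n : ℕ) : ℝ :=
  κ ^ β * ∑ j ∈ Finset.range n, ((n : ℝ) - j) ^ (β - 1) * ν j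

/-- Young's inequality for the discrete convolution with the kernel `t ^ (β - 1)`. -/
lemma exists_sum_kernelSum_le {β : ℝ} (hβ : 0 < β) {T : ℝ} :
    ∃ C > 0, ∀ (N : ℕ) (κ : ℝ) (ν : ℕ → ℝ), 0 < κ → N * κ = T → (∀ j, 0 ≤ ν j) →
      ∑ n ∈ Finset.Ico 1 N, kernelSum β κ ν n ≤ C * ∑ j ∈ Finset.range N, ν j := by
  obtain ⟨C, hC, h⟩ := exists_sum_rpow_le (s := β - 1) (by linarith)
  rw [sub_add_cancel] at h
  refine ⟨2 * C * (|T| ^ β + 1), by positivity, fun N κ ν hκ hT hν => ?_⟩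
  rcases Nat.eq_zero_or_pos N with rfl | hN
  · simp
  have hN1 : (1 : ℝ) ≤ N := by exact_mod_cast hN
  have hT0 : 0 ≤ T := by rw [← hT]; positivity
  have hS : 0 ≤ ∑ j ∈ Finset.range N, ν j := Finset.sum_nonneg fun j _ => hν j
  have h1 : ∑ n ∈ Finset.Ico 1 N, kernelSum β κ ν n ≤ κ ^ β *
      ∑ n ∈ Finset.range N, ∑ j ∈ Finset.range (n + 1),
        (((n - j : ℕ) : ℝ) + 1) ^ (β - 1) * ν j := by
    simp only [kernelSum]
    rw [← Finset.mul_sum]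
    refine mul_le_mul_of_nonneg_left ?_ (by positivity)
    rw [Finset.sum_Ico_eq_sum_range]
    refine (Finset.sum_le_sum_of_subset_of_nonneg (Finset.range_mono (Nat.sub_le N 1))
      fun n _ _ => Finset.sum_nonneg fun j hj => ?_).trans_eq ?_
    · rw [Finset.mem_range] at hj
      have : (0 : ℝ) ≤ ((1 + n : ℕ) : ℝ) - j := by
        rw [sub_nonneg]; exact_mod_cast hj.le
      exact mul_nonneg (Real.rpow_nonneg this _) (hν j)
    · refine Finset.sum_congr rfl fun n _ => ?_
      rw [add_comm 1 n]
      refine Finset.sum_congr rfl fun j hj => ?_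
      rw [Finset.mem_range] at hj
      rw [Nat.cast_sub (by omega)]
      congr 2
      push_cast
      ring
  refine h1.trans ?_
  have h2 := sum_range_conv_le (a := fun m : ℕ => ((m : ℝ) + 1) ^ (β - 1))
    (fun n => by positivity) hν N
  have h3 := mul_le_mul_of_nonneg_right (h N) hS
  have h4 : κ ^ β * (N : ℝ) ^ β = T ^ β := by
    rw [← Real.mul_rpow hκ.le (by positivity), mul_comm, hT]
  have h5 : κ ^ β ≤ T ^ β := by
    refine Real.rpow_le_rpow hκ.le ?_ hβ.le
    rw [← hT]
    nlinarith
  rw [abs_of_nonneg hT0]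
  have h6 : κ ^ β * (C * ((N : ℝ) ^ β + 1)) ≤ 2 * C * (T ^ β + 1) := by
    nlinarith
  calc _ ≤ κ ^ β * ((C * ((N : ℝ) ^ β + 1)) * ∑ j ∈ Finset.range N, ν j) :=
        mul_le_mul_of_nonneg_left (h2.trans h3) (by positivity)
    _ = (κ ^ β * (C * ((N : ℝ) ^ β + 1))) * ∑ j ∈ Finset.range N, ν j := by ring
    _ ≤ _ := mul_le_mul_of_nonneg_right h6 hS

/-! ### Piecewise linear interpolation -/

/-- The piecewise linear interpolant of a sequence, in the variable `x = t / κ`, written with the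
hinge functions `(x - i)_+`. -/
noncomputable def hingeSum {X : Type*} [AddCommGroup X] [Module ℝ X] (g : ℕ → X) (n : ℕ) (x : ℝ) :
    X :=
  g 0 + x • (g 1 - g 0) +
    ∑ i ∈ Finset.range (n - 1), max (x - (i + 1)) 0 • (g (i + 2) - (2 : ℝ) • g (i + 1) + g i)

lemma hingeSum_eq {X : Type*} [AddCommGroup X] [Module ℝ X] (g : ℕ → X) {n j : ℕ} {x : ℝ}
    (hj : j < n) (h₁ : j ≤ x) (h₂ : x ≤ j + 1) :
    hingeSum g n x = g j + (x - j) • (g (j + 1) - g j) := by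
  have key : ∀ j : ℕ, g 0 + x • (g 1 - g 0) +
      ∑ i ∈ Finset.range j, (x - (i + 1)) • (g (i + 2) - (2 : ℝ) • g (i + 1) + g i) =
      g j + (x - j) • (g (j + 1) - g j) := by
    intro j
    induction j with
    | zero => simp
    | succ j ih =>
      rw [Finset.sum_range_succ, ← add_assoc, ih]
      push_cast
      module
  rw [← key j, hingeSum]
  congr 1
  rw [← Finset.sum_range_add_sum_Ico _ (by omega : j ≤ n - 1), Finset.sum_eq_zero (s := Finset.Ico _ _), add_zero]
  · refine Finset.sum_congr rfl fun i hi => ?_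
    rw [Finset.mem_range] at hi
    have : (i : ℝ) + 1 ≤ j := by exact_mod_cast hi
    rw [max_eq_left (by linarith)]
  · intro i hi
    rw [Finset.mem_Ico] at hi
    have : (j : ℝ) ≤ i := by exact_mod_cast hi.1
    rw [max_eq_right (by linarith), zero_smul]

lemma hingeSum_natCast {X : Type*} [AddCommGroup X] [Module ℝ X] (g : ℕ → X) {n j : ℕ}
    (hn : 1 ≤ n) (hj : j ≤ n) : hingeSum g n j = g j := by
  rcases hj.lt_or_eq with h | rfl
  · rw [hingeSum_eq g h le_rfl (by linarith)]; simp
  · obtain ⟨m, rfl⟩ : ∃ m, j = m + 1 := ⟨j - 1, by omega⟩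
    rw [hingeSum_eq g (Nat.lt_succ_self m) (by push_cast; linarith) (by push_cast; linarith)]
    push_cast
    simp

/-! ### The Riemann–Liouville integral of the interpolant -/

lemma intervalIntegrable_kernel {β : ℝ} (hβ : 0 < β) (t a b : ℝ) :
    IntervalIntegrable (fun τ : ℝ => (t - τ) ^ (β - 1)) volume a b := by
  have := (intervalIntegral.intervalIntegrable_rpow' (r := β - 1) (a := t - a) (b := t - b)
    (by linarith)).comp_sub_left t
  simpa using this

lemma intervalIntegrable_kernel_smul {X : Type} [NormedAddCommGroup X] [NormedSpace ℝ X] {β : ℝ}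
    (hβ : 0 < β) {t a b : ℝ} {g : ℝ → X} (hg : ContinuousOn g (uIcc a b)) :
    IntervalIntegrable (fun τ : ℝ => (t - τ) ^ (β - 1) • g τ) volume a b :=
  (intervalIntegrable_kernel hβ t a b).smul_continuousOn hg

lemma rlIntegral_add {X : Type} [NormedAddCommGroup X] [NormedSpace ℝ X] {β : ℝ}
    (hβ : 0 < β) {t : ℝ} {g h : ℝ → X} (hg : ContinuousOn g (uIcc 0 t))
    (hh : ContinuousOn h (uIcc 0 t)) :
    rlIntegral β (fun τ => g τ + h τ) t = rlIntegral β g t + rlIntegral β h t := by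
  simp only [rlIntegral, smul_add]
  rw [intervalIntegral.integral_add (intervalIntegrable_kernel_smul hβ hg)
    (intervalIntegrable_kernel_smul hβ hh), smul_add]

lemma rlIntegral_sub {X : Type} [NormedAddCommGroup X] [NormedSpace ℝ X] {β : ℝ}
    (hβ : 0 < β) {t : ℝ} {g h : ℝ → X} (hg : ContinuousOn g (uIcc 0 t))
    (hh : ContinuousOn h (uIcc 0 t)) :
    rlIntegral β (fun τ => g τ - h τ) t = rlIntegral β g t - rlIntegral β h t := by
  simp only [rlIntegral, smul_sub]
  rw [intervalIntegral.integral_sub (intervalIntegrable_kernel_smul hβ hg)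
    (intervalIntegrable_kernel_smul hβ hh), smul_sub]

lemma rlIntegral_sum {X : Type} [NormedAddCommGroup X] [NormedSpace ℝ X] {β : ℝ}
    (hβ : 0 < β) {t : ℝ} {s : Finset ℕ} {g : ℕ → ℝ → X}
    (hg : ∀ i ∈ s, ContinuousOn (g i) (uIcc 0 t)) :
    rlIntegral β (fun τ => ∑ i ∈ s, g i τ) t = ∑ i ∈ s, rlIntegral β (g i) t := by
  simp only [rlIntegral, Finset.smul_sum]
  rw [intervalIntegral.integral_finsetSum fun i hi => intervalIntegrable_kernel_smul hβ (hg i hi),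
    Finset.smul_sum]

lemma rlIntegral_smul_const {X : Type} [NormedAddCommGroup X] [NormedSpace ℝ X] [CompleteSpace X]
    (β t : ℝ) (φ : ℝ → ℝ) (x : X) :
    rlIntegral β (fun τ => φ τ • x) t = rlIntegral β φ t • x := by
  simp only [rlIntegral, ← smul_assoc]
  rw [intervalIntegral.integral_smul_const]
  rw [smul_eq_mul, mul_smul]

lemma rlIntegral_one {β : ℝ} (hβ : 0 < β) (t : ℝ) :
    rlIntegral β (fun _ => (1 : ℝ)) t = t ^ β / Real.Gamma (1 + β) := by
  simp only [rlIntegral, smul_eq_mul, mul_one]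
  rw [intervalIntegral.integral_comp_sub_left (fun x : ℝ => x ^ (β - 1)), sub_self, sub_zero,
    integral_rpow (Or.inl (by linarith)), sub_add_cancel, Real.zero_rpow hβ.ne', sub_zero,
    add_comm 1 β, Real.Gamma_add_one hβ.ne']
  have := Real.Gamma_pos_of_pos hβ
  field_simp

lemma rlIntegral_hinge {β : ℝ} (hβ : 0 < β) {c t : ℝ} (hc : 0 ≤ c) (hct : c ≤ t) :
    rlIntegral β (fun τ => max (τ - c) 0) t = (t - c) ^ (1 + β) / Real.Gamma (2 + β) := by
  simp only [rlIntegral, smul_eq_mul]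
  have hcont : Continuous fun τ : ℝ => max (τ - c) 0 := by fun_prop
  have hint : ∀ a b, IntervalIntegrable (fun τ : ℝ => (t - τ) ^ (β - 1) * max (τ - c) 0) volume a b :=
    fun a b => intervalIntegrable_kernel_smul hβ hcont.continuousOn
  rw [← intervalIntegral.integral_add_adjacent_intervals (hint 0 c) (hint c t)]
  have h1 : ∫ τ in (0 : ℝ)..c, (t - τ) ^ (β - 1) * max (τ - c) 0 = 0 := by
    rw [intervalIntegral.integral_congr (g := fun _ => (0 : ℝ)), intervalIntegral.integral_zero]
    intro τ hτ
    rw [uIcc_of_le hc] at hτ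
    simp only
    rw [max_eq_right (by linarith [hτ.2]), mul_zero]
  have h2 : ∫ τ in c..t, (t - τ) ^ (β - 1) * max (τ - c) 0 =
      (t - c) ^ (1 + β) / (β * (1 + β)) := by
    have e1 : ∫ τ in c..t, (t - τ) ^ (β - 1) * max (τ - c) 0 =
        ∫ τ in c..t, (fun x : ℝ => (t - c) * x ^ (β - 1) - x ^ β) (t - τ) := by
      refine intervalIntegral.integral_congr_ae ?_
      have : ∀ᵐ τ : ℝ, τ ≠ t := by simp [ae_iff, measure_singleton]
      filter_upwards [this] with τ hne hτ
      rw [uIoc_of_le hct] at hτ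
      have hpos : 0 < t - τ := by
        have := lt_of_le_of_ne hτ.2 hne
        linarith
      rw [max_eq_left (by linarith [hτ.1]), show (t - τ) ^ β = (t - τ) ^ (β - 1) * (t - τ) by
        rw [← Real.rpow_add_one hpos.ne', sub_add_cancel]]
      ring
    rw [e1, intervalIntegral.integral_comp_sub_left (fun x : ℝ => (t - c) * x ^ (β - 1) - x ^ β),
      sub_self, intervalIntegral.integral_sub,
      intervalIntegral.integral_const_mul, integral_rpow (Or.inl (by linarith)),
      integral_rpow (Or.inl (by linarith)), sub_add_cancel, Real.zero_rpow hβ.ne',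
      Real.zero_rpow (by linarith)]
    · rcases (sub_nonneg.mpr hct).eq_or_lt with h | h
      · rw [← h, Real.zero_rpow hβ.ne', add_comm 1 β, Real.zero_rpow (by linarith)]
        simp
      · rw [add_comm 1 β, Real.rpow_add_one h.ne']
        field_simp
        ring
    · exact (intervalIntegral.intervalIntegrable_rpow' (by linarith)).const_mul _
    · exact intervalIntegral.intervalIntegrable_rpow' (by linarith)
  rw [h1, h2, zero_add, show (2 : ℝ) + β = (β + 1) + 1 by ring, Real.Gamma_add_one (by linarith),
    Real.Gamma_add_one hβ.ne']
  have := Real.Gamma_pos_of_pos hβ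
  rw [add_comm 1 β]
  field_simp

lemma continuous_hingeSum {X : Type*} [NormedAddCommGroup X] [NormedSpace ℝ X] (g : ℕ → X) (n : ℕ) :
    Continuous (hingeSum g n) := by
  unfold hingeSum
  fun_prop

lemma rlIntegral_hingeSum {X : Type} [NormedAddCommGroup X] [NormedSpace ℝ X] [CompleteSpace X]
    {β κ : ℝ} (hβ : 0 < β) (hκ : 0 < κ) (g : ℕ → X) {n : ℕ} :
    rlIntegral β (fun τ => hingeSum g n (τ / κ)) (n * κ) = κ ^ β •
      (((n : ℝ) ^ β / Real.Gamma (1 + β)) • g 0 +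
        ((n : ℝ) ^ (1 + β) / Real.Gamma (2 + β)) • (g 1 - g 0) +
        ∑ i ∈ Finset.range (n - 1), (((n : ℝ) - (i + 1)) ^ (1 + β) / Real.Gamma (2 + β)) •
          (g (i + 2) - (2 : ℝ) • g (i + 1) + g i)) := by
  have hnκ : (0 : ℝ) ≤ n * κ := by positivity
  have hh : ∀ c : ℝ, 0 ≤ c → c ≤ n → rlIntegral β (fun τ => max (τ / κ - c) 0) (n * κ) =
      κ ^ β * (((n : ℝ) - c) ^ (1 + β) / Real.Gamma (2 + β)) := by
    intro c hc hcn
    have h1 := rlIntegral_hinge hβ (c := c * κ) (t := n * κ) (by positivity) (by gcongr)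
    have h2 : ∀ τ : ℝ, max (τ / κ - c) 0 = max (τ - c * κ) 0 • κ⁻¹ := by
      intro τ
      rw [smul_eq_mul, max_mul_of_nonneg _ _ (by positivity), zero_mul]
      congr 1
      field_simp
    simp only [h2]
    rw [rlIntegral_smul_const, h1, ← sub_mul, Real.mul_rpow (by linarith) hκ.le, add_comm 1 β,
      Real.rpow_add_one hκ.ne', smul_eq_mul]
    field_simp
  have h0 : rlIntegral β (fun τ => (τ / κ) • (g 1 - g 0)) (n * κ) =
      (κ ^ β * ((n : ℝ) ^ (1 + β) / Real.Gamma (2 + β))) • (g 1 - g 0) := by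
    have := hh 0 le_rfl (by positivity)
    rw [sub_zero] at this
    rw [← this, ← rlIntegral_smul_const]
    simp only [rlIntegral]
    congr 1
    refine intervalIntegral.integral_congr fun τ hτ => ?_
    rw [uIcc_of_le hnκ] at hτ
    rw [sub_zero, max_eq_left (div_nonneg hτ.1 hκ.le)]
  simp only [hingeSum]
  rw [rlIntegral_add hβ (by fun_prop) (by fun_prop), rlIntegral_add hβ (by fun_prop) (by fun_prop),
    rlIntegral_sum hβ (fun i _ => by fun_prop), h0]
  have h1 : rlIntegral β (fun _ => g 0) (n * κ) =
      (κ ^ β * ((n : ℝ) ^ β / Real.Gamma (1 + β))) • g 0 := by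
    have := rlIntegral_smul_const β (n * κ) (fun _ => 1) (g 0)
    simp only [one_smul] at this
    rw [this, rlIntegral_one hβ, Real.mul_rpow (by positivity) hκ.le]
    congr 1
    ring
  rw [h1, smul_add, smul_add, smul_smul, smul_smul, Finset.smul_sum]
  congr 1
  refine Finset.sum_congr rfl fun i hi => ?_
  rw [Finset.mem_range] at hi
  have hi' : (i : ℝ) + 1 ≤ n := by exact_mod_cast (by omega : i + 1 ≤ n)
  rw [rlIntegral_smul_const, hh _ (by positivity) hi', smul_smul]

end FracWave

namespace FracWave

/-! ### The error of a convolution quadrature -/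

lemma rpow_sub_rpow_le {β : ℝ} (hβ : 0 < β) (hβ' : β < 1) (m : ℕ) :
    ((m : ℝ) + 1) ^ β - (m : ℝ) ^ β ≤ ((m : ℝ) + 1) ^ (β - 1) := by
  have h1 : (0 : ℝ) < (m : ℝ) + 1 := by positivity
  rcases Nat.eq_zero_or_pos m with rfl | hm
  · simp [Real.zero_rpow hβ.ne']
  · have hm' : (0 : ℝ) < m := by exact_mod_cast hm
    have h2 : ((m : ℝ) + 1) ^ (β - 1) ≤ (m : ℝ) ^ (β - 1) :=
      Real.rpow_le_rpow_of_nonpos hm' (by linarith) (by linarith)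
    have h3 : ((m : ℝ) + 1) ^ β = ((m : ℝ) + 1) ^ (β - 1) * (m + 1) := by
      rw [← Real.rpow_add_one h1.ne', sub_add_cancel]
    have h4 : (m : ℝ) ^ β = (m : ℝ) ^ (β - 1) * m := by
      rw [← Real.rpow_add_one hm'.ne', sub_add_cancel]
    rw [h3, h4]
    nlinarith

/-- The Riemann–Liouville integral of a function that is small on each cell of the grid. -/
lemma norm_rlIntegral_le_kernelSum {X : Type} [NormedAddCommGroup X] [NormedSpace ℝ X]
    {β κ : ℝ} (hβ : 0 < β) (hβ' : β < 1) (hκ : 0 < κ) {n : ℕ} {G : ℝ → X}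
    (hG : ContinuousOn G (Icc 0 (n * κ))) {ν : ℕ → ℝ}
    (h : ∀ j < n, ∀ τ ∈ Icc (j * κ) ((j + 1 : ℕ) * κ), ‖G τ‖ ≤ ν j) :
    ‖rlIntegral β G (n * κ)‖ ≤ (Real.Gamma (1 + β))⁻¹ * kernelSum β κ ν n := by
  have hΓ := Real.Gamma_pos_of_pos hβ
  have hsub : ∀ j < n, uIcc ((j : ℝ) * κ) ((j + 1 : ℕ) * κ) ⊆ Icc 0 (n * κ) := by
    intro j hj
    have h1 : ((j + 1 : ℕ) : ℝ) ≤ n := by exact_mod_cast hj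
    rw [uIcc_of_le (by gcongr; omega)]
    exact Icc_subset_Icc (by positivity) (by gcongr)
  have hint : ∀ j < n, IntervalIntegrable (fun τ : ℝ => (n * κ - τ) ^ (β - 1) • G τ) volume
      (j * κ) ((j + 1 : ℕ) * κ) := fun j hj =>
    intervalIntegrable_kernel_smul hβ (hG.mono (hsub j hj))
  have hcell : ∀ j < n, ‖∫ τ in (j * κ)..((j + 1 : ℕ) * κ), (n * κ - τ) ^ (β - 1) • G τ‖ ≤
      κ ^ β / β * (((n : ℝ) - j) ^ (β - 1) * ν j) := by
    intro j hj
    have hle : (j : ℝ) * κ ≤ (j + 1 : ℕ) * κ := by gcongr; omega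
    have hν : 0 ≤ ν j := (norm_nonneg _).trans (h j hj _ (left_mem_Icc.mpr hle))
    have h1 : ((j + 1 : ℕ) : ℝ) ≤ n := by exact_mod_cast hj
    have hb := intervalIntegral.norm_integral_le_of_norm_le (μ := volume)
      (f := fun τ : ℝ => (n * κ - τ) ^ (β - 1) • G τ)
      (g := fun τ : ℝ => (n * κ - τ) ^ (β - 1) * ν j) hle
      (Filter.Eventually.of_forall fun τ hτ => by
        have h2 : 0 ≤ n * κ - τ := by
          have : ((j + 1 : ℕ) : ℝ) * κ ≤ n * κ := by gcongr
          linarith [hτ.2]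
        rw [norm_smul, Real.norm_of_nonneg (Real.rpow_nonneg h2 _)]
        exact mul_le_mul_of_nonneg_left (h j hj τ ⟨hτ.1.le, hτ.2⟩) (Real.rpow_nonneg h2 _))
      ((intervalIntegrable_kernel hβ _ _ _).mul_const _)
    refine hb.trans ?_
    obtain ⟨m, rfl⟩ : ∃ m, n = j + 1 + m := ⟨n - j - 1, by omega⟩
    have e1 : ((j + 1 + m : ℕ) : ℝ) * κ - j * κ = (m + 1) * κ := by push_cast; ring
    have e2 : ((j + 1 + m : ℕ) : ℝ) * κ - (j + 1 : ℕ) * κ = m * κ := by push_cast; ring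
    have e3 : ((j + 1 + m : ℕ) : ℝ) - j = m + 1 := by push_cast; ring
    rw [intervalIntegral.integral_mul_const,
      intervalIntegral.integral_comp_sub_left (fun x : ℝ => x ^ (β - 1)),
      integral_rpow (Or.inl (by linarith)), sub_add_cancel, e1, e2, e3,
      Real.mul_rpow (by positivity) hκ.le, Real.mul_rpow (by positivity) hκ.le, ← sub_mul,
      ← mul_assoc]
    refine mul_le_mul_of_nonneg_right ?_ hν
    rw [mul_comm, mul_div_assoc, div_eq_mul_inv, div_eq_mul_inv, mul_assoc, mul_comm β⁻¹]
    have := rpow_sub_rpow_le hβ hβ' m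
    gcongr
  have hsum := intervalIntegral.sum_integral_adjacent_intervals
    (a := fun j : ℕ => (j : ℝ) * κ) hint
  simp only [Nat.cast_zero, zero_mul] at hsum
  rw [rlIntegral, norm_smul, norm_inv, Real.norm_of_nonneg hΓ.le, ← hsum, kernelSum]
  have h3 := norm_sum_le_of_le (Finset.range n) (f := fun j : ℕ =>
    ∫ τ in (j * κ)..((j + 1 : ℕ) * κ), (n * κ - τ) ^ (β - 1) • G τ)
    (fun j hj => hcell j (Finset.mem_range.mp hj))
  rw [← Finset.mul_sum] at h3
  rw [add_comm 1 β, Real.Gamma_add_one hβ.ne', mul_inv, mul_comm β⁻¹, mul_assoc]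
  refine mul_le_mul_of_nonneg_left (h3.trans_eq ?_) (by positivity)
  ring

/-- A discrete convolution with weights decaying like `t ^ (β - 1)`. -/
lemma norm_conv_le_kernelSum {X : Type} [NormedAddCommGroup X] [NormedSpace ℝ X]
    {β κ A : ℝ} (hκ : 0 < κ) (hA : 0 ≤ A) {n : ℕ} {σ : ℕ → ℝ} {θ : ℕ → X} {ν : ℕ → ℝ}
    (hσ : ∀ m, |σ m| ≤ A * ((m : ℝ) + 1) ^ (β - 1))
    (hθ : ∀ j, 1 ≤ j → j ≤ n → ‖θ j‖ ≤ ν (j - 1)) :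
    ‖κ ^ β • ∑ j ∈ Finset.Ico 1 (n + 1), σ (n - j) • θ j‖ ≤ A * kernelSum β κ ν n := by
  rw [norm_smul, Real.norm_of_nonneg (by positivity), kernelSum, mul_left_comm]
  refine mul_le_mul_of_nonneg_left ?_ (by positivity)
  rw [Finset.sum_Ico_eq_sum_range, Finset.mul_sum, Nat.add_sub_cancel]
  refine norm_sum_le_of_le _ fun j hj => ?_
  rw [Finset.mem_range] at hj
  have h1 := hσ (n - (1 + j))
  have h2 := hθ (1 + j) (by omega) (by omega)
  rw [Nat.add_sub_cancel_left] at h2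
  rw [Nat.cast_sub (by omega)] at h1
  push_cast at h1
  rw [show (n : ℝ) - (1 + j) + 1 = n - j by ring] at h1
  rw [norm_smul, ← mul_assoc]
  have h3 : 0 ≤ (n : ℝ) - j := by rw [sub_nonneg]; exact_mod_cast hj.le
  exact mul_le_mul h1 h2 (norm_nonneg _) (mul_nonneg hA (Real.rpow_nonneg h3 _))

/-- The error of a discrete convolution as an approximation of a Riemann–Liouville integral. It is
determined by the errors made for the functions `1` and `t`, since the integrand is replaced by its
piecewise linear interpolant, a combination of `1`, `t` and shifts of `t_+`. The error for `1` is
kept as an exact multiple of `G 0`; the bound `hw` of the error for `t` enters through `A`, and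
`ν` bounds the local interpolation errors and the second differences. The weight of the node `0`
is a separate parameter `q`. -/
lemma norm_rlIntegral_sub_quadrature_le {X : Type} [NormedAddCommGroup X] [NormedSpace ℝ X]
    [CompleteSpace X] {β κ A : ℝ} (hβ : 0 < β) (hβ' : β < 1) (hκ : 0 < κ) (hA : 0 ≤ A) {n : ℕ}
    (hn : 1 ≤ n) {G : ℝ → X} (hG : ContinuousOn G (Icc 0 (n * κ))) {ν : ℕ → ℝ} {w : ℕ → ℝ} {q : ℝ}
    (hcell : ∀ j < n, ∀ τ ∈ Icc (j * κ) ((j + 1 : ℕ) * κ),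
      ‖G τ - (G (j * κ) + (τ / κ - j) • (G ((j + 1 : ℕ) * κ) - G (j * κ)))‖ ≤ ν j)
    (hD : ∀ i, i + 2 ≤ n →
      ‖G ((i + 2 : ℕ) * κ) - (2 : ℝ) • G ((i + 1 : ℕ) * κ) + G (i * κ)‖ ≤ ν i)
    (hw : ∀ m : ℕ, |∑ k ∈ Finset.range (m + 1), w (m - k) * k -
      (m : ℝ) ^ (1 + β) / Real.Gamma (2 + β)| ≤ A * ((m : ℝ) + 1) ^ (β - 1)) :
    ‖rlIntegral β G (n * κ) -
        κ ^ β • (q • G 0 + ∑ j ∈ Finset.Ico 1 (n + 1), w (n - j) • G (j * κ)) +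
        (κ ^ β * (q + ∑ j ∈ Finset.Ico 1 (n + 1), w (n - j) - (n : ℝ) ^ β / Real.Gamma (1 + β))) •
          G 0‖ ≤
      ((Real.Gamma (1 + β))⁻¹ + A) * kernelSum β κ ν n +
        A * (κ ^ β * (n : ℝ) ^ (β - 1)) * ‖G κ - G 0‖ := by
  have hnκ : (0 : ℝ) ≤ n * κ := by positivity
  set g : ℕ → X := fun j => G (j * κ) with hg
  have hg0 : g 0 = G 0 := by simp [hg]
  have hg1 : g 1 = G κ := by simp [hg]
  have hPc : Continuous fun τ : ℝ => hingeSum g n (τ / κ) :=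
    (continuous_hingeSum g n).comp (continuous_id.div_const κ)
  have hS1 : ‖rlIntegral β (fun τ => G τ - hingeSum g n (τ / κ)) (n * κ)‖ ≤
      (Real.Gamma (1 + β))⁻¹ * kernelSum β κ ν n := by
    refine norm_rlIntegral_le_kernelSum hβ hβ' hκ (hG.sub hPc.continuousOn) fun j hj τ hτ => ?_
    rw [Pi.sub_apply, hingeSum_eq g hj ((le_div_iff₀ hκ).mpr hτ.1)
      ((div_le_iff₀ hκ).mpr (by simpa using hτ.2))]
    exact hcell j hj τ hτ
  rw [rlIntegral_sub hβ (by rwa [uIcc_of_le hnκ]) hPc.continuousOn,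
    rlIntegral_hingeSum hβ hκ] at hS1
  set ℓ : ℕ → ℝ := fun m => ∑ k ∈ Finset.range (m + 1), w (m - k) * k with hℓ
  have hconv : ∀ c ≤ n, ∑ j ∈ Finset.Ico 1 (n + 1), w (n - j) * max ((j : ℝ) - c) 0 = ℓ (n - c) := by
    intro c hc
    have h1 : ∑ j ∈ Finset.Ico 1 (n + 1), w (n - j) * max ((j : ℝ) - c) 0 =
        ∑ j ∈ Finset.range (n + 1), w (n - j) * max ((j : ℝ) - c) 0 := by
      rw [← Finset.sum_range_add_sum_Ico _ (by omega : 1 ≤ n + 1), Finset.sum_range_one]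
      simp
    rw [h1, ← Finset.sum_range_add_sum_Ico _ (by omega : c ≤ n + 1),
      Finset.sum_eq_zero (s := Finset.range c), zero_add, Finset.sum_Ico_eq_sum_range, hℓ]
    · rw [show n + 1 - c = n - c + 1 by omega]
      refine Finset.sum_congr rfl fun k hk => ?_
      rw [show n - (c + k) = n - c - k by omega]
      push_cast
      rw [add_sub_cancel_left, max_eq_left (by positivity)]
    · intro i hi
      rw [Finset.mem_range] at hi
      have : (i : ℝ) ≤ c := by exact_mod_cast hi.le
      rw [max_eq_right (by linarith), mul_zero]
  have hQ : ∑ j ∈ Finset.Ico 1 (n + 1), w (n - j) • g j =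
      (∑ j ∈ Finset.Ico 1 (n + 1), w (n - j)) • g 0 + ℓ n • (g 1 - g 0) +
      ∑ i ∈ Finset.range (n - 1), ℓ (n - (i + 1)) • (g (i + 2) - (2 : ℝ) • g (i + 1) + g i) := by
    have h1 : ∀ j ∈ Finset.Ico 1 (n + 1), w (n - j) • g j = w (n - j) • g 0 +
        (w (n - j) * max ((j : ℝ) - (0 : ℕ)) 0) • (g 1 - g 0) +
        ∑ i ∈ Finset.range (n - 1), (w (n - j) * max ((j : ℝ) - (i + 1 : ℕ)) 0) •
          (g (i + 2) - (2 : ℝ) • g (i + 1) + g i) := by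
      intro j hj
      rw [Finset.mem_Ico] at hj
      conv_lhs => rw [← hingeSum_natCast g hn (by omega : j ≤ n), hingeSum]
      rw [smul_add, smul_add, smul_smul, Finset.smul_sum]
      congr 1
      · congr 2
        rw [Nat.cast_zero, sub_zero, max_eq_left (by positivity)]
      · refine Finset.sum_congr rfl fun i _ => ?_
        rw [smul_smul]
        push_cast
        rfl
    rw [Finset.sum_congr rfl h1, Finset.sum_add_distrib, Finset.sum_add_distrib, ← Finset.sum_smul,
      ← Finset.sum_smul, hconv 0 (by omega), Finset.sum_comm]
    congr 1
    refine Finset.sum_congr rfl fun i hi => ?_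
    rw [Finset.mem_range] at hi
    rw [← Finset.sum_smul, hconv (i + 1) (by omega)]
  have hcast : ∀ i ∈ Finset.range (n - 1), ((n : ℝ) - (i + 1)) = ((n - (i + 1) : ℕ) : ℝ) := by
    intro i hi
    rw [Finset.mem_range] at hi
    rw [Nat.cast_sub (by omega)]
    push_cast
    ring
  -- integral and quadrature of the interpolant compared term by term
  have hE : rlIntegral β G (n * κ) -
        κ ^ β • (q • G 0 + ∑ j ∈ Finset.Ico 1 (n + 1), w (n - j) • G (j * κ)) +
        (κ ^ β * (q + ∑ j ∈ Finset.Ico 1 (n + 1), w (n - j) - (n : ℝ) ^ β / Real.Gamma (1 + β))) •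
          G 0 =
      (rlIntegral β G (n * κ) - κ ^ β •
        (((n : ℝ) ^ β / Real.Gamma (1 + β)) • g 0 +
          ((n : ℝ) ^ (1 + β) / Real.Gamma (2 + β)) • (g 1 - g 0) +
          ∑ i ∈ Finset.range (n - 1), (((n : ℝ) - (i + 1)) ^ (1 + β) / Real.Gamma (2 + β)) •
            (g (i + 2) - (2 : ℝ) • g (i + 1) + g i))) -
      κ ^ β • ((ℓ n - (n : ℝ) ^ (1 + β) / Real.Gamma (2 + β)) • (g 1 - g 0)) -
      κ ^ β • ∑ i ∈ Finset.range (n - 1), (ℓ (n - (i + 1)) -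
          (((n : ℝ) - (i + 1)) ^ (1 + β) / Real.Gamma (2 + β))) •
            (g (i + 2) - (2 : ℝ) • g (i + 1) + g i) := by
    simp only [sub_smul _ _ (g _ - (2 : ℝ) • g _ + g _), Finset.sum_sub_distrib]
    change rlIntegral β G (n * κ) - κ ^ β • (q • G 0 + ∑ j ∈ Finset.Ico 1 (n + 1), w (n - j) • g j) +
      _ = _
    rw [hQ, ← hg0]
    module
  rw [hE, hg1, hg0]
  have hS2 : ‖κ ^ β • ((ℓ n - (n : ℝ) ^ (1 + β) / Real.Gamma (2 + β)) • (G κ - G 0))‖ ≤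
      A * (κ ^ β * (n : ℝ) ^ (β - 1)) * ‖G κ - G 0‖ := by
    rw [norm_smul, norm_smul, Real.norm_of_nonneg (by positivity), ← mul_assoc]
    refine mul_le_mul_of_nonneg_right ?_ (norm_nonneg _)
    have hn' : (0 : ℝ) < n := by exact_mod_cast hn
    have h1 : ((n : ℝ) + 1) ^ (β - 1) ≤ (n : ℝ) ^ (β - 1) :=
      Real.rpow_le_rpow_of_nonpos hn' (by linarith) (by linarith)
    calc κ ^ β * ‖ℓ n - (n : ℝ) ^ (1 + β) / Real.Gamma (2 + β)‖
        ≤ κ ^ β * (A * (n : ℝ) ^ (β - 1)) :=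
          mul_le_mul_of_nonneg_left ((hw n).trans (mul_le_mul_of_nonneg_left h1 hA)) (by positivity)
      _ = _ := by ring
  have hν0 : ∀ i < n, 0 ≤ ν i := fun i hi => (norm_nonneg _).trans (hcell i hi _
    (left_mem_Icc.mpr (by gcongr; omega)))
  have hS3 : ‖κ ^ β • ∑ i ∈ Finset.range (n - 1), (ℓ (n - (i + 1)) -
          (((n : ℝ) - (i + 1)) ^ (1 + β) / Real.Gamma (2 + β))) •
            (g (i + 2) - (2 : ℝ) • g (i + 1) + g i)‖ ≤ A * kernelSum β κ ν n := by
    rw [norm_smul, Real.norm_of_nonneg (by positivity), kernelSum, mul_left_comm]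
    refine mul_le_mul_of_nonneg_left ?_ (by positivity)
    rw [Finset.mul_sum]
    have hnn : ∀ i ∈ Finset.range n, 0 ≤ A * (((n : ℝ) - i) ^ (β - 1) * ν i) := by
      intro i hi
      rw [Finset.mem_range] at hi
      have : 0 ≤ (n : ℝ) - i := by rw [sub_nonneg]; exact_mod_cast hi.le
      exact mul_nonneg hA (mul_nonneg (Real.rpow_nonneg this _) (hν0 i hi))
    refine (norm_sum_le_of_le _ fun i hi => ?_).trans
      (Finset.sum_le_sum_of_subset_of_nonneg (Finset.range_mono (Nat.sub_le n 1))
        fun i hi _ => hnn i hi)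
    have h1 := hw (n - (i + 1))
    rw [← hcast i hi, show (n : ℝ) - (i + 1) + 1 = n - i by ring] at h1
    rw [Finset.mem_range] at hi
    rw [norm_smul, ← mul_assoc]
    have h3 : 0 ≤ (n : ℝ) - i := by rw [sub_nonneg]; exact_mod_cast (by omega : i ≤ n)
    exact mul_le_mul h1 (hD i (by omega)) (norm_nonneg _) (mul_nonneg hA (Real.rpow_nonneg h3 _))
  refine (norm_sub_le _ _).trans ?_
  have := norm_sub_le (rlIntegral β G (n * κ) - κ ^ β •
        (((n : ℝ) ^ β / Real.Gamma (1 + β)) • G 0 +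
          ((n : ℝ) ^ (1 + β) / Real.Gamma (2 + β)) • (G κ - G 0) +
          ∑ i ∈ Finset.range (n - 1), (((n : ℝ) - (i + 1)) ^ (1 + β) / Real.Gamma (2 + β)) •
            (g (i + 2) - (2 : ℝ) • g (i + 1) + g i)))
    (κ ^ β • ((ℓ n - (n : ℝ) ^ (1 + β) / Real.Gamma (2 + β)) • (G κ - G 0)))
  rw [hg1, hg0] at hS1
  linarith

end FracWave

namespace FracWave

/-! ### Local Taylor estimates -/

section Taylor

variable {X : Type} [NormedAddCommGroup X] [NormedSpace ℝ X]

lemma norm_sub_le_of_hasDerivWithinAt {f f' : ℝ → X} {a b K L : ℝ} (hL : b - a ≤ L) (hK : 0 ≤ K)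
    (hf : ∀ t ∈ Icc a b, HasDerivWithinAt f (f' t) (Icc a b) t)
    (hf' : ∀ t ∈ Icc a b, ‖f' t‖ ≤ K) {t : ℝ} (ht : t ∈ Icc a b) : ‖f t - f a‖ ≤ K * L := by
  refine (norm_image_sub_le_of_norm_deriv_le_segment' hf
    (fun x hx => hf' x (Ico_subset_Icc_self hx)) t ht).trans ?_
  exact mul_le_mul_of_nonneg_left (by linarith [ht.2]) hK

/-- Remainders of the Taylor expansion of order one of a `C¹` function. -/
lemma norm_taylor_one_le {u₁ u₂ : ℝ → X} {a b η L : ℝ} (hL : b - a ≤ L) (hη : 0 ≤ η)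
    (h₁ : ∀ t ∈ Icc a b, HasDerivWithinAt u₁ (u₂ t) (Icc a b) t)
    (h : ∀ t ∈ Icc a b, ‖u₂ t - u₂ a‖ ≤ η) {t : ℝ} (ht : t ∈ Icc a b) :
    ‖u₁ t - (u₁ a + (t - a) • u₂ a)‖ ≤ η * L := by
  have hd : ∀ t ∈ Icc a b, HasDerivWithinAt (fun t => u₁ t - (u₁ a + (t - a) • u₂ a))
      (u₂ t - u₂ a) (Icc a b) t := by
    intro t ht
    have h2 : HasDerivAt (fun t : ℝ => u₁ a + (t - a) • u₂ a) ((1 : ℝ) • u₂ a) t :=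
      (((hasDerivAt_id t).sub_const a).smul_const _).const_add _
    rw [one_smul] at h2
    exact (h₁ t ht).sub h2.hasDerivWithinAt
  have := norm_sub_le_of_hasDerivWithinAt hL hη hd h ht
  simpa using this

/-- Remainders of the Taylor expansion of order two of a `C²` function. -/
lemma norm_taylor_two_le {u₀ u₁ u₂ : ℝ → X} {a b η L : ℝ} (hL : b - a ≤ L) (hL0 : 0 ≤ L)
    (hη : 0 ≤ η)
    (h₀ : ∀ t ∈ Icc a b, HasDerivWithinAt u₀ (u₁ t) (Icc a b) t)
    (h₁ : ∀ t ∈ Icc a b, HasDerivWithinAt u₁ (u₂ t) (Icc a b) t)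
    (h : ∀ t ∈ Icc a b, ‖u₂ t - u₂ a‖ ≤ η) {t : ℝ} (ht : t ∈ Icc a b) :
    ‖u₀ t - (u₀ a + (t - a) • u₁ a + ((t - a) ^ 2 / 2) • u₂ a)‖ ≤ η * L * L := by
  have hd : ∀ t ∈ Icc a b, HasDerivWithinAt
      (fun t => u₀ t - (u₀ a + (t - a) • u₁ a + ((t - a) ^ 2 / 2) • u₂ a))
      (u₁ t - (u₁ a + (t - a) • u₂ a)) (Icc a b) t := by
    intro t ht
    have h2 : HasDerivAt (fun t : ℝ => u₀ a + (t - a) • u₁ a) ((1 : ℝ) • u₁ a) t :=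
      (((hasDerivAt_id t).sub_const a).smul_const _).const_add _
    have h3 : HasDerivAt (fun t : ℝ => ((t - a) ^ 2 / 2) • u₂ a) ((t - a) • u₂ a) t := by
      have := (((((hasDerivAt_id t).sub_const a).pow 2).div_const 2).smul_const (u₂ a))
      refine this.congr_deriv ?_
      congr 1
      simp
    rw [one_smul] at h2
    exact (h₀ t ht).sub (h2.add h3).hasDerivWithinAt
  have := norm_sub_le_of_hasDerivWithinAt hL (mul_nonneg hη hL0) hd
    (fun t ht => norm_taylor_one_le hL hη h₁ h ht) ht
  simpa using this

/-- Remainders of the Taylor expansion of order three. -/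
lemma norm_taylor_three_le {u₀ u₁ u₂ u₃ : ℝ → X} {a b η L : ℝ} (hL : b - a ≤ L) (hL0 : 0 ≤ L)
    (hη : 0 ≤ η)
    (h₀ : ∀ t ∈ Icc a b, HasDerivWithinAt u₀ (u₁ t) (Icc a b) t)
    (h₁ : ∀ t ∈ Icc a b, HasDerivWithinAt u₁ (u₂ t) (Icc a b) t)
    (h₂ : ∀ t ∈ Icc a b, HasDerivWithinAt u₂ (u₃ t) (Icc a b) t)
    (h : ∀ t ∈ Icc a b, ‖u₃ t - u₃ a‖ ≤ η) {t : ℝ} (ht : t ∈ Icc a b) :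
    ‖u₀ t - (u₀ a + (t - a) • u₁ a + ((t - a) ^ 2 / 2) • u₂ a + ((t - a) ^ 3 / 6) • u₃ a)‖ ≤
      η * L * L * L := by
  have hd : ∀ t ∈ Icc a b, HasDerivWithinAt (fun t => u₀ t -
      (u₀ a + (t - a) • u₁ a + ((t - a) ^ 2 / 2) • u₂ a + ((t - a) ^ 3 / 6) • u₃ a))
      (u₁ t - (u₁ a + (t - a) • u₂ a + ((t - a) ^ 2 / 2) • u₃ a)) (Icc a b) t := by
    intro t ht
    have h2 : HasDerivAt (fun t : ℝ => u₀ a + (t - a) • u₁ a) ((1 : ℝ) • u₁ a) t :=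
      (((hasDerivAt_id t).sub_const a).smul_const _).const_add _
    have h3 : HasDerivAt (fun t : ℝ => ((t - a) ^ 2 / 2) • u₂ a) ((t - a) • u₂ a) t := by
      have := (((((hasDerivAt_id t).sub_const a).pow 2).div_const 2).smul_const (u₂ a))
      refine this.congr_deriv ?_
      congr 1
      simp
    have h4 : HasDerivAt (fun t : ℝ => ((t - a) ^ 3 / 6) • u₃ a) (((t - a) ^ 2 / 2) • u₃ a) t := by
      have := (((((hasDerivAt_id t).sub_const a).pow 3).div_const 6).smul_const (u₃ a))
      refine this.congr_deriv ?_
      congr 1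
      simp
      ring
    rw [one_smul] at h2
    exact (h₀ t ht).sub ((h2.add h3).add h4).hasDerivWithinAt
  have := norm_sub_le_of_hasDerivWithinAt hL (mul_nonneg (mul_nonneg hη hL0) hL0) hd
    (fun t ht => norm_taylor_two_le hL hL0 hη h₁ h₂ h ht) ht
  simpa using this

lemma norm_lin_sub_le {x y : X} {θ B₁ B₂ : ℝ} (h₀ : 0 ≤ θ) (h₁ : θ ≤ 1) (hx : ‖x‖ ≤ B₁)
    (hy : ‖y‖ ≤ B₂) : ‖x - θ • y‖ ≤ B₁ + B₂ := by
  refine (norm_sub_le _ _).trans (add_le_add hx ?_)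
  rw [norm_smul, Real.norm_of_nonneg h₀]
  nlinarith [norm_nonneg y]

/-- Error of linear interpolation in terms of the oscillation of the derivative. -/
lemma norm_interp_le_of_osc {u₁ u₂ : ℝ → X} {a κ η : ℝ} (hκ : 0 < κ) (hη : 0 ≤ η)
    (h₁ : ∀ t ∈ Icc a (a + κ), HasDerivWithinAt u₁ (u₂ t) (Icc a (a + κ)) t)
    (h : ∀ t ∈ Icc a (a + κ), ‖u₂ t - u₂ a‖ ≤ η) {t : ℝ} (ht : t ∈ Icc a (a + κ)) :
    ‖u₁ t - (u₁ a + ((t - a) / κ) • (u₁ (a + κ) - u₁ a))‖ ≤ 2 * (κ * η) := by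
  have hb : a + κ ∈ Icc a (a + κ) := ⟨by linarith, le_rfl⟩
  have e1 := norm_taylor_one_le (L := κ) (by linarith) hη h₁ h ht
  have e2 := norm_taylor_one_le (L := κ) (by linarith) hη h₁ h hb
  have hθ0 : 0 ≤ (t - a) / κ := div_nonneg (by linarith [ht.1]) hκ.le
  have hθ1 : (t - a) / κ ≤ 1 := by rw [div_le_one hκ]; linarith [ht.2]
  have := norm_lin_sub_le hθ0 hθ1 e1 e2
  refine le_trans (le_of_eq ?_) (this.trans_eq (by ring))
  congr 1
  match_scalars <;> field_simp <;> ring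

/-- Error of linear interpolation in terms of the second derivative. -/
lemma norm_interp_le_of_deriv {u₂ u₃ u₄ : ℝ → X} {a κ S : ℝ} (hκ : 0 < κ) (hS : 0 ≤ S)
    (h₂ : ∀ t ∈ Icc a (a + κ), HasDerivWithinAt u₂ (u₃ t) (Icc a (a + κ)) t)
    (h₃ : ∀ t ∈ Icc a (a + κ), HasDerivWithinAt u₃ (u₄ t) (Icc a (a + κ)) t)
    (h : ∀ t ∈ Icc a (a + κ), ‖u₄ t‖ ≤ S) {t : ℝ} (ht : t ∈ Icc a (a + κ)) :
    ‖u₂ t - (u₂ a + ((t - a) / κ) • (u₂ (a + κ) - u₂ a))‖ ≤ 2 * (κ ^ 2 * S) := by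
  have := norm_interp_le_of_osc hκ (mul_nonneg hS hκ.le) h₂
    (fun t ht => norm_sub_le_of_hasDerivWithinAt (L := κ) (by linarith) hS h₃ h ht) ht
  refine this.trans_eq (by ring)

/-- Second differences in terms of the oscillation of the derivative. -/
lemma norm_second_diff_le_of_osc {u₁ u₂ : ℝ → X} {a κ η : ℝ} (hκ : 0 < κ) (hη : 0 ≤ η)
    (h₁ : ∀ t ∈ Icc a (a + 2 * κ), HasDerivWithinAt u₁ (u₂ t) (Icc a (a + 2 * κ)) t)
    (h : ∀ t ∈ Icc a (a + 2 * κ), ‖u₂ t - u₂ a‖ ≤ η) :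
    ‖u₁ (a + 2 * κ) - (2 : ℝ) • u₁ (a + κ) + u₁ a‖ ≤ 6 * (κ * η) := by
  have e1 := norm_taylor_one_le (L := 2 * κ) (by linarith) hη h₁ h (t := a + κ)
    ⟨by linarith, by linarith⟩
  have e2 := norm_taylor_one_le (L := 2 * κ) (by linarith) hη h₁ h (t := a + 2 * κ)
    ⟨by linarith, by linarith⟩
  set r₁ := u₁ (a + κ) - (u₁ a + (a + κ - a) • u₂ a) with hr₁
  set r₂ := u₁ (a + 2 * κ) - (u₁ a + (a + 2 * κ - a) • u₂ a) with hr₂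
  have : u₁ (a + 2 * κ) - (2 : ℝ) • u₁ (a + κ) + u₁ a = r₂ - (2 : ℝ) • r₁ := by
    rw [hr₁, hr₂]; module
  rw [this]
  refine (norm_sub_le _ _).trans ?_
  rw [norm_smul, Real.norm_ofNat]
  linarith

lemma norm_second_diff_le_of_deriv {u₂ u₃ u₄ : ℝ → X} {a κ S : ℝ} (hκ : 0 < κ) (hS : 0 ≤ S)
    (h₂ : ∀ t ∈ Icc a (a + 2 * κ), HasDerivWithinAt u₂ (u₃ t) (Icc a (a + 2 * κ)) t)
    (h₃ : ∀ t ∈ Icc a (a + 2 * κ), HasDerivWithinAt u₃ (u₄ t) (Icc a (a + 2 * κ)) t)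
    (h : ∀ t ∈ Icc a (a + 2 * κ), ‖u₄ t‖ ≤ S) :
    ‖u₂ (a + 2 * κ) - (2 : ℝ) • u₂ (a + κ) + u₂ a‖ ≤ 12 * (κ ^ 2 * S) := by
  have := norm_second_diff_le_of_osc hκ (η := S * (2 * κ)) (by positivity) h₂
    (fun t ht => norm_sub_le_of_hasDerivWithinAt (L := 2 * κ) (by linarith) hS h₃ h ht)
  refine this.trans_eq (by ring)

/-- The central difference quotient as an approximation of the derivative. -/
lemma norm_central_diff_le {u₀ u₁ u₂ : ℝ → X} {a κ η : ℝ} (hκ : 0 < κ) (hη : 0 ≤ η)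
    (h₀ : ∀ t ∈ Icc a (a + 2 * κ), HasDerivWithinAt u₀ (u₁ t) (Icc a (a + 2 * κ)) t)
    (h₁ : ∀ t ∈ Icc a (a + 2 * κ), HasDerivWithinAt u₁ (u₂ t) (Icc a (a + 2 * κ)) t)
    (h : ∀ t ∈ Icc a (a + 2 * κ), ‖u₂ t - u₂ a‖ ≤ η) :
    ‖u₁ (a + κ) - (2 * κ)⁻¹ • (u₀ (a + 2 * κ) - u₀ a)‖ ≤ 4 * (κ * η) := by
  have e1 := norm_taylor_one_le (L := 2 * κ) (by linarith) hη h₁ h (t := a + κ)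
    ⟨by linarith, by linarith⟩
  have e2 := norm_taylor_two_le (L := 2 * κ) (by linarith) (by linarith) hη h₀ h₁ h
    (t := a + 2 * κ) ⟨by linarith, by linarith⟩
  set r₁ := u₁ (a + κ) - (u₁ a + (a + κ - a) • u₂ a) with hr₁
  set r₂ := u₀ (a + 2 * κ) - (u₀ a + (a + 2 * κ - a) • u₁ a + ((a + 2 * κ - a) ^ 2 / 2) • u₂ a)
    with hr₂
  have : u₁ (a + κ) - (2 * κ)⁻¹ • (u₀ (a + 2 * κ) - u₀ a) = r₁ - (2 * κ)⁻¹ • r₂ := by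
    rw [hr₁, hr₂]
    match_scalars <;> field_simp <;> ring
  rw [this]
  refine (norm_sub_le _ _).trans ?_
  rw [norm_smul, Real.norm_of_nonneg (by positivity)]
  have : (2 * κ)⁻¹ * ‖r₂‖ ≤ (2 * κ)⁻¹ * (η * (2 * κ) * (2 * κ)) := by gcongr
  have e3 : (2 * κ)⁻¹ * (η * (2 * κ) * (2 * κ)) = 2 * (κ * η) := by field_simp
  linarith

/-- The second difference quotient as an approximation of the second derivative. -/
lemma norm_second_deriv_sub_le_of_osc {u₀ u₁ u₂ : ℝ → X} {a κ η : ℝ} (hκ : 0 < κ) (hη : 0 ≤ η)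
    (h₀ : ∀ t ∈ Icc a (a + 2 * κ), HasDerivWithinAt u₀ (u₁ t) (Icc a (a + 2 * κ)) t)
    (h₁ : ∀ t ∈ Icc a (a + 2 * κ), HasDerivWithinAt u₁ (u₂ t) (Icc a (a + 2 * κ)) t)
    (h : ∀ t ∈ Icc a (a + 2 * κ), ‖u₂ t - u₂ a‖ ≤ η) :
    ‖u₂ (a + κ) - (κ ^ 2)⁻¹ • (u₀ (a + 2 * κ) - (2 : ℝ) • u₀ (a + κ) + u₀ a)‖ ≤ 13 * η := by
  have e0 := h (a + κ) ⟨by linarith, by linarith⟩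
  have e1 := norm_taylor_two_le (L := 2 * κ) (by linarith) (by linarith) hη h₀ h₁ h
    (t := a + κ) ⟨by linarith, by linarith⟩
  have e2 := norm_taylor_two_le (L := 2 * κ) (by linarith) (by linarith) hη h₀ h₁ h
    (t := a + 2 * κ) ⟨by linarith, by linarith⟩
  set r₁ := u₀ (a + κ) - (u₀ a + (a + κ - a) • u₁ a + ((a + κ - a) ^ 2 / 2) • u₂ a) with hr₁
  set r₂ := u₀ (a + 2 * κ) - (u₀ a + (a + 2 * κ - a) • u₁ a + ((a + 2 * κ - a) ^ 2 / 2) • u₂ a)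
    with hr₂
  have : u₂ (a + κ) - (κ ^ 2)⁻¹ • (u₀ (a + 2 * κ) - (2 : ℝ) • u₀ (a + κ) + u₀ a) =
      (u₂ (a + κ) - u₂ a) - (κ ^ 2)⁻¹ • (r₂ - (2 : ℝ) • r₁) := by
    rw [hr₁, hr₂]
    match_scalars <;> field_simp <;> ring
  rw [this]
  refine (norm_sub_le _ _).trans ?_
  rw [norm_smul, Real.norm_of_nonneg (by positivity)]
  have e4 : ‖r₂ - (2 : ℝ) • r₁‖ ≤ 12 * (κ ^ 2 * η) := by
    refine (norm_sub_le _ _).trans ?_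
    rw [norm_smul, Real.norm_ofNat]
    nlinarith
  have : (κ ^ 2)⁻¹ * ‖r₂ - (2 : ℝ) • r₁‖ ≤ (κ ^ 2)⁻¹ * (12 * (κ ^ 2 * η)) := by gcongr
  have e3 : (κ ^ 2)⁻¹ * (12 * (κ ^ 2 * η)) = 12 * η := by field_simp
  linarith

lemma norm_second_deriv_sub_le_of_deriv {u₀ u₁ u₂ u₃ u₄ : ℝ → X} {a κ S : ℝ} (hκ : 0 < κ)
    (hS : 0 ≤ S)
    (h₀ : ∀ t ∈ Icc a (a + 2 * κ), HasDerivWithinAt u₀ (u₁ t) (Icc a (a + 2 * κ)) t)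
    (h₁ : ∀ t ∈ Icc a (a + 2 * κ), HasDerivWithinAt u₁ (u₂ t) (Icc a (a + 2 * κ)) t)
    (h₂ : ∀ t ∈ Icc a (a + 2 * κ), HasDerivWithinAt u₂ (u₃ t) (Icc a (a + 2 * κ)) t)
    (h₃ : ∀ t ∈ Icc a (a + 2 * κ), HasDerivWithinAt u₃ (u₄ t) (Icc a (a + 2 * κ)) t)
    (h : ∀ t ∈ Icc a (a + 2 * κ), ‖u₄ t‖ ≤ S) :
    ‖u₂ (a + κ) - (κ ^ 2)⁻¹ • (u₀ (a + 2 * κ) - (2 : ℝ) • u₀ (a + κ) + u₀ a)‖ ≤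
      52 * (κ ^ 2 * S) := by
  have hη : 0 ≤ S * (2 * κ) := by positivity
  have ho : ∀ t ∈ Icc a (a + 2 * κ), ‖u₃ t - u₃ a‖ ≤ S * (2 * κ) := fun t ht =>
    norm_sub_le_of_hasDerivWithinAt (L := 2 * κ) (by linarith) hS h₃ h ht
  have e0 := norm_taylor_one_le (L := 2 * κ) (by linarith) hη h₂ ho (t := a + κ)
    ⟨by linarith, by linarith⟩
  have e1 := norm_taylor_three_le (L := 2 * κ) (by linarith) (by linarith) hη h₀ h₁ h₂ ho
    (t := a + κ) ⟨by linarith, by linarith⟩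
  have e2 := norm_taylor_three_le (L := 2 * κ) (by linarith) (by linarith) hη h₀ h₁ h₂ ho
    (t := a + 2 * κ) ⟨by linarith, by linarith⟩
  set r₀ := u₂ (a + κ) - (u₂ a + (a + κ - a) • u₃ a) with hr₀
  set r₁ := u₀ (a + κ) - (u₀ a + (a + κ - a) • u₁ a + ((a + κ - a) ^ 2 / 2) • u₂ a +
    ((a + κ - a) ^ 3 / 6) • u₃ a) with hr₁
  set r₂ := u₀ (a + 2 * κ) - (u₀ a + (a + 2 * κ - a) • u₁ a + ((a + 2 * κ - a) ^ 2 / 2) • u₂ a +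
    ((a + 2 * κ - a) ^ 3 / 6) • u₃ a) with hr₂
  have : u₂ (a + κ) - (κ ^ 2)⁻¹ • (u₀ (a + 2 * κ) - (2 : ℝ) • u₀ (a + κ) + u₀ a) =
      r₀ - (κ ^ 2)⁻¹ • (r₂ - (2 : ℝ) • r₁) := by
    rw [hr₀, hr₁, hr₂]
    match_scalars <;> field_simp <;> ring
  rw [this]
  refine (norm_sub_le _ _).trans ?_
  rw [norm_smul, Real.norm_of_nonneg (by positivity)]
  have e4 : ‖r₂ - (2 : ℝ) • r₁‖ ≤ 48 * (κ ^ 4 * S) := by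
    refine (norm_sub_le _ _).trans ?_
    rw [norm_smul, Real.norm_ofNat]
    nlinarith
  have : (κ ^ 2)⁻¹ * ‖r₂ - (2 : ℝ) • r₁‖ ≤ (κ ^ 2)⁻¹ * (48 * (κ ^ 4 * S)) := by gcongr
  have e3 : (κ ^ 2)⁻¹ * (48 * (κ ^ 4 * S)) = 48 * (κ ^ 2 * S) := by field_simp
  nlinarith

/-- Increments of the central difference quotient versus the trapezoidal rule for `u₂`. -/
lemma norm_central_diff_increment_le_of_osc {u₀ u₁ u₂ : ℝ → X} {a κ η : ℝ} (hκ : 0 < κ)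
    (hη : 0 ≤ η)
    (h₀ : ∀ t ∈ Icc a (a + 3 * κ), HasDerivWithinAt u₀ (u₁ t) (Icc a (a + 3 * κ)) t)
    (h₁ : ∀ t ∈ Icc a (a + 3 * κ), HasDerivWithinAt u₁ (u₂ t) (Icc a (a + 3 * κ)) t)
    (h : ∀ t ∈ Icc a (a + 3 * κ), ‖u₂ t - u₂ a‖ ≤ η) :
    ‖(κ / 2) • (u₂ (a + 2 * κ) + u₂ (a + κ)) - ((2 * κ)⁻¹ • (u₀ (a + 3 * κ) - u₀ (a + κ)) -
      (2 * κ)⁻¹ • (u₀ (a + 2 * κ) - u₀ a))‖ ≤ 15 * (κ * η) := by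
  have d1 := h (a + κ) ⟨by linarith, by linarith⟩
  have d2 := h (a + 2 * κ) ⟨by linarith, by linarith⟩
  have e1 := norm_taylor_two_le (L := 3 * κ) (by linarith) (by linarith) hη h₀ h₁ h
    (t := a + κ) ⟨by linarith, by linarith⟩
  have e2 := norm_taylor_two_le (L := 3 * κ) (by linarith) (by linarith) hη h₀ h₁ h
    (t := a + 2 * κ) ⟨by linarith, by linarith⟩
  have e3 := norm_taylor_two_le (L := 3 * κ) (by linarith) (by linarith) hη h₀ h₁ h
    (t := a + 3 * κ) ⟨by linarith, by linarith⟩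
  set r₁ := u₀ (a + κ) - (u₀ a + (a + κ - a) • u₁ a + ((a + κ - a) ^ 2 / 2) • u₂ a) with hr₁
  set r₂ := u₀ (a + 2 * κ) - (u₀ a + (a + 2 * κ - a) • u₁ a + ((a + 2 * κ - a) ^ 2 / 2) • u₂ a)
    with hr₂
  set r₃ := u₀ (a + 3 * κ) - (u₀ a + (a + 3 * κ - a) • u₁ a + ((a + 3 * κ - a) ^ 2 / 2) • u₂ a)
    with hr₃
  set s₁ := u₂ (a + κ) - u₂ a with hs₁
  set s₂ := u₂ (a + 2 * κ) - u₂ a with hs₂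
  have : (κ / 2) • (u₂ (a + 2 * κ) + u₂ (a + κ)) - ((2 * κ)⁻¹ • (u₀ (a + 3 * κ) - u₀ (a + κ)) -
      (2 * κ)⁻¹ • (u₀ (a + 2 * κ) - u₀ a)) = (κ / 2) • (s₂ + s₁) -
      (2 * κ)⁻¹ • (r₃ - r₁ - r₂) := by
    rw [hr₁, hr₂, hr₃, hs₁, hs₂]
    match_scalars <;> field_simp <;> ring
  rw [this]
  refine (norm_sub_le _ _).trans ?_
  rw [norm_smul, norm_smul, Real.norm_of_nonneg (by positivity), Real.norm_of_nonneg (by positivity)]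
  have e4 : ‖r₃ - r₁ - r₂‖ ≤ 27 * (κ ^ 2 * η) := by
    refine (norm_sub_le _ _).trans ?_
    have := norm_sub_le r₃ r₁
    nlinarith
  have e5 : ‖s₂ + s₁‖ ≤ 2 * η := (norm_add_le _ _).trans (by linarith)
  have e6 : (2 * κ)⁻¹ * ‖r₃ - r₁ - r₂‖ ≤ (2 * κ)⁻¹ * (27 * (κ ^ 2 * η)) := by gcongr
  have e7 : (2 * κ)⁻¹ * (27 * (κ ^ 2 * η)) = 27 / 2 * (κ * η) := by field_simp
  have e8 : κ / 2 * ‖s₂ + s₁‖ ≤ κ / 2 * (2 * η) := by gcongr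
  nlinarith [mul_nonneg hκ.le hη]

lemma norm_central_diff_increment_le_of_deriv {u₀ u₁ u₂ u₃ u₄ : ℝ → X} {a κ S : ℝ} (hκ : 0 < κ)
    (hS : 0 ≤ S)
    (h₀ : ∀ t ∈ Icc a (a + 3 * κ), HasDerivWithinAt u₀ (u₁ t) (Icc a (a + 3 * κ)) t)
    (h₁ : ∀ t ∈ Icc a (a + 3 * κ), HasDerivWithinAt u₁ (u₂ t) (Icc a (a + 3 * κ)) t)
    (h₂ : ∀ t ∈ Icc a (a + 3 * κ), HasDerivWithinAt u₂ (u₃ t) (Icc a (a + 3 * κ)) t)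
    (h₃ : ∀ t ∈ Icc a (a + 3 * κ), HasDerivWithinAt u₃ (u₄ t) (Icc a (a + 3 * κ)) t)
    (h : ∀ t ∈ Icc a (a + 3 * κ), ‖u₄ t‖ ≤ S) :
    ‖(κ / 2) • (u₂ (a + 2 * κ) + u₂ (a + κ)) - ((2 * κ)⁻¹ • (u₀ (a + 3 * κ) - u₀ (a + κ)) -
      (2 * κ)⁻¹ • (u₀ (a + 2 * κ) - u₀ a))‖ ≤ 135 * (κ * (κ ^ 2 * S)) := by
  have hη : 0 ≤ S * (3 * κ) := by positivity
  have ho : ∀ t ∈ Icc a (a + 3 * κ), ‖u₃ t - u₃ a‖ ≤ S * (3 * κ) := fun t ht =>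
    norm_sub_le_of_hasDerivWithinAt (L := 3 * κ) (by linarith) hS h₃ h ht
  have d1 := norm_taylor_one_le (L := 3 * κ) (by linarith) hη h₂ ho (t := a + κ)
    ⟨by linarith, by linarith⟩
  have d2 := norm_taylor_one_le (L := 3 * κ) (by linarith) hη h₂ ho (t := a + 2 * κ)
    ⟨by linarith, by linarith⟩
  have e1 := norm_taylor_three_le (L := 3 * κ) (by linarith) (by linarith) hη h₀ h₁ h₂ ho
    (t := a + κ) ⟨by linarith, by linarith⟩
  have e2 := norm_taylor_three_le (L := 3 * κ) (by linarith) (by linarith) hη h₀ h₁ h₂ ho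
    (t := a + 2 * κ) ⟨by linarith, by linarith⟩
  have e3 := norm_taylor_three_le (L := 3 * κ) (by linarith) (by linarith) hη h₀ h₁ h₂ ho
    (t := a + 3 * κ) ⟨by linarith, by linarith⟩
  set r₁ := u₀ (a + κ) - (u₀ a + (a + κ - a) • u₁ a + ((a + κ - a) ^ 2 / 2) • u₂ a +
    ((a + κ - a) ^ 3 / 6) • u₃ a) with hr₁
  set r₂ := u₀ (a + 2 * κ) - (u₀ a + (a + 2 * κ - a) • u₁ a + ((a + 2 * κ - a) ^ 2 / 2) • u₂ a +
    ((a + 2 * κ - a) ^ 3 / 6) • u₃ a) with hr₂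
  set r₃ := u₀ (a + 3 * κ) - (u₀ a + (a + 3 * κ - a) • u₁ a + ((a + 3 * κ - a) ^ 2 / 2) • u₂ a +
    ((a + 3 * κ - a) ^ 3 / 6) • u₃ a) with hr₃
  set s₁ := u₂ (a + κ) - (u₂ a + (a + κ - a) • u₃ a) with hs₁
  set s₂ := u₂ (a + 2 * κ) - (u₂ a + (a + 2 * κ - a) • u₃ a) with hs₂
  have : (κ / 2) • (u₂ (a + 2 * κ) + u₂ (a + κ)) - ((2 * κ)⁻¹ • (u₀ (a + 3 * κ) - u₀ (a + κ)) -
      (2 * κ)⁻¹ • (u₀ (a + 2 * κ) - u₀ a)) = (κ / 2) • (s₂ + s₁) -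
      (2 * κ)⁻¹ • (r₃ - r₁ - r₂) := by
    rw [hr₁, hr₂, hr₃, hs₁, hs₂]
    match_scalars <;> field_simp <;> ring
  rw [this]
  refine (norm_sub_le _ _).trans ?_
  rw [norm_smul, norm_smul, Real.norm_of_nonneg (by positivity), Real.norm_of_nonneg (by positivity)]
  have e4 : ‖r₃ - r₁ - r₂‖ ≤ 243 * (κ ^ 4 * S) := by
    refine (norm_sub_le _ _).trans ?_
    have := norm_sub_le r₃ r₁
    nlinarith
  have e5 : ‖s₂ + s₁‖ ≤ 18 * (κ ^ 2 * S) := (norm_add_le _ _).trans (by nlinarith)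
  have e6 : (2 * κ)⁻¹ * ‖r₃ - r₁ - r₂‖ ≤ (2 * κ)⁻¹ * (243 * (κ ^ 4 * S)) := by gcongr
  have e7 : (2 * κ)⁻¹ * (243 * (κ ^ 4 * S)) = 243 / 2 * (κ * (κ ^ 2 * S)) := by field_simp
  have e8 : κ / 2 * ‖s₂ + s₁‖ ≤ κ / 2 * (18 * (κ ^ 2 * S)) := by gcongr
  have : 0 ≤ κ * (κ ^ 2 * S) := by positivity
  linarith

/-- The first increment of the central difference quotient, with the exact derivative at the left
end point. -/
lemma norm_first_increment_le {u₀ u₁ u₂ : ℝ → X} {a κ η : ℝ} (hκ : 0 < κ) (hη : 0 ≤ η)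
    (h₀ : ∀ t ∈ Icc a (a + 2 * κ), HasDerivWithinAt u₀ (u₁ t) (Icc a (a + 2 * κ)) t)
    (h₁ : ∀ t ∈ Icc a (a + 2 * κ), HasDerivWithinAt u₁ (u₂ t) (Icc a (a + 2 * κ)) t)
    (h : ∀ t ∈ Icc a (a + 2 * κ), ‖u₂ t - u₂ a‖ ≤ η) :
    ‖(κ / 2) • (u₂ (a + κ) + u₂ a) - ((2 * κ)⁻¹ • (u₀ (a + 2 * κ) - u₀ a) - u₁ a)‖ ≤
      3 * (κ * η) := by
  have d1 := h (a + κ) ⟨by linarith, by linarith⟩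
  have e2 := norm_taylor_two_le (L := 2 * κ) (by linarith) (by linarith) hη h₀ h₁ h
    (t := a + 2 * κ) ⟨by linarith, by linarith⟩
  set r₂ := u₀ (a + 2 * κ) - (u₀ a + (a + 2 * κ - a) • u₁ a + ((a + 2 * κ - a) ^ 2 / 2) • u₂ a)
    with hr₂
  have : (κ / 2) • (u₂ (a + κ) + u₂ a) - ((2 * κ)⁻¹ • (u₀ (a + 2 * κ) - u₀ a) - u₁ a) =
      (κ / 2) • (u₂ (a + κ) - u₂ a) - (2 * κ)⁻¹ • r₂ := by
    rw [hr₂]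
    match_scalars <;> field_simp <;> ring
  rw [this]
  refine (norm_sub_le _ _).trans ?_
  rw [norm_smul, norm_smul, Real.norm_of_nonneg (by positivity), Real.norm_of_nonneg (by positivity)]
  have e6 : (2 * κ)⁻¹ * ‖r₂‖ ≤ (2 * κ)⁻¹ * (η * (2 * κ) * (2 * κ)) := by gcongr
  have e7 : (2 * κ)⁻¹ * (η * (2 * κ) * (2 * κ)) = 2 * (κ * η) := by field_simp
  have e8 : κ / 2 * ‖u₂ (a + κ) - u₂ a‖ ≤ κ / 2 * η := by gcongr
  have : 0 ≤ κ * η := by positivity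
  linarith

/-- The difference quotient as an approximation of the derivative at the midpoint. -/
lemma norm_midpoint_deriv_le {u₀ u₁ u₂ : ℝ → X} {a κ η : ℝ} (hκ : 0 < κ) (hη : 0 ≤ η)
    (h₀ : ∀ t ∈ Icc a (a + κ), HasDerivWithinAt u₀ (u₁ t) (Icc a (a + κ)) t)
    (h₁ : ∀ t ∈ Icc a (a + κ), HasDerivWithinAt u₁ (u₂ t) (Icc a (a + κ)) t)
    (h : ∀ t ∈ Icc a (a + κ), ‖u₂ t - u₂ a‖ ≤ η) :
    ‖κ⁻¹ • (u₀ (a + κ) - u₀ a) - u₁ (a + κ / 2)‖ ≤ 2 * (κ * η) := by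
  have e1 := norm_taylor_one_le (L := κ) (by linarith) hη h₁ h (t := a + κ / 2)
    ⟨by linarith, by linarith⟩
  have e2 := norm_taylor_two_le (L := κ) (by linarith) (by linarith) hη h₀ h₁ h
    (t := a + κ) ⟨by linarith, by linarith⟩
  set r₁ := u₁ (a + κ / 2) - (u₁ a + (a + κ / 2 - a) • u₂ a) with hr₁
  set r₂ := u₀ (a + κ) - (u₀ a + (a + κ - a) • u₁ a + ((a + κ - a) ^ 2 / 2) • u₂ a) with hr₂
  have : κ⁻¹ • (u₀ (a + κ) - u₀ a) - u₁ (a + κ / 2) = κ⁻¹ • r₂ - r₁ := by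
    rw [hr₁, hr₂]
    match_scalars <;> field_simp <;> ring
  rw [this]
  refine (norm_sub_le _ _).trans ?_
  rw [norm_smul, Real.norm_of_nonneg (by positivity)]
  have e6 : κ⁻¹ * ‖r₂‖ ≤ κ⁻¹ * (η * κ * κ) := by gcongr
  have e7 : κ⁻¹ * (η * κ * κ) = κ * η := by field_simp
  linarith

/-- The average of two values as an approximation of the value at the midpoint. -/
lemma norm_midpoint_average_le {u₀ u₁ u₂ : ℝ → X} {a κ S : ℝ} (hκ : 0 < κ) (hS : 0 ≤ S)
    (h₀ : ∀ t ∈ Icc a (a + κ), HasDerivWithinAt u₀ (u₁ t) (Icc a (a + κ)) t)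
    (h₁ : ∀ t ∈ Icc a (a + κ), HasDerivWithinAt u₁ (u₂ t) (Icc a (a + κ)) t)
    (h : ∀ t ∈ Icc a (a + κ), ‖u₂ t‖ ≤ S) :
    ‖(2 : ℝ)⁻¹ • (u₀ (a + κ) + u₀ a) - u₀ (a + κ / 2)‖ ≤ 2 * (κ ^ 2 * S) := by
  have ho : ∀ t ∈ Icc a (a + κ), ‖u₁ t - u₁ a‖ ≤ S * κ := fun t ht =>
    norm_sub_le_of_hasDerivWithinAt (L := κ) (by linarith) hS h₁ h ht
  have hη : 0 ≤ S * κ := by positivity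
  have e1 := norm_taylor_one_le (L := κ) (by linarith) hη h₀ ho (t := a + κ / 2)
    ⟨by linarith, by linarith⟩
  have e2 := norm_taylor_one_le (L := κ) (by linarith) hη h₀ ho (t := a + κ)
    ⟨by linarith, by linarith⟩
  set r₁ := u₀ (a + κ / 2) - (u₀ a + (a + κ / 2 - a) • u₁ a) with hr₁
  set r₂ := u₀ (a + κ) - (u₀ a + (a + κ - a) • u₁ a) with hr₂
  have : (2 : ℝ)⁻¹ • (u₀ (a + κ) + u₀ a) - u₀ (a + κ / 2) = (2 : ℝ)⁻¹ • r₂ - r₁ := by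
    rw [hr₁, hr₂]
    match_scalars <;> ring
  rw [this]
  refine (norm_sub_le _ _).trans ?_
  rw [norm_smul, Real.norm_of_nonneg (by positivity)]
  have : 0 ≤ κ ^ 2 * S := by positivity
  nlinarith

end Taylor

end FracWave

/-! ### Regularity in time -/

namespace FracWave

section Regularity
variable {X : Type} [NormedAddCommGroup X] [NormedSpace ℝ X]

lemma hasDerivWithinAt_timeDeriv {T : ℝ} (hT : 0 < T) {u : ℝ → X} {s : Set ℝ} {n k : ℕ}
    (h : ContDiffOn ℝ n u s) (hk : k < n) {t : ℝ} (ht : t ∈ s) (htT : t ∈ Icc 0 T)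
    (hs : s ∈ nhdsWithin t (Icc 0 T)) :
    HasDerivWithinAt (timeDeriv T k u) (timeDeriv T (k + 1) u t) (Icc 0 T) t := by
  have h1 : ContDiffWithinAt ℝ n u (Icc 0 T) t := (h t ht).mono_of_mem_nhdsWithin hs
  have h2 := h1.differentiableWithinAt_iteratedDerivWithin (m := k) (by exact_mod_cast hk)
    (by rw [insert_eq_of_mem htT]; exact uniqueDiffOn_Icc hT)
  have h3 := h2.hasDerivWithinAt
  rw [← iteratedDerivWithin_succ] at h3
  exact h3

/-- A bound by `C (1 + c t^{α-1})` of the derivative, integrable at `0`, integrates to a bound of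
the increments. -/
lemma norm_sub_le_of_singular_deriv {T α C c : ℝ} (hα : 0 < α) {f f' : ℝ → X}
    (hf : ContinuousOn f (Icc 0 T))
    (hd : ∀ t ∈ Ioc 0 T, HasDerivWithinAt f (f' t) (Icc 0 T) t)
    (hb : ∀ t ∈ Ioc 0 T, ‖f' t‖ ≤ C * (1 + c * t ^ (α - 1))) {s t : ℝ} (hs : 0 ≤ s)
    (hst : s ≤ t) (ht : t ≤ T) :
    ‖f t - f s‖ ≤ C * ((t - s) + c / α * (t ^ α - s ^ α)) := by
  -- the derivative need not exist at `0`, which is reached by continuity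
  have pos : ∀ s ∈ Ioc 0 t, ‖f t - f s‖ ≤ C * ((t - s) + c / α * (t ^ α - s ^ α)) := by
    intro s hs
    refine image_norm_le_of_norm_deriv_right_le_deriv_boundary' (a := s) (b := t)
      (f := fun x => f x - f s) (f' := f') (B := fun x => C * ((x - s) + c / α * (x ^ α - s ^ α)))
      (B' := fun x => C * (1 + c * x ^ (α - 1))) ?_ ?_ ?_ ?_ ?_ ?_ (right_mem_Icc.2 hs.2)
    · exact (hf.mono (Icc_subset_Icc hs.1.le ht)).sub continuousOn_const
    · intro x hx
      have hx' : x ∈ Ioc 0 T := ⟨hs.1.trans_le hx.1, hx.2.le.trans ht⟩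
      have h1 := (hd x hx').sub_const (f s)
      refine h1.mono_of_mem_nhdsWithin ?_
      refine Filter.mem_of_superset (Icc_mem_nhdsGE (hx.2.trans_le ht)) ?_
      exact Icc_subset_Icc hx'.1.le le_rfl
    · simp
    · refine ContinuousOn.mul continuousOn_const ?_
      refine (continuousOn_id.sub continuousOn_const).add (continuousOn_const.mul ?_)
      exact (continuousOn_id.rpow_const fun x hx => Or.inr hα.le).sub continuousOn_const
    · intro x hx
      have hx0 : 0 < x := hs.1.trans_le hx.1
      have h1 : HasDerivAt (fun x : ℝ => C * ((x - s) + c / α * (x ^ α - s ^ α)))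
          (C * (1 + c / α * (α * x ^ (α - 1)))) x :=
        (((hasDerivAt_id x).sub_const s).add
          (((Real.hasDerivAt_rpow_const (Or.inl hx0.ne')).sub_const (s ^ α)).const_mul _)).const_mul C
      have h2 : C * (1 + c / α * (α * x ^ (α - 1))) = C * (1 + c * x ^ (α - 1)) := by
        field_simp
      rw [h2] at h1
      exact h1.hasDerivWithinAt
    · intro x hx
      exact hb x ⟨hs.1.trans_le hx.1, hx.2.le.trans ht⟩
  rcases hst.eq_or_lt with rfl | hlt
  · simp
  have ht0 : 0 < t := hs.trans_lt hlt
  have hcl : closure (Ioc 0 t) = Icc 0 t := closure_Ioc ht0.ne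
  refine le_on_closure (s := Ioc 0 t) (f := fun s => ‖f t - f s‖)
    (g := fun s => C * ((t - s) + c / α * (t ^ α - s ^ α))) pos ?_ ?_ (by rw [hcl]; exact ⟨hs, hst⟩)
  · rw [hcl]
    exact (continuousOn_const.sub (hf.mono (Icc_subset_Icc le_rfl ht))).norm
  · rw [hcl]
    refine ContinuousOn.mul continuousOn_const ?_
    refine (continuousOn_const.sub continuousOn_id).add (continuousOn_const.mul ?_)
    exact continuousOn_const.sub (continuousOn_id.rpow_const fun x hx => Or.inr hα.le)

end Regularity

/-- The case `α ≤ 1` uses Hölder continuity, the case `α > 1` the mean value inequality. -/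
lemma rpow_sub_rpow_le_of_sub_le {α T κ : ℝ} (hα : 0 < α) (hκ : 0 < κ) {s t : ℝ}
    (hs : 0 ≤ s) (hst : s ≤ t) (ht : t ≤ T) (h : t - s ≤ 3 * κ) :
    t ^ α - s ^ α ≤ (3 + 3 * α * T ^ (α - 1)) * (κ ^ α + κ) := by
  have hT : 0 ≤ T := hs.trans (hst.trans ht)
  have hκα : 0 < κ ^ α := by positivity
  have hTα : 0 ≤ T ^ (α - 1) := by positivity
  rcases le_or_gt α 1 with h1 | h1
  · have e1 : t ^ α ≤ s ^ α + (t - s) ^ α := by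
      have := Real.rpow_add_le_add_rpow hs (sub_nonneg.2 hst) hα.le h1
      simpa using this
    have e2 : (t - s) ^ α ≤ (3 * κ) ^ α := Real.rpow_le_rpow (sub_nonneg.2 hst) h hα.le
    have e3 : (3 * κ) ^ α = 3 ^ α * κ ^ α := Real.mul_rpow (by norm_num) hκ.le
    have e4 : (3 : ℝ) ^ α ≤ 3 := by
      simpa using Real.rpow_le_rpow_of_exponent_le (x := (3 : ℝ)) (by norm_num) h1
    have e5 : (3 : ℝ) ^ α * κ ^ α ≤ 3 * κ ^ α := by gcongr
    have e6 : 0 ≤ 3 * α * T ^ (α - 1) * (κ ^ α + κ) := by positivity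
    nlinarith
  · have e1 : ‖t ^ α - s ^ α‖ ≤ (α * T ^ (α - 1)) * (3 * κ) := by
      refine norm_sub_le_of_hasDerivWithinAt (f := fun x : ℝ => x ^ α)
        (f' := fun x => α * x ^ (α - 1)) h (by positivity) ?_ ?_ (right_mem_Icc.2 hst)
      · intro x _
        exact (Real.hasDerivAt_rpow_const (Or.inr h1.le)).hasDerivWithinAt
      · intro x hx
        have hx0 : 0 ≤ x := hs.trans hx.1
        rw [Real.norm_of_nonneg (by positivity)]
        have : x ^ (α - 1) ≤ T ^ (α - 1) :=
          Real.rpow_le_rpow hx0 (hx.2.trans ht) (by linarith)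
        gcongr
    have e2 := (le_abs_self _).trans e1
    have e6 : 0 ≤ 3 * α * T ^ (α - 1) * κ ^ α := by positivity
    nlinarith

/-- The bounds on a time interval of length `T`, divided into `N` steps of length `κ`, that the
consistency estimates rest on. The functions `u 0, u 1, …` are the successive derivatives of
`u 0`; `η` bounds the oscillation of `u 2` over three steps, and `S j` bounds `u 4` on the three
steps after `j * κ`, for `j ≥ 1`. -/
structure StepBounds {X : Type} [NormedAddCommGroup X] [NormedSpace ℝ X] (T κ η : ℝ) (S : ℕ → ℝ)
    (u : ℕ → ℝ → X) : Prop where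
  deriv : ∀ k < 2, ∀ t ∈ Icc 0 T, HasDerivWithinAt (u k) (u (k + 1) t) (Icc 0 T) t
  deriv' : ∀ k < 4, ∀ t ∈ Ioc 0 T, HasDerivWithinAt (u k) (u (k + 1) t) (Icc 0 T) t
  cont : ContinuousOn (u 2) (Icc 0 T)
  osc : ∀ s t, 0 ≤ s → s ≤ t → t ≤ T → t - s ≤ 3 * κ → ‖u 2 t - u 2 s‖ ≤ η
  fourth : ∀ j : ℕ, 1 ≤ j → ∀ t, j * κ ≤ t → t ≤ (j + 3) * κ → t ≤ T → ‖u 4 t‖ ≤ S j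

lemma rpow_le_four_rpow_mul {a t τ : ℝ} (hτ : 0 < τ) (h₁ : τ ≤ t) (h₂ : t ≤ 4 * τ) :
    t ^ a ≤ 4 ^ |a| * τ ^ a := by
  have hr1 : 1 ≤ t / τ := by rwa [one_le_div hτ]
  have hr4 : t / τ ≤ 4 := by rwa [div_le_iff₀ hτ]
  have e : t ^ a = (t / τ) ^ a * τ ^ a := by
    rw [← Real.mul_rpow (by positivity) hτ.le, div_mul_cancel₀ _ hτ.ne']
  rw [e]
  have e1 : (t / τ) ^ a ≤ (t / τ) ^ |a| := Real.rpow_le_rpow_of_exponent_le hr1 (le_abs_self a)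
  have e2 : (t / τ) ^ |a| ≤ 4 ^ |a| := Real.rpow_le_rpow (by positivity) hr4 (abs_nonneg a)
  have := e1.trans e2
  gcongr

/-- Both conditions on `α` force `α > 0`, so that the second derivative is bounded. -/
lemma SmoothnessAssumption.exponent_pos' {d : ℕ} {Ω : Set (Euc d)} {T γ α C₀ : ℝ} {c : Fin 5 → ℝ}
    {u : ℝ → H10 Ω} (h : SmoothnessAssumption T γ α C₀ c u) (hγ : γ < 1) (hγ₀ : γ ≠ 0) : 0 < α := by
  rcases lt_or_gt_of_ne hγ₀ with h1 | h1
  · linarith [h.exponent_neg h1]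
  · linarith [h.exponent_pos h1]

/-- The smoothness assumption in the form used by the consistency estimates: the oscillation of the
second derivative over three steps is `O(κ + c₃ κ^α)`, and the fourth derivative, away from the
first step, is comparable to its bound at a grid point. -/
lemma exists_stepBounds {T α : ℝ} (hT : 0 < T) (hα : 0 < α) :
    ∃ K > 0, ∀ (d : ℕ) (Ω : Set (Euc d)) (γ C₀ κ : ℝ) (c : Fin 5 → ℝ) (u : ℝ → H10 Ω), 0 < C₀ →
      (∀ k, 0 ≤ c k) → 0 < κ → SmoothnessAssumption T γ α C₀ c u →
      StepBounds T κ (K * (C₀ * (κ + c 3 * (κ ^ α + κ))))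
        (fun j => K * (C₀ * (1 + c 4 * (j * κ) ^ (α - 2)))) (fun k => timeDeriv T k u) ∧
      ∀ t ∈ Icc 0 T, ‖timeDeriv T 2 u t‖ ≤ K * (C₀ * (1 + c 2)) := by
  set K₁ := 3 + 3 * α * T ^ (α - 1) with hK₁
  have hTα : 0 < T ^ (α - 1) := by positivity
  have hK₁0 : 3 ≤ K₁ := by
    have : 0 ≤ 3 * α * T ^ (α - 1) := by positivity
    linarith
  set K := K₁ + K₁ / α + 4 ^ |α - 2| + T ^ α + 1 with hK
  have h4 : (0 : ℝ) < 4 ^ |α - 2| := by positivity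
  have hTα' : 0 < T ^ α := by positivity
  have hK₁α : 0 < K₁ / α := by positivity
  refine ⟨K, by positivity, ?_⟩
  intro d Ω γ C₀ κ c u hC₀ hc hκ h
  have hIoc : ∀ t ∈ Ioc 0 T, Ioc 0 T ∈ nhdsWithin t (Icc 0 T) := by
    intro t ht
    have : Ioi (0 : ℝ) ∩ Icc 0 T ∈ nhdsWithin t (Icc 0 T) :=
      Filter.inter_mem (mem_nhdsWithin_of_mem_nhds (Ioi_mem_nhds ht.1)) self_mem_nhdsWithin
    exact Filter.mem_of_superset this fun x hx => ⟨hx.1, hx.2.2⟩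
  have hd2 : ∀ k < 2, ∀ t ∈ Icc 0 T,
      HasDerivWithinAt (timeDeriv T k u) (timeDeriv T (k + 1) u t) (Icc 0 T) t :=
    fun k hk t ht => hasDerivWithinAt_timeDeriv hT (n := 2) h.contDiff_two hk ht ht
      self_mem_nhdsWithin
  have hd4 : ∀ k < 4, ∀ t ∈ Ioc 0 T,
      HasDerivWithinAt (timeDeriv T k u) (timeDeriv T (k + 1) u t) (Icc 0 T) t :=
    fun k hk t ht => hasDerivWithinAt_timeDeriv hT (n := 4) h.contDiff_four hk ht
      (Ioc_subset_Icc_self ht) (hIoc t ht)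
  have hcont : ContinuousOn (timeDeriv T 2 u) (Icc 0 T) :=
    h.contDiff_two.continuousOn_iteratedDerivWithin le_rfl (uniqueDiffOn_Icc hT)
  have hc2 := hc 2
  have hc3 := hc 3
  have hc4 := hc 4
  refine ⟨⟨hd2, hd4, hcont, ?_, ?_⟩, ?_⟩
  · intro s t hs hst ht hts
    have h3 : ∀ t ∈ Ioc 0 T, ‖timeDeriv T 3 u t‖ ≤ C₀ * (1 + c 3 * t ^ (α - 1)) := by
      intro t ht
      have := h.bound 3 t ht
      have e : 2 + α - (((3 : Fin 5) : ℕ) : ℝ) = α - 1 := by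
        have : ((3 : Fin 5) : ℕ) = 3 := rfl
        rw [this]; push_cast; ring
      rwa [e] at this
    have e1 := norm_sub_le_of_singular_deriv hα hcont (hd4 2 (by norm_num)) h3 hs hst ht
    have e2 := rpow_sub_rpow_le_of_sub_le hα hκ hs hst ht hts
    have hκα : 0 < κ ^ α := by positivity
    refine e1.trans ?_
    have e3 : c 3 / α * (t ^ α - s ^ α) ≤ c 3 / α * (K₁ * (κ ^ α + κ)) := by gcongr
    have e4 : c 3 / α * (K₁ * (κ ^ α + κ)) = K₁ / α * (c 3 * (κ ^ α + κ)) := by ring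
    calc C₀ * (t - s + c 3 / α * (t ^ α - s ^ α))
        ≤ C₀ * (K * κ + K * (c 3 * (κ ^ α + κ))) := by
          gcongr ?_ * (?_ + ?_)
          · exact hts.trans (by gcongr; linarith)
          · rw [e4] at e3
            refine e3.trans ?_
            gcongr
            linarith
      _ = _ := by ring
  · intro j hj t h1 h2 ht
    have hj' : (1 : ℝ) ≤ j := by exact_mod_cast hj
    have hjκ : 0 < j * κ := by positivity
    have ht0 : t ∈ Ioc 0 T := ⟨hjκ.trans_le h1, ht⟩
    have := h.bound 4 t ht0
    have e : 2 + α - (((4 : Fin 5) : ℕ) : ℝ) = α - 2 := by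
      have : ((4 : Fin 5) : ℕ) = 4 := rfl
      rw [this]; push_cast; ring
    rw [e] at this
    refine this.trans ?_
    have e1 : t ^ (α - 2) ≤ 4 ^ |α - 2| * (j * κ) ^ (α - 2) :=
      rpow_le_four_rpow_mul hjκ h1 (h2.trans (by nlinarith))
    have hp : 0 < ((j : ℝ) * κ) ^ (α - 2) := by positivity
    calc C₀ * (1 + c 4 * t ^ (α - 2)) ≤ C₀ * (K * 1 + c 4 * (K * (j * κ) ^ (α - 2))) := by
          gcongr ?_ * (?_ + ?_ * ?_)
          · linarith
          · refine e1.trans ?_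
            gcongr
            linarith
      _ = _ := by ring
  · have hcl : closure (Ioc 0 T) = Icc 0 T := closure_Ioc hT.ne
    have key : ∀ t ∈ Ioc 0 T, ‖timeDeriv T 2 u t‖ ≤ K * (C₀ * (1 + c 2)) := by
      intro t ht
      have := h.bound 2 t ht
      have e : 2 + α - (((2 : Fin 5) : ℕ) : ℝ) = α := by
        have : ((2 : Fin 5) : ℕ) = 2 := rfl
        rw [this]; push_cast; ring
      rw [e] at this
      refine this.trans ?_
      have e1 : t ^ α ≤ T ^ α := Real.rpow_le_rpow ht.1.le ht.2 hα.le
      calc C₀ * (1 + c 2 * t ^ α) ≤ C₀ * (K * 1 + c 2 * K) := by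
            gcongr ?_ * (?_ + ?_ * ?_)
            · linarith
            · linarith
        _ = _ := by ring
    intro t ht
    refine le_on_closure (s := Ioc 0 T) (f := fun t => ‖timeDeriv T 2 u t‖)
      (g := fun _ => K * (C₀ * (1 + c 2))) key ?_ continuousOn_const (by rwa [hcl])
    rw [hcl]
    exact hcont.norm

end FracWave

/-! ### The truncation error of the convolution quadrature -/

namespace FracWave

open PowerSeries (coeff)

lemma coeff_mul_eq_sum_range (f g : PowerSeries ℝ) (n : ℕ) :
    coeff n (f * g) = ∑ k ∈ Finset.range (n + 1), coeff (n - k) f * coeff k g := by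
  rw [mul_comm, PowerSeries.coeff_mul,
    Finset.Nat.sum_antidiagonal_eq_sum_range_succ (fun i j => coeff i g * coeff j f)]
  exact Finset.sum_congr rfl fun k _ => mul_comm _ _

lemma risingCoeff_one (n : ℕ) : risingCoeff 1 n = 1 := by
  induction n with
  | zero => exact risingCoeff_zero 1
  | succ n ih =>
    have h := succ_mul_risingCoeff_succ 1 n
    rw [ih] at h
    exact mul_left_cancel₀ (by positivity) h

lemma risingCoeff_two (n : ℕ) : risingCoeff 2 n = n + 1 := by
  induction n with
  | zero => simp [risingCoeff_zero]
  | succ n ih =>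
    have h := succ_mul_risingCoeff_succ 2 n
    rw [ih] at h
    refine mul_left_cancel₀ (a := (n : ℝ) + 1) (by positivity) ?_
    rw [h]; push_cast; ring

/-- Division by `1 - ζ` takes partial sums. -/
lemma coeff_mul_oneSubPow_neg_one (f : PowerSeries ℝ) (n : ℕ) :
    coeff n (f * oneSubPow (-1)) = ∑ k ∈ Finset.range (n + 1), coeff (n - k) f := by
  rw [coeff_mul_eq_sum_range]
  refine Finset.sum_congr rfl fun k _ => ?_
  rw [show coeff k (oneSubPow (-1)) = risingCoeff 1 k from rfl, risingCoeff_one, mul_one]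

lemma coeff_mul_X_mul_oneSubPow_neg_two (f : PowerSeries ℝ) (n : ℕ) :
    coeff n (f * (PowerSeries.X * oneSubPow (-2))) =
      ∑ k ∈ Finset.range (n + 1), coeff (n - k) f * k := by
  rw [coeff_mul_eq_sum_range]
  refine Finset.sum_congr rfl fun k _ => ?_
  congr 1
  cases k with
  | zero => simp
  | succ k =>
    rw [PowerSeries.coeff_succ_X_mul,
      show coeff k (oneSubPow (-2)) = risingCoeff 2 k from rfl, risingCoeff_two]
    push_cast; ring

/-- Summation by parts for a convolution: `b = (1 + c ζ) s` as generating functions. -/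
lemma sum_conv_shift {X : Type*} [AddCommGroup X] [Module ℝ X] {s b : ℕ → ℝ} {c : ℝ}
    (h0 : b 0 = s 0) (hb : ∀ m, b (m + 1) = s (m + 1) + c * s m) (G : ℕ → X) (m : ℕ) :
    (c * s m) • G 0 + ∑ j ∈ Finset.range (m + 1), b (m - j) • G (j + 1) =
      ∑ j ∈ Finset.range (m + 1), s (m - j) • (G (j + 1) + c • G j) := by
  simp only [smul_add, Finset.sum_add_distrib]
  rw [Finset.sum_range_succ' (fun j => s (m - j) • c • G j), Finset.sum_range_succ
    (fun j => b (m - j) • G (j + 1)), Finset.sum_range_succ (fun j => s (m - j) • G (j + 1))]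
  have e : ∀ j ∈ Finset.range m, b (m - j) • G (j + 1) =
      s (m - j) • G (j + 1) + s (m - (j + 1)) • c • G (j + 1) := by
    intro j hj
    have hj := Finset.mem_range.1 hj
    obtain ⟨i, hi⟩ : ∃ i, m - j = i + 1 := ⟨m - j - 1, by omega⟩
    have hi' : m - (j + 1) = i := by omega
    rw [hi, hi', hb]
    module
  rw [Finset.sum_congr rfl e, Finset.sum_add_distrib]
  simp only [Nat.sub_self, h0, Nat.sub_zero]
  module

lemma sum_Ico_one_succ {X : Type*} [AddCommMonoid X] (f : ℕ → X) (n : ℕ) :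
    ∑ j ∈ Finset.Ico 1 (n + 1), f j = ∑ j ∈ Finset.range n, f (j + 1) := by
  rw [Finset.sum_Ico_eq_sum_range]
  simp [add_comm]

lemma exists_sum_Ico_rpow_le {s : ℝ} (hs : s ≠ -1) :
    ∃ C > 0, ∀ N : ℕ, ∑ n ∈ Finset.Ico 1 N, (n : ℝ) ^ s ≤ C * ((N : ℝ) ^ (s + 1) + 1) := by
  obtain ⟨C, hC, h⟩ := exists_sum_rpow_le hs
  refine ⟨C, hC, fun N => ?_⟩
  refine le_trans ?_ (h N)
  cases N with
  | zero => simp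
  | succ N =>
    rw [sum_Ico_one_succ, Finset.sum_range_succ]
    push_cast
    have : (0 : ℝ) ≤ ((N : ℝ) + 1) ^ s := by positivity
    linarith

/-- The Riemann sums of `τ ↦ τ^{β-1}` are bounded. -/
lemma exists_rpow_mul_sum_Ico_le {β : ℝ} (hβ : 0 < β) {T : ℝ} :
    ∃ C > 0, ∀ (N : ℕ) (κ : ℝ), 0 < κ → κ ≤ 1 → N * κ = T →
      κ ^ β * ∑ n ∈ Finset.Ico 1 N, (n : ℝ) ^ (β - 1) ≤ C := by
  obtain ⟨C, hC, h⟩ := exists_sum_Ico_rpow_le (s := β - 1) (by linarith)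
  refine ⟨C * (|T ^ β| + 1), by positivity, fun N κ hκ hκ1 hN => ?_⟩
  have h1 := h N
  rw [sub_add_cancel] at h1
  have h2 : κ ^ β ≤ 1 := Real.rpow_le_one hκ.le hκ1 hβ.le
  have h3 : κ ^ β * (N : ℝ) ^ β = T ^ β := by
    rw [← hN, Real.mul_rpow (by positivity) hκ.le, mul_comm]
  calc κ ^ β * ∑ n ∈ Finset.Ico 1 N, (n : ℝ) ^ (β - 1)
      ≤ κ ^ β * (C * ((N : ℝ) ^ β + 1)) := by gcongr
    _ = C * (κ ^ β * (N : ℝ) ^ β + κ ^ β) := by ring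
    _ ≤ C * (|T ^ β| + 1) := by rw [h3]; gcongr; exact le_abs_self _

section Window
variable {X : Type} [NormedAddCommGroup X] [NormedSpace ℝ X] {T κ η : ℝ} {S : ℕ → ℝ}
  {u : ℕ → ℝ → X}

lemma StepBounds.window (h : StepBounds T κ η S u) {k : ℕ} (hk : k < 2) {a L : ℝ} (ha : 0 ≤ a)
    (hL : a + L ≤ T) :
    ∀ t ∈ Icc a (a + L), HasDerivWithinAt (u k) (u (k + 1) t) (Icc a (a + L)) t := fun t ht =>
  (h.deriv k hk t ⟨ha.trans ht.1, ht.2.trans hL⟩).mono (Icc_subset_Icc ha hL)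

lemma StepBounds.window' (h : StepBounds T κ η S u) {k : ℕ} (hk : k < 4) {a L : ℝ} (ha : 0 < a)
    (hL : a + L ≤ T) :
    ∀ t ∈ Icc a (a + L), HasDerivWithinAt (u k) (u (k + 1) t) (Icc a (a + L)) t := fun t ht =>
  (h.deriv' k hk t ⟨ha.trans_le ht.1, ht.2.trans hL⟩).mono (Icc_subset_Icc ha.le hL)

lemma StepBounds.osc_window (h : StepBounds T κ η S u) {a L : ℝ} (ha : 0 ≤ a) (hL : a + L ≤ T)
    (hL' : L ≤ 3 * κ) : ∀ t ∈ Icc a (a + L), ‖u 2 t - u 2 a‖ ≤ η := fun t ht =>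
  h.osc a t ha ht.1 (ht.2.trans hL) (by linarith [ht.2])

lemma StepBounds.fourth_window (h : StepBounds T κ η S u) {j : ℕ} (hj : 1 ≤ j) {L : ℝ}
    (hL : j * κ + L ≤ T) (hL' : L ≤ 3 * κ) : ∀ t ∈ Icc (j * κ) (j * κ + L), ‖u 4 t‖ ≤ S j :=
  fun t ht => h.fourth j hj t ht.1 (by linarith [ht.2]) (ht.2.trans hL)

lemma StepBounds.osc_nonneg (h : StepBounds T κ η S u) (hT : 0 ≤ T) (hκ : 0 ≤ κ) : 0 ≤ η := by
  simpa using h.osc 0 0 le_rfl le_rfl hT (by linarith)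

end Window

end FracWave

namespace FracWave

/-! ### Quadrature of negative order -/

open PowerSeries (coeff)

lemma exists_forall_abs_le_of_isBigO {f : ℕ → ℝ} {s : ℝ}
    (h : f =O[Filter.atTop] fun n : ℕ => ((n : ℝ) + 1) ^ s) :
    ∃ A > 0, ∀ n : ℕ, |f n| ≤ A * ((n : ℝ) + 1) ^ s := by
  obtain ⟨A, hA, hb⟩ := Asymptotics.bound_of_isBigO_nat_atTop h
  refine ⟨A, hA, fun n => ?_⟩
  have hp : (0 : ℝ) < ((n : ℝ) + 1) ^ s := by positivity
  have := hb (x := n) hp.ne'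
  rwa [Real.norm_eq_abs, Real.norm_of_nonneg hp.le] at this

/-- The truncation error of the convolution quadrature of negative order, applied to central
differences, is a multiple of the initial velocity plus a small remainder. The multiple comes from
the quadrature error for constants; its sum over the grid, times `κ`, is `O(κ)`. -/
lemma exists_cq_truncation_of_neg {γ : ℝ} (hγ : -1 < γ) (hγ' : γ < 0) {T : ℝ} (hT : 0 < T) :
    ∃ C > 0, ∀ (X : Type) [NormedAddCommGroup X] [NormedSpace ℝ X] [CompleteSpace X]
      (u : ℕ → ℝ → X) (κ η M : ℝ) (S : ℕ → ℝ) (N : ℕ), 0 < κ → κ ≤ 1 → N * κ = T →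
      StepBounds T κ η S u → (∀ t ∈ Icc 0 T, ‖u 2 t‖ ≤ M) →
      ∃ (ε : ℕ → ℝ) (τ : ℕ → X),
        (∀ n ∈ Finset.Ico 1 N, rlIntegral (-γ) (u 1) (n * κ) -
          cq γ κ (centralDiff κ (u 1 0) fun j => u 0 (j * κ)) n = ε n • u 1 0 + τ n) ∧
        κ * ∑ n ∈ Finset.Ico 1 N, |ε n| ≤ C * κ ∧
        κ * ∑ n ∈ Finset.Ico 1 N, ‖τ n‖ ≤ C * (κ * η + κ ^ 2 * M) := by
  have hγ1 : γ < 1 := by linarith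
  obtain ⟨A₁, hA₁, hw⟩ := exists_forall_abs_le_of_isBigO (isBigO_coeff_bdfSeries hγ hγ1)
  obtain ⟨A₂, hA₂, hc⟩ := exists_forall_abs_le_of_isBigO (isBigO_quadrature_const hγ hγ1 hγ')
  obtain ⟨A₃, hA₃, hl⟩ := exists_forall_abs_le_of_isBigO (isBigO_quadrature_linear hγ hγ1)
  have hβ : 0 < -γ := by linarith
  obtain ⟨C₁, hC₁, hK⟩ := exists_sum_kernelSum_le hβ (T := T)
  obtain ⟨C₂, hC₂, hR⟩ := exists_rpow_mul_sum_Ico_le hβ (T := T)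
  have hΓ : 0 < Real.Gamma (1 + -γ) := Real.Gamma_pos_of_pos (by linarith)
  refine ⟨A₂ * C₂ + ((Real.Gamma (1 + -γ))⁻¹ + A₃ + A₁) * C₁ * (6 * T) + A₃ * C₂, by positivity, ?_⟩
  intro X _ _ _ u κ η M S N hκ hκ1 hN h hM
  have hη : 0 ≤ η := h.osc_nonneg hT.le hκ.le
  have hM0 : 0 ≤ M := (norm_nonneg _).trans (hM 0 ⟨le_rfl, hT.le⟩)
  set w : ℕ → ℝ := fun n => coeff n (bdfSeries γ) with hwdef
  set β := -γ with hβdef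
  -- minus the error made for the constant function `1`
  set E : ℕ → ℝ := fun n => κ ^ β * (w n + ∑ j ∈ Finset.Ico 1 (n + 1), w (n - j) -
    (n : ℝ) ^ β / Real.Gamma (1 + β)) with hE
  set ν : ℕ → ℝ := fun _ => 6 * (κ * η) with hν
  set err : ℕ → X := fun n => rlIntegral β (u 1) (n * κ) -
    cq γ κ (centralDiff κ (u 1 0) fun j => u 0 (j * κ)) n with herr
  have hnT : ∀ n : ℕ, n ≤ N → n * κ ≤ T := fun n hn => by
    rw [← hN]; gcongr
  have hνn : ∀ j, 0 ≤ ν j := fun j => by positivity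
  have hu1 : ContinuousOn (u 1) (Icc 0 T) := fun t ht =>
    (h.deriv 1 (by norm_num) t ht).continuousWithinAt
  have hτ : ∀ n ∈ Finset.Ico 1 N, ‖err n + E n • u 1 0‖ ≤
      ((Real.Gamma (1 + β))⁻¹ + A₃) * kernelSum β κ ν n +
        A₃ * (κ ^ β * (n : ℝ) ^ (β - 1)) * (κ * M) + A₁ * kernelSum β κ ν n := by
    intro n hn
    obtain ⟨hn1, hnN⟩ := Finset.mem_Ico.1 hn
    have hq := norm_rlIntegral_sub_quadrature_le (β := β) (κ := κ) (A := A₃) (n := n) (G := u 1)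
      (ν := ν) (w := w) (q := w n) hβ (by linarith) hκ hA₃.le hn1
      (hu1.mono (Icc_subset_Icc le_rfl (hnT n hnN.le))) ?_ ?_ ?_
    · have hG : ‖u 1 κ - u 1 0‖ ≤ κ * M := by
        have hκT : 0 + κ ≤ T := by
          have := hnT 1 (by omega)
          simpa using this
        have := norm_sub_le_of_hasDerivWithinAt (L := κ) (by linarith) hM0
          (h.window (k := 1) (by norm_num) le_rfl hκT)
          (fun t ht => hM t ⟨ht.1, ht.2.trans hκT⟩) (t := κ) ⟨hκ.le, by linarith⟩
        rwa [mul_comm] at this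
      have hconv := norm_conv_le_kernelSum (X := X) (β := β) (κ := κ) (A := A₁) hκ hA₁.le (n := n)
        (σ := w)
        (θ := fun j => u 1 (j * κ) - centralDiff κ (u 1 0) (fun j => u 0 (j * κ)) j) (ν := ν) hw ?_
      · have hcq : cq γ κ (centralDiff κ (u 1 0) fun j => u 0 (j * κ)) n =
            κ ^ β • (w n • u 1 0 + ∑ j ∈ Finset.Ico 1 (n + 1), w (n - j) •
              centralDiff κ (u 1 0) (fun j => u 0 (j * κ)) j) := by
          rw [cq, Finset.range_eq_Ico, Finset.sum_eq_sum_Ico_succ_bot (Nat.succ_pos n), smul_add,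
            Finset.smul_sum]
          simp only [not_lt.2 hγ'.le, if_false, zero_smul, sub_zero, Nat.sub_zero, zero_add]
          congr 1
          · rw [cqWeight_eq_bdfSeries γ hκ, mul_smul]
            simp [centralDiff, hwdef, hβdef]
          · refine Finset.sum_congr rfl fun j _ => ?_
            rw [cqWeight_eq_bdfSeries γ hκ, mul_smul]
        have hsplit : err n + E n • u 1 0 =
            (rlIntegral β (u 1) (n * κ) -
              κ ^ β • (w n • u 1 0 + ∑ j ∈ Finset.Ico 1 (n + 1), w (n - j) • u 1 (j * κ)) +
              E n • u 1 0) +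
            κ ^ β • ∑ j ∈ Finset.Ico 1 (n + 1), w (n - j) •
              (u 1 (j * κ) - centralDiff κ (u 1 0) (fun j => u 0 (j * κ)) j) := by
          simp only [herr, hcq, smul_sub, Finset.sum_sub_distrib]
          module
        rw [hsplit]
        refine (norm_add_le _ _).trans (add_le_add (hq.trans ?_) hconv)
        gcongr
      · intro j hj hjn
        obtain ⟨i, rfl⟩ : ∃ i, j = i + 1 := ⟨j - 1, by omega⟩
        have hb : (i : ℝ) * κ + 2 * κ ≤ T := by
          have := hnT (i + 2) (by omega)
          push_cast at this; linarith
        have := norm_central_diff_le hκ hη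
          (h.window (k := 0) (by norm_num) (by positivity) hb)
          (h.window (k := 1) (by norm_num) (by positivity) hb)
          (h.osc_window (a := i * κ) (by positivity) hb (by linarith))
        have e1 : ((i + 1 : ℕ) : ℝ) * κ = i * κ + κ := by push_cast; ring
        have e2 : ((i + 1 + 1 : ℕ) : ℝ) * κ = i * κ + 2 * κ := by push_cast; ring
        simp only [centralDiff, Nat.add_eq_zero_iff, one_ne_zero, and_false, if_false,
          Nat.add_sub_cancel, e1, e2]
        refine this.trans ?_
        have : 0 ≤ κ * η := by positivity
        simp only [hν]; linarith
    · intro j hj t ht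
      have e1 : ((j + 1 : ℕ) : ℝ) * κ = j * κ + κ := by push_cast; ring
      rw [e1] at ht ⊢
      have hb : (j : ℝ) * κ + κ ≤ T := by
        rw [← e1]; exact hnT _ (by omega)
      have := norm_interp_le_of_osc hκ hη
        (h.window (k := 1) (by norm_num) (by positivity) hb)
        (h.osc_window (a := j * κ) (by positivity) hb (by linarith)) ht
      have e3 : (t - j * κ) / κ = t / κ - j := by field_simp
      rw [e3] at this
      refine this.trans ?_
      have : 0 ≤ κ * η := by positivity
      simp only [hν]; linarith
    · intro i hi
      have e1 : ((i + 1 : ℕ) : ℝ) * κ = i * κ + κ := by push_cast; ring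
      have e2 : ((i + 2 : ℕ) : ℝ) * κ = i * κ + 2 * κ := by push_cast; ring
      rw [e1, e2]
      have hb : (i : ℝ) * κ + 2 * κ ≤ T := by
        rw [← e2]; exact hnT _ (by omega)
      exact norm_second_diff_le_of_osc hκ hη
        (h.window (k := 1) (by norm_num) (by positivity) hb)
        (h.osc_window (a := i * κ) (by positivity) hb (by linarith))
    · intro m
      have := hl m
      rw [coeff_mul_X_mul_oneSubPow_neg_two] at this
      have e1 : 1 - γ = 1 + β := by rw [hβdef]; ring
      have e2 : 2 - γ = 2 + β := by rw [hβdef]; ring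
      rw [e1, e2] at this
      exact this
  have hEb : ∀ n ∈ Finset.Ico 1 N, |E n| ≤ A₂ * (κ ^ β * (n : ℝ) ^ (β - 1)) := by
    intro n hn
    obtain ⟨hn1, hnN⟩ := Finset.mem_Ico.1 hn
    have hn0 : (0 : ℝ) < n := by exact_mod_cast hn1
    have e : w n + ∑ j ∈ Finset.Ico 1 (n + 1), w (n - j) =
        coeff n (bdfSeries γ * oneSubPow (-1)) := by
      rw [coeff_mul_oneSubPow_neg_one, Finset.range_eq_Ico,
        Finset.sum_eq_sum_Ico_succ_bot (Nat.succ_pos n)]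
      simp [hwdef]
    have h1 := hc n
    have h2 : ((n : ℝ) + 1) ^ (-γ - 1) ≤ (n : ℝ) ^ (-γ - 1) :=
      Real.rpow_le_rpow_of_nonpos hn0 (by linarith) (by linarith)
    simp only [hE, e]
    rw [abs_mul, abs_of_pos (by positivity : 0 < κ ^ β)]
    have e3 : 1 - γ = 1 + β := by rw [hβdef]; ring
    rw [e3] at h1
    calc κ ^ β * |coeff n (bdfSeries γ * oneSubPow (-1)) - (n : ℝ) ^ β / Real.Gamma (1 + β)|
        ≤ κ ^ β * (A₂ * (n : ℝ) ^ (β - 1)) := by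
          gcongr
          exact h1.trans (by gcongr)
      _ = _ := by ring
  refine ⟨fun n => -E n, fun n => err n + E n • u 1 0, ?_, ?_, ?_⟩
  · intro n hn
    simp only [herr]
    module
  · simp only [abs_neg]
    calc κ * ∑ n ∈ Finset.Ico 1 N, |E n|
        ≤ κ * ∑ n ∈ Finset.Ico 1 N, A₂ * (κ ^ β * (n : ℝ) ^ (β - 1)) := by
          gcongr with n hn
          exact hEb n hn
      _ = (A₂ * (κ ^ β * ∑ n ∈ Finset.Ico 1 N, (n : ℝ) ^ (β - 1))) * κ := by
          simp only [← Finset.mul_sum]; ring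
      _ ≤ (A₂ * C₂) * κ := by gcongr; exact hR N κ hκ hκ1 hN
      _ ≤ _ := by
          gcongr
          have h1 : 0 ≤ ((Real.Gamma (1 + β))⁻¹ + A₃ + A₁) * C₁ * (6 * T) := by positivity
          have h2 : 0 ≤ A₃ * C₂ := by positivity
          linarith
  · have hsν : κ * ∑ n ∈ Finset.Ico 1 N, kernelSum β κ ν n ≤ C₁ * (6 * T) * (κ * η) := by
      calc κ * ∑ n ∈ Finset.Ico 1 N, kernelSum β κ ν n
          ≤ κ * (C₁ * ∑ j ∈ Finset.range N, ν j) := by gcongr; exact hK N κ ν hκ hN hνn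
        _ = C₁ * (6 * (N * κ)) * (κ * η) := by simp [hν]; ring
        _ = _ := by rw [hN]
    calc κ * ∑ n ∈ Finset.Ico 1 N, ‖err n + E n • u 1 0‖
        ≤ κ * ∑ n ∈ Finset.Ico 1 N, (((Real.Gamma (1 + β))⁻¹ + A₃) * kernelSum β κ ν n +
          A₃ * (κ ^ β * (n : ℝ) ^ (β - 1)) * (κ * M) + A₁ * kernelSum β κ ν n) := by
          gcongr with n hn
          exact hτ n hn
      _ = ((Real.Gamma (1 + β))⁻¹ + A₃ + A₁) * (κ * ∑ n ∈ Finset.Ico 1 N, kernelSum β κ ν n) +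
          A₃ * (κ ^ β * ∑ n ∈ Finset.Ico 1 N, (n : ℝ) ^ (β - 1)) * (κ ^ 2 * M) := by
          simp only [Finset.sum_add_distrib, ← Finset.mul_sum, ← Finset.sum_mul]
          ring
      _ ≤ ((Real.Gamma (1 + β))⁻¹ + A₃ + A₁) * (C₁ * (6 * T) * (κ * η)) +
          A₃ * C₂ * (κ ^ 2 * M) := by
          gcongr
          exact hR N κ hκ hκ1 hN
      _ ≤ _ := by
          have p1 : 0 ≤ κ * η := by positivity
          have p2 : 0 ≤ κ ^ 2 * M := by positivity
          have p3 : 0 ≤ A₂ * C₂ := by positivity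
          have p4 : 0 ≤ A₃ * C₂ := by positivity
          have p5 : 0 ≤ ((Real.Gamma (1 + β))⁻¹ + A₃ + A₁) * C₁ * (6 * T) := by positivity
          nlinarith [mul_nonneg p3 p1, mul_nonneg p3 p2, mul_nonneg p4 p1, mul_nonneg p5 p2]

end FracWave

namespace FracWave

/-! ### Quadrature of positive order -/

open PowerSeries (coeff)

lemma coeff_mul_one_add_X_half (f : PowerSeries ℝ) :
    coeff 0 (f * ((1 + PowerSeries.X) * PowerSeries.C (1 / 2))) = coeff 0 f / 2 ∧
    ∀ m, coeff (m + 1) (f * ((1 + PowerSeries.X) * PowerSeries.C (1 / 2))) =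
      (coeff (m + 1) f + coeff m f) / 2 := by
  have e : f * ((1 + PowerSeries.X) * PowerSeries.C (1 / 2)) =
      (f + f * PowerSeries.X) * PowerSeries.C (1 / 2) := by ring
  constructor
  · rw [e, PowerSeries.coeff_mul_C]; simp; ring
  · intro m
    rw [e, PowerSeries.coeff_mul_C]; simp [PowerSeries.coeff_succ_mul_X]; ring

lemma coeff_of_mul_oneSubPow_neg_one (f : PowerSeries ℝ) :
    coeff 0 f = coeff 0 (f * oneSubPow (-1)) ∧
    ∀ m, coeff (m + 1) f =
      coeff (m + 1) (f * oneSubPow (-1)) + (-1) * coeff m (f * oneSubPow (-1)) := by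
  have e : f = f * oneSubPow (-1) - f * oneSubPow (-1) * PowerSeries.X := by
    have h : oneSubPow (-1) * (1 - PowerSeries.X) = 1 := by
      rw [oneSubPow_mul_one_sub_X, neg_add_cancel, oneSubPow_zero]
    calc f = f * (oneSubPow (-1) * (1 - PowerSeries.X)) := by rw [h, mul_one]
      _ = _ := by ring
  constructor
  · conv_lhs => rw [e]
    simp
  · intro m
    conv_lhs => rw [e]
    simp [PowerSeries.coeff_succ_mul_X]
    ring

/-- For positive order, the convolution quadrature is a convolution of the increments. -/
lemma cq_succ_of_pos {X : Type} [AddCommGroup X] [Module ℝ X] {γ κ : ℝ} (hγ : 0 < γ) (hκ : 0 < κ)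
    (g : ℕ → X) (m : ℕ) :
    cq γ κ g (m + 1) = κ ^ (-γ) • ∑ j ∈ Finset.range (m + 1),
      coeff (m - j) (bdfSeries γ * oneSubPow (-1)) • (g (j + 1) - g j) := by
  have h := sum_conv_shift (b := fun m => coeff m (bdfSeries γ))
    (s := fun m => coeff m (bdfSeries γ * oneSubPow (-1))) (c := -1) (coeff_of_mul_oneSubPow_neg_one (bdfSeries γ)).1
    (coeff_of_mul_oneSubPow_neg_one (bdfSeries γ)).2 (fun j => g j - g 0) m
  simp only [sub_self, smul_zero, zero_add] at h
  rw [cq, Finset.sum_range_succ']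
  simp only [hγ, if_true, one_smul, sub_self, smul_zero, add_zero, cqWeight_eq_bdfSeries γ hκ,
    mul_smul, Nat.add_sub_add_right]
  rw [← Finset.smul_sum, h]
  congr 1
  refine Finset.sum_congr rfl fun j _ => ?_
  congr 1
  module

/-- The bounds of the increments of the central differences: the first two are controlled by the
oscillation of the second derivative, the others by the fourth derivative. -/
lemma norm_increment_le {X : Type} [NormedAddCommGroup X] [NormedSpace ℝ X] {T κ η : ℝ}
    {S : ℕ → ℝ} {u : ℕ → ℝ → X} (hκ : 0 < κ) (hη : 0 ≤ η) (hS : ∀ j, 0 ≤ S j)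
    (h : StepBounds T κ η S u) {j : ℕ} (hj : ((j + 2 : ℕ) : ℝ) * κ ≤ T) :
    ‖(κ / 2) • (u 2 ((j + 1 : ℕ) * κ) + u 2 (j * κ)) -
      (centralDiff κ (u 1 0) (fun i => u 0 (i * κ)) (j + 1) -
        centralDiff κ (u 1 0) (fun i => u 0 (i * κ)) j)‖ ≤
      κ * (if j ≤ 1 then 15 * η else 135 * (κ ^ 2 * S (j - 1))) := by
  rcases j with _ | _ | j
  · have hb : (0 : ℝ) + 2 * κ ≤ T := by push_cast at hj; linarith
    have := norm_first_increment_le hκ hη (h.window (k := 0) (by norm_num) le_rfl hb)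
      (h.window (k := 1) (by norm_num) le_rfl hb) (h.osc_window le_rfl hb (by linarith))
    simp only [zero_add] at this
    simp only [centralDiff, zero_add, one_ne_zero, if_false, if_true, Nat.cast_one, one_mul,
      Nat.cast_zero, zero_mul, zero_le, Nat.sub_self]
    norm_num only [Nat.cast_ofNat]
    refine this.trans ?_
    have : 0 ≤ κ * η := by positivity
    linarith
  · have hb : (0 : ℝ) + 3 * κ ≤ T := by push_cast at hj; linarith
    have := norm_central_diff_increment_le_of_osc hκ hη
      (h.window (k := 0) (by norm_num) le_rfl hb)
      (h.window (k := 1) (by norm_num) le_rfl hb) (h.osc_window le_rfl hb le_rfl)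
    simp only [zero_add] at this
    simp only [centralDiff, zero_add, one_ne_zero, if_false, if_true, Nat.cast_one, one_mul,
      Nat.cast_zero, zero_mul, le_refl, Nat.sub_self, Nat.reduceAdd,
      OfNat.ofNat_ne_zero, Nat.reduceSub, Nat.cast_ofNat]
    refine this.trans ?_
    have : 0 ≤ κ * η := by positivity
    linarith
  · have e0 : ((j + 1 : ℕ) : ℝ) * κ = (j + 1) * κ := by push_cast; ring
    have e1 : ((j + 1 + 1 : ℕ) : ℝ) * κ = (j + 1 : ℕ) * κ + κ := by push_cast; ring
    have e2 : ((j + 1 + 1 + 1 : ℕ) : ℝ) * κ = (j + 1 : ℕ) * κ + 2 * κ := by push_cast; ring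
    have e3 : ((j + 1 + 1 + 1 + 1 : ℕ) : ℝ) * κ = (j + 1 : ℕ) * κ + 3 * κ := by push_cast; ring
    have hb : ((j + 1 : ℕ) : ℝ) * κ + 3 * κ ≤ T := by rw [← e3]; exact hj
    have ha : 0 < ((j + 1 : ℕ) : ℝ) * κ := by positivity
    have := norm_central_diff_increment_le_of_deriv hκ (hS (j + 1))
      (h.window' (k := 0) (by norm_num) ha hb)
      (h.window' (k := 1) (by norm_num) ha hb)
      (h.window' (k := 2) (by norm_num) ha hb)
      (h.window' (k := 3) (by norm_num) ha hb)
      (h.fourth_window (by omega) hb le_rfl)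
    have hc1 : ∀ i : ℕ, centralDiff κ (u 1 0) (fun i => u 0 (i * κ)) (i + 1) =
        (2 * κ)⁻¹ • (u 0 ((i + 1 + 1 : ℕ) * κ) - u 0 (i * κ)) := by
      intro i; simp [centralDiff]
    rw [hc1, hc1, e3, e2, e1]
    have hif : ¬ (j + 1 + 1 ≤ 1) := by omega
    simp only [hif, if_false, Nat.add_sub_cancel]
    refine this.trans (le_of_eq ?_)
    ring

/-- The truncation error of the convolution quadrature of positive order, applied to central
differences, is a multiple of the initial acceleration plus a small remainder. After a summation by
parts the quadrature acts on increments of the central differences, which approximate integrals of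
`u 2` over one step, so that it is compared with the Riemann–Liouville integral of order `1 - γ` of
`u 2`. -/
lemma exists_cq_truncation_of_pos {γ : ℝ} (hγ : 0 < γ) (hγ' : γ < 1) {T : ℝ} (hT : 0 < T) :
    ∃ C > 0, ∀ (X : Type) [NormedAddCommGroup X] [NormedSpace ℝ X] [CompleteSpace X]
      (u : ℕ → ℝ → X) (κ η : ℝ) (S : ℕ → ℝ) (N : ℕ), 0 < κ → κ ≤ 1 → N * κ = T →
      (∀ j, 0 ≤ S j) → StepBounds T κ η S u →
      ∃ (ε : ℕ → ℝ) (τ : ℕ → X),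
        (∀ n ∈ Finset.Ico 1 N, rlIntegral (1 - γ) (u 2) (n * κ) -
          cq γ κ (centralDiff κ (u 1 0) fun j => u 0 (j * κ)) n = ε n • u 2 0 + τ n) ∧
        κ * ∑ n ∈ Finset.Ico 1 N, |ε n| ≤ C * κ ^ (2 - γ) ∧
        κ * ∑ n ∈ Finset.Ico 1 N, ‖τ n‖ ≤
          C * (κ * η + κ * ∑ j ∈ Finset.Ico 1 N, κ ^ 2 * S j) := by
  have hγm : -1 < γ := by linarith
  obtain ⟨A₁, hA₁, hs⟩ := exists_forall_abs_le_of_isBigO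
    (isBigO_coeff_bdfSeries_mul_oneSubPow_neg_one hγm hγ')
  obtain ⟨A₂, hA₂, hl⟩ := exists_forall_abs_le_of_isBigO (isBigO_quadrature_linear hγm hγ')
  obtain ⟨A₃, hA₃, hq⟩ := exists_forall_abs_le_of_isBigO (isBigO_quadrature_quadratic hγm hγ')
  have hβ : 0 < 1 - γ := by linarith
  obtain ⟨C₁, hC₁, hK⟩ := exists_sum_kernelSum_le hβ (T := T)
  obtain ⟨C₂, hC₂, hR⟩ := exists_rpow_mul_sum_Ico_le hβ (T := T)
  obtain ⟨C₃, hC₃, hR'⟩ := exists_sum_Ico_rpow_le (s := -γ - 1) (by linarith)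
  have hΓ : 0 < Real.Gamma (1 + (1 - γ)) := Real.Gamma_pos_of_pos (by linarith)
  set D := ((Real.Gamma (1 + (1 - γ)))⁻¹ + A₃ + A₁) * C₁ * 150 + A₃ * C₂ with hD
  refine ⟨A₂ * (C₃ * 2) + D, by positivity, ?_⟩
  intro X _ _ _ u κ η S N hκ hκ1 hN hS h
  have hη : 0 ≤ η := h.osc_nonneg hT.le hκ.le
  set β := 1 - γ with hβdef
  have eβ : -γ = β - 1 := by rw [hβdef]; ring
  -- `s` are the weights of the increments of the central differences; replacing the increments by
  -- the trapezoidal rule for `u 2` turns them into the weights `w` of the values of `u 2`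
  set s : ℕ → ℝ := fun n => coeff n (bdfSeries γ * oneSubPow (-1)) with hsdef
  set w : ℕ → ℝ := fun n => coeff n (bdfSeries γ * oneSubPow (-1) *
    ((1 + PowerSeries.X) * PowerSeries.C (1 / 2))) with hwdef
  have hw0 : 2 * w 0 = s 0 := by
    rw [hwdef, hsdef]; simp only; rw [(coeff_mul_one_add_X_half _).1]; ring
  have hw1 : ∀ m, 2 * w (m + 1) = s (m + 1) + 1 * s m := fun m => by
    rw [hwdef, hsdef]; simp only; rw [(coeff_mul_one_add_X_half _).2]; ring
  -- minus the error made for the constant function `1`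
  set E : ℕ → ℝ := fun n => κ ^ β * (s (n - 1) / 2 + ∑ j ∈ Finset.Ico 1 (n + 1), w (n - j) -
    (n : ℝ) ^ β / Real.Gamma (1 + β)) with hE
  set ν : ℕ → ℝ := fun j => if j = 0 then 15 * η else 135 * (κ ^ 2 * S j) with hν
  set ν' : ℕ → ℝ := fun j => if j ≤ 1 then 15 * η else 135 * (κ ^ 2 * S (j - 1)) with hν'
  set bd : ℕ → X := centralDiff κ (u 1 0) (fun j => u 0 (j * κ)) with hbd
  set err : ℕ → X := fun n => rlIntegral β (u 2) (n * κ) - cq γ κ bd n with herr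
  have hnT : ∀ n : ℕ, n ≤ N → n * κ ≤ T := fun n hn => by
    rw [← hN]; gcongr
  have hνn : ∀ j, 0 ≤ ν j := fun j => by
    have := hS j
    simp only [hν]; split_ifs <;> positivity
  have hνn' : ∀ j, 0 ≤ ν' j := fun j => by
    have := hS (j - 1)
    simp only [hν']; split_ifs <;> positivity
  have hκβ : κ ^ (-γ) = κ ^ β * κ⁻¹ := by
    rw [eβ, Real.rpow_sub hκ, Real.rpow_one, div_eq_mul_inv]
  have hτ : ∀ n ∈ Finset.Ico 1 N, ‖err n + E n • u 2 0‖ ≤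
      ((Real.Gamma (1 + β))⁻¹ + A₃) * kernelSum β κ ν n +
        A₃ * (κ ^ β * (n : ℝ) ^ (β - 1)) * η + A₁ * kernelSum β κ ν' n := by
    intro n hn
    obtain ⟨hn1, hnN⟩ := Finset.mem_Ico.1 hn
    have hQ := norm_rlIntegral_sub_quadrature_le (β := β) (κ := κ) (A := A₃) (n := n) (G := u 2)
      (ν := ν) (w := w) (q := s (n - 1) / 2) hβ (by linarith) hκ hA₃.le hn1
      (h.cont.mono (Icc_subset_Icc le_rfl (hnT n hnN.le))) ?_ ?_ ?_
    · have hG : ‖u 2 κ - u 2 0‖ ≤ η := by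
        have hκT : κ ≤ T := by
          have := hnT 1 (by omega)
          simpa using this
        exact h.osc 0 κ le_rfl hκ.le hκT (by linarith)
      have hconv := norm_conv_le_kernelSum (X := X) (β := β) (κ := κ) (A := A₁) hκ hA₁.le (n := n)
        (σ := s) (θ := fun j => κ⁻¹ • ((κ / 2) • (u 2 (j * κ) + u 2 ((j - 1 : ℕ) * κ)) -
          (bd j - bd (j - 1)))) (ν := ν') (by rw [← eβ]; exact hs) ?_
      · obtain ⟨m, rfl⟩ : ∃ m, n = m + 1 := ⟨n - 1, by omega⟩
        have hquad : (s (m + 1 - 1) / 2) • u 2 0 + ∑ j ∈ Finset.Ico 1 (m + 1 + 1),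
            w (m + 1 - j) • u 2 (j * κ) = ∑ j ∈ Finset.range (m + 1),
              s (m - j) • ((2 : ℝ)⁻¹ • (u 2 ((j + 1 : ℕ) * κ) + u 2 (j * κ))) := by
          have := sum_conv_shift (s := s) (b := fun m => 2 * w m) (c := 1) hw0 hw1
            (fun j => (2 : ℝ)⁻¹ • u 2 (j * κ)) m
          rw [sum_Ico_one_succ]
          simp only [Nat.add_sub_add_right, Nat.add_sub_cancel]
          simp only [one_mul, ← smul_add, smul_smul, Nat.cast_zero, zero_mul] at this ⊢
          rw [← this, div_eq_mul_inv]
          congr 1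
          refine Finset.sum_congr rfl fun j _ => ?_
          congr 1; ring
        have hsplit : err (m + 1) + E (m + 1) • u 2 0 =
            (rlIntegral β (u 2) ((m + 1 : ℕ) * κ) -
              κ ^ β • ((s (m + 1 - 1) / 2) • u 2 0 +
                ∑ j ∈ Finset.Ico 1 (m + 1 + 1), w (m + 1 - j) • u 2 (j * κ)) +
              E (m + 1) • u 2 0) +
            κ ^ β • ∑ j ∈ Finset.Ico 1 (m + 1 + 1), s (m + 1 - j) •
              (κ⁻¹ • ((κ / 2) • (u 2 (j * κ) + u 2 ((j - 1 : ℕ) * κ)) - (bd j - bd (j - 1)))) := by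
          rw [hquad, sum_Ico_one_succ]
          simp only [herr, cq_succ_of_pos hγ hκ, hκβ, Nat.add_sub_add_right, Nat.add_sub_cancel]
          have e : ∀ j ∈ Finset.range (m + 1), s (m - j) • (κ⁻¹ •
              ((κ / 2) • (u 2 ((j + 1 : ℕ) * κ) + u 2 (j * κ)) - (bd (j + 1) - bd j))) =
              s (m - j) • ((2 : ℝ)⁻¹ • (u 2 ((j + 1 : ℕ) * κ) + u 2 (j * κ))) -
                κ⁻¹ • (s (m - j) • (bd (j + 1) - bd j)) := by
            intro j _
            rw [smul_sub, smul_sub, smul_smul κ⁻¹, smul_comm κ⁻¹]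
            congr 4
            field_simp
          rw [Finset.sum_congr rfl e, Finset.sum_sub_distrib, ← Finset.smul_sum]
          module
        rw [hsplit]
        refine (norm_add_le _ _).trans (add_le_add (hQ.trans ?_) hconv)
        gcongr
      · intro j hj hjn
        obtain ⟨i, rfl⟩ : ∃ i, j = i + 1 := ⟨j - 1, by omega⟩
        have := norm_increment_le hκ hη hS h (j := i) (hnT (i + 2) (by omega))
        simp only [Nat.add_sub_cancel]
        rw [norm_smul, Real.norm_of_nonneg (by positivity), inv_mul_le_iff₀ hκ]
        exact this
    · intro j hj t ht
      have e1 : ((j + 1 : ℕ) : ℝ) * κ = j * κ + κ := by push_cast; ring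
      have hb : (j : ℝ) * κ + κ ≤ T := by
        rw [← e1]; exact hnT _ (by omega)
      rw [e1] at ht ⊢
      rcases j with _ | j
      · simp only [Nat.cast_zero, zero_mul, zero_add, sub_zero] at ht hb ⊢
        have h1 := h.osc 0 t le_rfl ht.1 (ht.2.trans hb) (by linarith [ht.2])
        have h2 := h.osc 0 κ le_rfl hκ.le hb (by linarith)
        have := norm_lin_sub_le (div_nonneg ht.1 hκ.le) ((div_le_one hκ).2 ht.2) h1 h2
        rw [sub_add_eq_sub_sub]
        refine this.trans ?_
        simp only [hν, if_true]; linarith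
      · have ha : 0 < ((j + 1 : ℕ) : ℝ) * κ := by positivity
        have := norm_interp_le_of_deriv hκ (hS (j + 1))
          (h.window' (k := 2) (by norm_num) ha hb)
          (h.window' (k := 3) (by norm_num) ha hb)
          (h.fourth_window (by omega) hb (by linarith)) ht
        have e3 : (t - ((j + 1 : ℕ) : ℝ) * κ) / κ = t / κ - ((j + 1 : ℕ) : ℝ) := by field_simp
        rw [e3] at this
        refine this.trans ?_
        have : 0 ≤ κ ^ 2 * S (j + 1) := mul_nonneg (by positivity) (hS _)
        simp only [hν, Nat.add_eq_zero_iff, one_ne_zero, and_false, if_false]; linarith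
    · intro i hi
      have e1 : ((i + 1 : ℕ) : ℝ) * κ = i * κ + κ := by push_cast; ring
      have e2 : ((i + 2 : ℕ) : ℝ) * κ = i * κ + 2 * κ := by push_cast; ring
      have hb : (i : ℝ) * κ + 2 * κ ≤ T := by
        rw [← e2]; exact hnT _ (by omega)
      rw [e1, e2]
      rcases i with _ | i
      · simp only [Nat.cast_zero, zero_mul, zero_add] at hb ⊢
        have h1 := h.osc κ (2 * κ) hκ.le (by linarith) hb (by linarith)
        have h2 := h.osc 0 κ le_rfl hκ.le (by linarith) (by linarith)
        have e : u 2 (2 * κ) - (2 : ℝ) • u 2 κ + u 2 0 =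
            (u 2 (2 * κ) - u 2 κ) - (u 2 κ - u 2 0) := by module
        rw [e]
        refine (norm_sub_le _ _).trans ?_
        simp only [hν, if_true]; linarith
      · have ha : 0 < ((i + 1 : ℕ) : ℝ) * κ := by positivity
        have := norm_second_diff_le_of_deriv hκ (hS (i + 1))
          (h.window' (k := 2) (by norm_num) ha hb)
          (h.window' (k := 3) (by norm_num) ha hb)
          (h.fourth_window (by omega) hb (by linarith))
        refine this.trans ?_
        have : 0 ≤ κ ^ 2 * S (i + 1) := mul_nonneg (by positivity) (hS _)
        simp only [hν, Nat.add_eq_zero_iff, one_ne_zero, and_false, if_false]; linarith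
    · intro m
      have := hq m
      have e : bdfSeries γ * (PowerSeries.X * (1 + PowerSeries.X) * PowerSeries.C (1 / 2) *
          oneSubPow (-3)) = bdfSeries γ * oneSubPow (-1) * ((1 + PowerSeries.X) *
            PowerSeries.C (1 / 2)) * (PowerSeries.X * oneSubPow (-2)) := by
        rw [show (-3 : ℝ) = -1 + -2 by norm_num, oneSubPow_add]; ring
      rw [e, coeff_mul_X_mul_oneSubPow_neg_two] at this
      have e1 : 2 - γ = 1 + β := by rw [hβdef]; ring
      have e2 : 3 - γ = 2 + β := by rw [hβdef]; ring
      rw [e1, e2, eβ] at this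
      exact this
  have hEb : ∀ n ∈ Finset.Ico 1 N, |E n| ≤ A₂ * κ ^ β * (n : ℝ) ^ (-γ - 1) := by
    intro n hn
    obtain ⟨hn1, hnN⟩ := Finset.mem_Ico.1 hn
    have hn0 : (0 : ℝ) < n := by exact_mod_cast hn1
    have e : s (n - 1) / 2 + ∑ j ∈ Finset.Ico 1 (n + 1), w (n - j) =
        coeff n (bdfSeries γ * (PowerSeries.X * oneSubPow (-2))) := by
      obtain ⟨m, rfl⟩ : ∃ m, n = m + 1 := ⟨n - 1, by omega⟩
      have := sum_conv_shift (s := s) (b := fun m => 2 * w m) (c := 1) hw0 hw1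
        (fun _ => (1 / 2 : ℝ)) m
      have e1 : bdfSeries γ * (PowerSeries.X * oneSubPow (-2)) =
          PowerSeries.X * (bdfSeries γ * oneSubPow (-1) * oneSubPow (-1)) := by
        rw [show (-2 : ℝ) = -1 + -1 by norm_num, oneSubPow_add]; ring
      rw [e1, PowerSeries.coeff_succ_X_mul, coeff_mul_oneSubPow_neg_one, sum_Ico_one_succ]
      simp only [smul_eq_mul, one_mul] at this
      simp only [Nat.add_sub_add_right, Nat.add_sub_cancel]
      have e2 : ∀ j ∈ Finset.range (m + 1), 2 * w (m - j) * (1 / 2) = w (m - j) :=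
        fun j _ => by ring
      rw [Finset.sum_congr rfl e2] at this
      rw [div_eq_mul_one_div, this]
      refine Finset.sum_congr rfl fun j _ => ?_
      ring
    have h1 := hl n
    have h2 : ((n : ℝ) + 1) ^ (-γ - 1) ≤ (n : ℝ) ^ (-γ - 1) :=
      Real.rpow_le_rpow_of_nonpos hn0 (by linarith) (by linarith)
    simp only [hE, e]
    rw [abs_mul, abs_of_pos (by positivity : 0 < κ ^ β)]
    have e3 : 2 - γ = 1 + β := by rw [hβdef]; ring
    rw [e3] at h1
    calc κ ^ β * |coeff n (bdfSeries γ * (PowerSeries.X * oneSubPow (-2))) -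
          (n : ℝ) ^ β / Real.Gamma (1 + β)|
        ≤ κ ^ β * (A₂ * (n : ℝ) ^ (-γ - 1)) := by
          gcongr
          exact h1.trans (by gcongr)
      _ = _ := by ring
  have hN1 : 1 ≤ N := by
    rcases Nat.eq_zero_or_pos N with h0 | h0
    · rw [h0] at hN; simp at hN; linarith
    · exact h0
  refine ⟨fun n => -E n, fun n => err n + E n • u 2 0, ?_, ?_, ?_⟩
  · intro n hn
    simp only [herr]
    module
  · simp only [abs_neg]
    have hN' : (N : ℝ) ^ (-γ - 1 + 1) ≤ 1 :=
      Real.rpow_le_one_of_one_le_of_nonpos (by exact_mod_cast hN1) (by linarith)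
    calc κ * ∑ n ∈ Finset.Ico 1 N, |E n|
        ≤ κ * ∑ n ∈ Finset.Ico 1 N, A₂ * κ ^ β * (n : ℝ) ^ (-γ - 1) := by
          gcongr with n hn
          exact hEb n hn
      _ = A₂ * (∑ n ∈ Finset.Ico 1 N, (n : ℝ) ^ (-γ - 1)) * κ ^ (2 - γ) := by
          have : κ ^ (2 - γ) = κ * κ ^ β := by
            rw [show 2 - γ = 1 + β by rw [hβdef]; ring, Real.rpow_add hκ, Real.rpow_one]
          rw [← Finset.mul_sum, this]; ring
      _ ≤ A₂ * (C₃ * 2) * κ ^ (2 - γ) := by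
          gcongr
          refine (hR' N).trans ?_
          gcongr
          linarith
      _ ≤ _ := by
          gcongr
          have h1 : 0 ≤ D := by positivity
          linarith
  · set Z := κ * ∑ j ∈ Finset.Ico 1 N, κ ^ 2 * S j with hZ
    have hZ0 : 0 ≤ Z := mul_nonneg hκ.le (Finset.sum_nonneg fun j _ =>
      mul_nonneg (by positivity) (hS j))
    obtain ⟨N', rfl⟩ : ∃ N', N = N' + 1 := ⟨N - 1, by omega⟩
    have e1 : ∑ j ∈ Finset.range (N' + 1), ν j =
        15 * η + 135 * ∑ j ∈ Finset.Ico 1 (N' + 1), κ ^ 2 * S j := by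
      rw [Finset.sum_range_succ', sum_Ico_one_succ, Finset.mul_sum, add_comm]
      simp [hν]
    have e2 : ∑ j ∈ Finset.range (N' + 1), ν' j ≤
        30 * η + 135 * ∑ j ∈ Finset.Ico 1 (N' + 1), κ ^ 2 * S j := by
      rw [Finset.sum_range_succ']
      have e : ∀ j, ν' (j + 1) = ν j := by
        intro j; simp [hν, hν']
      have : ν' 0 = 15 * η := by simp [hν']
      simp only [e, this]
      have h1 := Finset.sum_range_succ ν N'
      have h2 := hνn N'
      linarith
    have hsν : κ * ∑ n ∈ Finset.Ico 1 (N' + 1), kernelSum β κ ν n ≤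
        C₁ * (150 * (κ * η + Z)) := by
      calc κ * ∑ n ∈ Finset.Ico 1 (N' + 1), kernelSum β κ ν n
          ≤ κ * (C₁ * ∑ j ∈ Finset.range (N' + 1), ν j) := by
            gcongr; exact hK (N' + 1) κ ν hκ hN hνn
        _ = C₁ * (15 * (κ * η) + 135 * Z) := by rw [e1, hZ]; ring
        _ ≤ _ := by
          have : 0 ≤ κ * η := by positivity
          gcongr
          linarith
    have hsν' : κ * ∑ n ∈ Finset.Ico 1 (N' + 1), kernelSum β κ ν' n ≤
        C₁ * (150 * (κ * η + Z)) := by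
      calc κ * ∑ n ∈ Finset.Ico 1 (N' + 1), kernelSum β κ ν' n
          ≤ κ * (C₁ * ∑ j ∈ Finset.range (N' + 1), ν' j) := by
            gcongr; exact hK (N' + 1) κ ν' hκ hN hνn'
        _ ≤ κ * (C₁ * (30 * η + 135 * ∑ j ∈ Finset.Ico 1 (N' + 1), κ ^ 2 * S j)) := by
            gcongr
        _ = C₁ * (30 * (κ * η) + 135 * Z) := by rw [hZ]; ring
        _ ≤ _ := by
          have : 0 ≤ κ * η := by positivity
          gcongr
          linarith
    calc κ * ∑ n ∈ Finset.Ico 1 (N' + 1), ‖err n + E n • u 2 0‖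
        ≤ κ * ∑ n ∈ Finset.Ico 1 (N' + 1), (((Real.Gamma (1 + β))⁻¹ + A₃) * kernelSum β κ ν n +
          A₃ * (κ ^ β * (n : ℝ) ^ (β - 1)) * η + A₁ * kernelSum β κ ν' n) := by
          gcongr with n hn
          exact hτ n hn
      _ = ((Real.Gamma (1 + β))⁻¹ + A₃) * (κ * ∑ n ∈ Finset.Ico 1 (N' + 1), kernelSum β κ ν n) +
          A₃ * (κ ^ β * ∑ n ∈ Finset.Ico 1 (N' + 1), (n : ℝ) ^ (β - 1)) * (κ * η) +
          A₁ * (κ * ∑ n ∈ Finset.Ico 1 (N' + 1), kernelSum β κ ν' n) := by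
          simp only [Finset.sum_add_distrib, ← Finset.mul_sum, ← Finset.sum_mul]
          ring
      _ ≤ ((Real.Gamma (1 + β))⁻¹ + A₃) * (C₁ * (150 * (κ * η + Z))) +
          A₃ * C₂ * (κ * η) + A₁ * (C₁ * (150 * (κ * η + Z))) := by
          gcongr
          exact hR (N' + 1) κ hκ hκ1 hN
      _ ≤ D * (κ * η + Z) := by
          have p1 : 0 ≤ A₃ * C₂ * Z := by positivity
          have : D * (κ * η + Z) = ((Real.Gamma (1 + β))⁻¹ + A₃) * (C₁ * (150 * (κ * η + Z))) +
            A₃ * C₂ * (κ * η) + A₁ * (C₁ * (150 * (κ * η + Z))) + A₃ * C₂ * Z := by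
            rw [hD]; ring
          linarith
      _ ≤ _ := by
          have p1 : 0 ≤ κ * η := by positivity
          gcongr
          have : 0 ≤ A₂ * (C₃ * 2) := by positivity
          linarith

end FracWave

/-! ### The Poincaré inequality and the projections onto the discrete space -/

namespace FracWave

section Linear
variable {d : ℕ} {Ω : Set (Euc d)}

/-- The embedding `H¹₀(Ω) → L²(Ω)` as a linear map. -/
def toL2L (Ω : Set (Euc d)) : H10 Ω →ₗ[ℝ] L2 ℝ Ω where
  toFun := toL2
  map_add' _ _ := rfl
  map_smul' _ _ := rfl

/-- The gradient `H¹₀(Ω) → L²(Ω; ℝ^d)` as a linear map. -/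
def gradL (Ω : Set (Euc d)) : H10 Ω →ₗ[ℝ] L2 (Euc d) Ω where
  toFun := grad
  map_add' _ _ := rfl
  map_smul' _ _ := rfl

lemma toL2_sub (v w : H10 Ω) : toL2 (v - w) = toL2 v - toL2 w := map_sub (toL2L Ω) v w
lemma toL2_add (v w : H10 Ω) : toL2 (v + w) = toL2 v + toL2 w := rfl
lemma toL2_smul (a : ℝ) (w : H10 Ω) : toL2 (a • w) = a • toL2 w := rfl
lemma grad_sub (v w : H10 Ω) : grad (v - w) = grad v - grad w := map_sub (gradL Ω) v w
lemma grad_add (v w : H10 Ω) : grad (v + w) = grad v + grad w := rfl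
lemma grad_smul (a : ℝ) (w : H10 Ω) : grad (a • w) = a • grad w := rfl

lemma norm_sq_eq (w : H10 Ω) : ‖w‖ ^ 2 = ‖toL2 w‖ ^ 2 + ‖grad w‖ ^ 2 :=
  WithLp.prod_norm_sq_eq_of_L2 (w : PairSpace Ω)

lemma norm_grad_le (w : H10 Ω) : ‖grad w‖ ≤ ‖w‖ := by
  refine le_of_sq_le_sq ?_ (norm_nonneg _)
  rw [norm_sq_eq]; nlinarith [sq_nonneg ‖toL2 w‖]

lemma eq_zero_of_toL2_of_grad {w : H10 Ω} (h₁ : ‖toL2 w‖ = 0) (h₂ : ‖grad w‖ = 0) : w = 0 := by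
  have := norm_sq_eq w
  rw [h₁, h₂] at this
  simpa using this

end Linear

/-! #### Poincaré's inequality -/

/-- Poincaré's inequality for test functions, by integrating `∂ᵢ(xᵢ φ²)`. -/
lemma integral_sq_le_of_isTestFunction {d : ℕ} {Ω : Set (Euc d)} {R : ℝ} (i : Fin d)
    (hR : ∀ x ∈ Ω, |x i| ≤ R) {φ : Euc d → ℝ} (hφ : IsTestFunction Ω φ) :
    ∫ x, φ x ^ 2 ≤ 4 * R ^ 2 * ∫ x, ‖gradient φ x‖ ^ 2 := by
  set e : Euc d := EuclideanSpace.single i (1 : ℝ) with he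
  have hd : Differentiable ℝ φ := hφ.smooth.differentiable (by simp)
  have hdc : Continuous (fderiv ℝ φ) := hφ.smooth.continuous_fderiv (by simp)
  have hxi : ∀ x : Euc d, HasFDerivAt (fun x : Euc d => x i)
      (EuclideanSpace.proj i : Euc d →L[ℝ] ℝ) x :=
    fun x => (EuclideanSpace.proj i : Euc d →L[ℝ] ℝ).hasFDerivAt
  have hsq : ∀ x v, fderiv ℝ (fun x => φ x ^ 2) x v = 2 * φ x * fderiv ℝ φ x v := by
    intro x v
    have := ((hd x).hasFDerivAt.pow 2).fderiv
    rw [this]; simp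
  have hc0 : Continuous φ := hφ.smooth.continuous
  have hci : Continuous fun x : Euc d => x i := (EuclideanSpace.proj i : Euc d →L[ℝ] ℝ).continuous
  have hce : Continuous fun x => fderiv ℝ φ x e := hdc.clm_apply continuous_const
  have hcs : HasCompactSupport φ := hφ.compact
  have int1 : Integrable fun x => φ x ^ 2 :=
    (hc0.pow 2).integrable_of_hasCompactSupport (by
      simpa [pow_two] using hcs.mul_left (f := φ))
  have int2 : Integrable fun x : Euc d => x i * (2 * φ x * fderiv ℝ φ x e) := by
    refine Continuous.integrable_of_hasCompactSupport (by fun_prop) ?_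
    have h1 : HasCompactSupport fun x : Euc d => φ x * (2 * x i * fderiv ℝ φ x e) :=
      hcs.mul_right
    exact h1.mono fun x hx => by
      simp only [Function.mem_support] at hx ⊢
      convert hx using 1; ring
  have int3 : Integrable fun x : Euc d => x i * φ x ^ 2 := by
    refine Continuous.integrable_of_hasCompactSupport (by fun_prop) ?_
    have h1 : HasCompactSupport fun x : Euc d => φ x * (x i * φ x) := hcs.mul_right
    exact h1.mono fun x hx => by
      simp only [Function.mem_support] at hx ⊢
      convert hx using 1; ring
  have hgn : ∀ x, ‖gradient φ x‖ = ‖fderiv ℝ φ x‖ := fun x => by simp [gradient]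
  have int4 : Integrable fun x => ‖gradient φ x‖ ^ 2 := by
    simp only [hgn]
    refine Continuous.integrable_of_hasCompactSupport (by fun_prop) ?_
    have h1 : HasCompactSupport fun x => ‖fderiv ℝ φ x‖ := (hcs.fderiv ℝ).norm
    simp only [pow_two]
    exact h1.mul_left (f := fun x => ‖fderiv ℝ φ x‖)
  have hfe : ∀ x : Euc d, fderiv ℝ (fun x : Euc d => x i) x e = 1 := fun x => by
    rw [(hxi x).fderiv]; simp [he]
  have ibp := integral_mul_fderiv_eq_neg_fderiv_mul_of_integrable (μ := (volume : Measure (Euc d)))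
    (f := fun x : Euc d => x i) (g := fun x => φ x ^ 2) (v := e) (by simpa [hfe] using int1)
    (by simpa only [hsq] using int2) int3 (fun x _ => (hxi x).differentiableAt)
    (fun x _ => ((hd x).pow 2))
  simp only [hsq, hfe, one_mul] at ibp
  have hpt : ∀ x : Euc d, -(x i * (2 * φ x * fderiv ℝ φ x e)) ≤
      1 / 2 * φ x ^ 2 + 2 * R ^ 2 * ‖gradient φ x‖ ^ 2 := by
    intro x
    by_cases hx : x ∈ Ω
    · have h1 := hR x hx
      have h2 : |fderiv ℝ φ x e| ≤ ‖gradient φ x‖ := by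
        rw [hgn]
        have := (fderiv ℝ φ x).le_opNorm e
        simpa [he] using this
      have h3 : |x i * fderiv ℝ φ x e| ≤ R * ‖gradient φ x‖ := by
        rw [abs_mul]
        exact mul_le_mul h1 h2 (abs_nonneg _) ((abs_nonneg _).trans h1)
      have h4 := sq_le_sq' (abs_le.1 h3).1 (abs_le.1 h3).2
      nlinarith [sq_nonneg (φ x + 2 * (x i * fderiv ℝ φ x e))]
    · have : φ x = 0 := by
        by_contra h0
        exact hx (hφ.support (subset_tsupport _ h0))
      rw [this]
      have : 0 ≤ 2 * R ^ 2 * ‖gradient φ x‖ ^ 2 := by positivity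
      simpa using this
  have h5 : ∫ x, -(x i * (2 * φ x * fderiv ℝ φ x e)) ≤
      ∫ x, (1 / 2 * φ x ^ 2 + 2 * R ^ 2 * ‖gradient φ x‖ ^ 2) :=
    integral_mono int2.neg ((int1.const_mul _).add (int4.const_mul _)) hpt
  rw [integral_neg, integral_add (int1.const_mul _) (int4.const_mul _), integral_const_mul,
    integral_const_mul, ibp] at h5
  linarith

/-- The `L²` norm of a class represented by a function that vanishes outside `Ω`, as an integral over
the whole space. -/
lemma norm_sq_eq_integral {d : ℕ} {Ω : Set (Euc d)} {F : Type} [NormedAddCommGroup F]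
    [InnerProductSpace ℝ F] {f : L2 F Ω} {g : Euc d → F} (h : f =ᵐ[volume.restrict Ω] g)
    (hg : ∀ x ∉ Ω, g x = 0) : ‖f‖ ^ 2 = ∫ x, ‖g x‖ ^ 2 := by
  rw [← real_inner_self_eq_norm_sq, L2.inner_def]
  have e : ∫ x in Ω, ⟪f x, f x⟫ = ∫ x in Ω, ‖g x‖ ^ 2 := by
    refine integral_congr_ae (h.mono fun x hx => ?_)
    simp only [hx, real_inner_self_eq_norm_sq]
  rw [e]
  refine setIntegral_eq_integral_of_forall_compl_eq_zero fun x hx => ?_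
  simp [hg x hx]

/-- Poincaré's inequality on a bounded open set. Integration by parts against a coordinate `xᵢ`
gives `∫ φ² = -2 ∫ xᵢ φ ∂ᵢφ` for test functions, and both sides are continuous in `H¹`. -/
lemma exists_poincare {d : ℕ} (hd : 1 ≤ d) {Ω : Set (Euc d)} (hΩb : Bornology.IsBounded Ω) :
    ∃ K > 0, ∀ w : H10 Ω, ‖toL2 w‖ ≤ K * ‖grad w‖ := by
  obtain ⟨R, hR0, hR⟩ := hΩb.exists_pos_norm_le
  refine ⟨2 * R, by positivity, fun w => ?_⟩
  have hcl : IsClosed {p : PairSpace Ω | ‖p.fst‖ ≤ 2 * R * ‖p.snd‖} := by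
    refine isClosed_le ?_ ?_
    · exact ((WithLp.fstL 2 ℝ (L2 ℝ Ω) (L2 (Euc d) Ω)).continuous).norm
    · exact continuous_const.mul ((WithLp.sndL 2 ℝ (L2 ℝ Ω) (L2 (Euc d) Ω)).continuous).norm
  have hsub : ((testPairs Ω : Submodule ℝ (PairSpace Ω)) : Set (PairSpace Ω)) ⊆
      {p : PairSpace Ω | ‖p.fst‖ ≤ 2 * R * ‖p.snd‖} := by
    rintro p ⟨φ, hφ, h1, h2⟩
    have i : Fin d := ⟨0, hd⟩
    have hφ0 : ∀ x ∉ Ω, φ =ᶠ[nhds x] fun _ => 0 := fun x hx =>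
      notMem_tsupport_iff_eventuallyEq.1 fun h => hx (hφ.support h)
    have e1 := norm_sq_eq_integral h1 (fun x hx => (hφ0 x hx).self_of_nhds)
    have e2 := norm_sq_eq_integral h2 (fun x hx => by
      rw [gradient, (hφ0 x hx).fderiv_eq]; simp)
    have h3 := integral_sq_le_of_isTestFunction i (R := R)
      (fun x hx => (PiLp.norm_apply_le x i).trans (hR x hx)) hφ
    simp only [Real.norm_eq_abs, sq_abs] at e1
    show ‖p.fst‖ ≤ 2 * R * ‖p.snd‖
    refine le_of_sq_le_sq ?_ (by positivity)
    rw [mul_pow, e1, e2]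
    refine h3.trans (le_of_eq ?_)
    ring
  exact closure_minimal hsub hcl w.2

/-! #### The projections -/

/-- The Ritz and `L²` projections exist: both arise from the orthogonal projection onto the
finite-dimensional image of `V`. -/
lemma exists_mem_forall_inner_eq {H F : Type*} [AddCommGroup H] [Module ℝ H]
    [NormedAddCommGroup F] [InnerProductSpace ℝ F] (B : H →ₗ[ℝ] F) (V : Submodule ℝ H)
    [FiniteDimensional ℝ V] (y : F) : ∃ r ∈ V, ∀ v ∈ V, ⟪B r, B v⟫ = ⟪y, B v⟫ := by
  have hmem := ((V.map B).starProjection_apply_mem y)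
  obtain ⟨r, hr, hr'⟩ := (Submodule.mem_map).1 hmem
  refine ⟨r, hr, fun v hv => ?_⟩
  have h := (V.map B).starProjection_inner_eq_zero y (B v) (Submodule.mem_map_of_mem hv)
  rw [← hr', inner_sub_left] at h
  linarith

section Projections
variable {d : ℕ} {Ω : Set (Euc d)} (V : Submodule ℝ (H10 Ω)) [FiniteDimensional ℝ V]

lemma ritz_spec (w : H10 Ω) :
    ritz V w ∈ V ∧ ∀ v ∈ V, ⟪grad (ritz V w), grad v⟫ = ⟪grad w, grad v⟫ :=
  Classical.epsilon_spec (p := fun r => r ∈ V ∧ ∀ v ∈ V, ⟪grad r, grad v⟫ = ⟪grad w, grad v⟫)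
    (exists_mem_forall_inner_eq (gradL Ω) V (grad w))

lemma l2Proj_spec (w : L2 ℝ Ω) :
    l2Proj V w ∈ V ∧ ∀ v ∈ V, ⟪toL2 (l2Proj V w), toL2 v⟫ = ⟪w, toL2 v⟫ :=
  Classical.epsilon_spec (p := fun r => r ∈ V ∧ ∀ v ∈ V, ⟪toL2 r, toL2 v⟫ = ⟪w, toL2 v⟫)
    (exists_mem_forall_inner_eq (toL2L Ω) V w)

variable {V} {K : ℝ}

/-- The Ritz projection is unique, by Poincaré's inequality; its linearity follows. -/
lemma eq_ritz (hP : ∀ w : H10 Ω, ‖toL2 w‖ ≤ K * ‖grad w‖) {w r : H10 Ω} (hr : r ∈ V)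
    (h : ∀ v ∈ V, ⟪grad r, grad v⟫ = ⟪grad w, grad v⟫) : ritz V w = r := by
  obtain ⟨h1, h2⟩ := ritz_spec V w
  have hz : ⟪grad (ritz V w - r), grad (ritz V w - r)⟫ = 0 := by
    have hm := V.sub_mem h1 hr
    conv_lhs => rw [grad_sub (ritz V w) r]
    rw [← grad_sub, grad_sub, inner_sub_left, ← grad_sub, h2 _ hm, h _ hm, sub_self]
  have hg : ‖grad (ritz V w - r)‖ = 0 := by
    rw [real_inner_self_eq_norm_sq] at hz
    simpa using hz
  have ht : ‖toL2 (ritz V w - r)‖ = 0 := by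
    have := hP (ritz V w - r)
    rw [hg, mul_zero] at this
    exact le_antisymm this (norm_nonneg _)
  exact sub_eq_zero.1 (eq_zero_of_toL2_of_grad ht hg)

variable (V) in
/-- The Ritz projection as a linear map. -/
noncomputable def ritzL (hP : ∀ w : H10 Ω, ‖toL2 w‖ ≤ K * ‖grad w‖) : H10 Ω →ₗ[ℝ] H10 Ω where
  toFun := ritz V
  map_add' v w := by
    refine eq_ritz hP (V.add_mem (ritz_spec V v).1 (ritz_spec V w).1) fun z hz => ?_
    rw [grad_add, grad_add, inner_add_left, inner_add_left, (ritz_spec V v).2 z hz,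
      (ritz_spec V w).2 z hz]
  map_smul' a w := by
    refine eq_ritz hP (V.smul_mem a (ritz_spec V w).1) fun z hz => ?_
    rw [RingHom.id_apply, grad_smul, grad_smul, inner_smul_left, inner_smul_left,
      (ritz_spec V w).2 z hz]

lemma norm_grad_ritz_le (w : H10 Ω) : ‖grad (ritz V w)‖ ≤ ‖grad w‖ := by
  obtain ⟨h1, h2⟩ := ritz_spec V w
  have h := h2 _ h1
  rw [real_inner_self_eq_norm_sq] at h
  have h3 := real_inner_le_norm (grad w) (grad (ritz V w))
  rw [← h, pow_two] at h3
  rcases (norm_nonneg (grad (ritz V w))).eq_or_lt with h0 | h0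
  · rw [← h0]; exact norm_nonneg _
  · exact le_of_mul_le_mul_right h3 h0

lemma norm_toL2_ritz_le (hK : 0 ≤ K) (hP : ∀ w : H10 Ω, ‖toL2 w‖ ≤ K * ‖grad w‖) (w : H10 Ω) :
    ‖toL2 (ritz V w)‖ ≤ K * ‖w‖ :=
  (hP _).trans (mul_le_mul_of_nonneg_left ((norm_grad_ritz_le w).trans (norm_grad_le w)) hK)

lemma norm_le_of_poincare (hK : 0 ≤ K) (hP : ∀ w : H10 Ω, ‖toL2 w‖ ≤ K * ‖grad w‖) (w : H10 Ω) :
    ‖w‖ ≤ (K + 1) * ‖grad w‖ := by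
  refine le_of_sq_le_sq ?_ (by positivity)
  have h1 := hP w
  have h2 : ‖toL2 w‖ ^ 2 ≤ (K * ‖grad w‖) ^ 2 := by gcongr
  rw [norm_sq_eq]
  nlinarith [mul_nonneg hK (sq_nonneg ‖grad w‖)]

lemma norm_ritz_le (hK : 0 ≤ K) (hP : ∀ w : H10 Ω, ‖toL2 w‖ ≤ K * ‖grad w‖) (w : H10 Ω) :
    ‖ritz V w‖ ≤ (K + 1) * ‖w‖ :=
  (norm_le_of_poincare hK hP _).trans
    (mul_le_mul_of_nonneg_left ((norm_grad_ritz_le w).trans (norm_grad_le w)) (by positivity))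

lemma norm_toL2_l2Proj_sub_ritz_le (w : H10 Ω) :
    ‖toL2 (l2Proj V (toL2 w) - ritz V w)‖ ≤ projErr V w := by
  obtain ⟨h1, h2⟩ := l2Proj_spec V (toL2 w)
  set z := l2Proj V (toL2 w) - ritz V w with hz
  have hm : z ∈ V := V.sub_mem h1 (ritz_spec V w).1
  have h3 : ‖toL2 z‖ ^ 2 = ⟪toL2 (w - ritz V w), toL2 z⟫ := by
    rw [toL2_sub w, inner_sub_left, ← h2 z hm, ← inner_sub_left, ← toL2_sub, ← hz,
      real_inner_self_eq_norm_sq]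
  have h4 := real_inner_le_norm (toL2 (w - ritz V w)) (toL2 z)
  have h5 : ‖toL2 (w - ritz V w)‖ = projErr V w := by
    rw [projErr, toL2_sub, toL2_sub, norm_sub_rev]
  rw [← h3, pow_two, h5] at h4
  rcases (norm_nonneg (toL2 z)).eq_or_lt with h0 | h0
  · rw [← h0]; exact norm_nonneg _
  · exact le_of_mul_le_mul_right h4 h0

end Projections

end FracWave

/-! ### Stability of the leapfrog scheme -/

namespace FracWave

/-- The damping coefficient is nonnegative: `Γ(-γ-1)` and `cos ((γ+1) π/2)` have opposite signs. -/
lemma aCoeff_nonneg {α₀ γ : ℝ} (hα₀ : 0 < α₀) (hγ : -1 < γ) (hγ' : γ < 1) (hγ₀ : γ ≠ 0) :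
    0 ≤ aCoeff α₀ γ := by
  have hπ := Real.pi_pos
  have e1 : Real.Gamma (-γ) = (-γ - 1) * Real.Gamma (-γ - 1) := by
    have := Real.Gamma_add_one (s := -γ - 1) (by linarith)
    rwa [sub_add_cancel] at this
  have h2 : 0 < Real.Gamma (γ + 2) := Real.Gamma_pos_of_pos (by linarith)
  have key : Real.Gamma (-γ - 1) * Real.cos ((γ + 1) * Real.pi / 2) ≤ 0 := by
    rcases lt_or_gt_of_ne hγ₀ with h | h
    · have h1 : 0 < Real.Gamma (-γ) := Real.Gamma_pos_of_pos (by linarith)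
      have h3 : Real.Gamma (-γ - 1) < 0 := by
        by_contra h4
        nlinarith [mul_nonneg (not_lt.1 h4) (by linarith : 0 ≤ γ + 1)]
      have h5 : 0 < Real.cos ((γ + 1) * Real.pi / 2) :=
        Real.cos_pos_of_mem_Ioo ⟨by nlinarith, by nlinarith⟩
      exact (mul_neg_of_neg_of_pos h3 h5).le
    · have e2 : Real.Gamma (1 - γ) = -γ * Real.Gamma (-γ) := by
        have := Real.Gamma_add_one (s := -γ) (by linarith)
        rwa [neg_add_eq_sub] at this
      have h1 : 0 < Real.Gamma (1 - γ) := Real.Gamma_pos_of_pos (by linarith)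
      have h3 : 0 ≤ Real.Gamma (-γ - 1) := by
        by_contra h4
        nlinarith [mul_pos h (mul_pos (neg_pos.2 (not_le.1 h4)) (by linarith : 0 < γ + 1))]
      have h5 : Real.cos ((γ + 1) * Real.pi / 2) ≤ 0 :=
        Real.cos_nonpos_of_pi_div_two_le_of_le (by nlinarith) (by nlinarith)
      exact mul_nonpos_of_nonneg_of_nonpos h3 h5
  have e : aCoeff α₀ γ = (α₀ * (4 / Real.pi) * Real.Gamma (γ + 2)) *
      -(Real.Gamma (-γ - 1) * Real.cos ((γ + 1) * Real.pi / 2)) := by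
    rw [aCoeff]; ring
  rw [e]
  exact mul_nonneg (by positivity) (neg_nonneg.2 key)

/-- The convolution quadrature is a dissipative operation on sequences that start at zero. -/
lemma sum_inner_cq_nonneg {γ κ : ℝ} (hγ : -1 < γ) (hγ' : γ < 1) (hκ : 0 < κ) {L : Type}
    [NormedAddCommGroup L] [InnerProductSpace ℝ L] {g : ℕ → L} (hg : g 0 = 0) (m : ℕ) :
    0 ≤ ∑ n ∈ Finset.Ico 1 (m + 1), ⟪cq γ κ g n, g n⟫ := by
  have hacc : Accretive (bdfSeries γ) :=
    (accretive_bdfPow hγ.le hγ'.le).smul (by positivity)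
  have h := hacc.inner_nonneg g m
  have hcq : ∀ n, cq γ κ g n = κ ^ (-γ) • ∑ j ∈ Finset.range (n + 1),
      PowerSeries.coeff (n - j) (bdfSeries γ) • g j := by
    intro n
    rw [cq, Finset.smul_sum]
    refine Finset.sum_congr rfl fun j _ => ?_
    rw [hg, smul_zero, sub_zero, cqWeight_eq_bdfSeries γ hκ, mul_smul]
  rw [Finset.sum_range_succ', hg, inner_zero_right, add_zero] at h
  rw [sum_Ico_one_succ]
  simp only [hcq, inner_smul_left, ← Finset.mul_sum]
  exact mul_nonneg (by simp; positivity) h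

lemma map_cq {X Y : Type} [AddCommGroup X] [Module ℝ X] [AddCommGroup Y] [Module ℝ Y]
    (A : X →ₗ[ℝ] Y) (γ κ : ℝ) (g : ℕ → X) (n : ℕ) :
    A (cq γ κ g n) = cq γ κ (fun j => A (g j)) n := by
  simp only [cq, map_sum, map_smul, map_sub]

section Energy
variable {H F₁ F₂ : Type} [AddCommGroup H] [Module ℝ H] [NormedAddCommGroup F₁]
  [InnerProductSpace ℝ F₁] [NormedAddCommGroup F₂] [InnerProductSpace ℝ F₂]
  (A : H →ₗ[ℝ] F₁) (B : H →ₗ[ℝ] F₂)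

/-- The discrete energy of a sequence at the midpoint of the `n`-th time step. -/
noncomputable def energy (κ : ℝ) (e : ℕ → H) (n : ℕ) : ℝ :=
  1 / 2 * ‖A (κ⁻¹ • (e n - e (n - 1)))‖ ^ 2 + 1 / 2 * ⟪B (e n), B (e (n - 1))⟫

/-- Under the CFL condition the energy controls the velocity and the averaged gradient. -/
lemma le_energy {κ : ℝ} (hκ : 0 < κ) (e : ℕ → H) (n : ℕ)
    (h : κ * ‖B (e n - e (n - 1))‖ ≤ √2 * ‖A (e n - e (n - 1))‖) :
    1 / 4 * ‖A (κ⁻¹ • (e n - e (n - 1)))‖ ^ 2 +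
      1 / 2 * ‖B ((2 : ℝ)⁻¹ • (e n + e (n - 1)))‖ ^ 2 ≤ energy A B κ e n := by
  have h1 : ‖B (e n - e (n - 1))‖ ^ 2 ≤ 2 * ‖A (κ⁻¹ • (e n - e (n - 1)))‖ ^ 2 := by
    rw [map_smul, norm_smul, Real.norm_of_nonneg (by positivity), mul_pow]
    have h2 := pow_le_pow_left₀ (by positivity) h 2
    rw [mul_pow, mul_pow, Real.sq_sqrt (by norm_num)] at h2
    have h3 : ‖B (e n - e (n - 1))‖ ^ 2 = κ⁻¹ ^ 2 * (κ ^ 2 * ‖B (e n - e (n - 1))‖ ^ 2) := by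
      field_simp
    rw [h3]
    calc κ⁻¹ ^ 2 * (κ ^ 2 * ‖B (e n - e (n - 1))‖ ^ 2)
        ≤ κ⁻¹ ^ 2 * (2 * ‖A (e n - e (n - 1))‖ ^ 2) := by gcongr
      _ = _ := by ring
  have h4 : ‖B ((2 : ℝ)⁻¹ • (e n + e (n - 1)))‖ ^ 2 =
      ⟪B (e n), B (e (n - 1))⟫ + 1 / 4 * ‖B (e n - e (n - 1))‖ ^ 2 := by
    rw [map_smul, norm_smul, map_add, map_sub, mul_pow, norm_add_sq_real, norm_sub_sq_real]
    norm_num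
    ring
  rw [energy, h4]
  linarith

/-- The energy identity: testing the scheme with the central difference. -/
lemma energy_succ_sub {κ a : ℝ} (hκ : 0 < κ) (e : ℕ → H) {n : ℕ} (hn : 1 ≤ n) {ρ z : F₁}
    (h : ⟪A ((κ ^ 2)⁻¹ • (e (n + 1) - (2 : ℝ) • e n + e (n - 1))), A (centralDiff κ 0 e n)⟫ +
      ⟪B (e n), B (centralDiff κ 0 e n)⟫ + a * ⟪z, A (centralDiff κ 0 e n)⟫ =
      ⟪ρ, A (centralDiff κ 0 e n)⟫) :
    energy A B κ e (n + 1) - energy A B κ e n + κ * (a * ⟪z, A (centralDiff κ 0 e n)⟫) =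
      κ * ⟪ρ, A (centralDiff κ 0 e n)⟫ := by
  rw [← h]
  have hn0 : n ≠ 0 := by omega
  simp only [centralDiff, hn0, if_false, energy, Nat.add_sub_cancel]
  have e1 : ∀ x y w : F₁, κ * ⟪(κ ^ 2)⁻¹ • (x - (2 : ℝ) • y + w), (2 * κ)⁻¹ • (x - w)⟫ =
      1 / 2 * ‖κ⁻¹ • (x - y)‖ ^ 2 - 1 / 2 * ‖κ⁻¹ • (y - w)‖ ^ 2 := by
    intro x y w
    simp only [← real_inner_self_eq_norm_sq, inner_smul_left, inner_smul_right, inner_add_left,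
      inner_sub_left, inner_sub_right, RCLike.conj_to_real, real_inner_comm y x,
      real_inner_comm w x, real_inner_comm w y]
    field_simp
    ring
  have e2 : ∀ x y w : F₂, κ * ⟪y, (2 * κ)⁻¹ • (x - w)⟫ = 1 / 2 * ⟪x, y⟫ - 1 / 2 * ⟪y, w⟫ := by
    intro x y w
    simp only [inner_smul_right, inner_sub_right, real_inner_comm y x]
    field_simp
  have e1' := e1 (A (e (n + 1))) (A (e n)) (A (e (n - 1)))
  have e2' := e2 (B (e (n + 1))) (B (e n)) (B (e (n - 1)))
  simp only [map_smul, map_sub, map_add] at e1' e2' ⊢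
  linear_combination -e1' - e2'

/-- Stability: a solution of the scheme that starts at zero is controlled by its first step and
by the residuals. -/
theorem energy_stability {γ κ a : ℝ} (hγ : -1 < γ) (hγ' : γ < 1) (hκ : 0 < κ) (ha : 0 ≤ a)
    (V : Submodule ℝ H) (hcfl : ∀ v ∈ V, κ * ‖B v‖ ≤ √2 * ‖A v‖) {N : ℕ} {e : ℕ → H}
    (he : ∀ n ≤ N, e n ∈ V) (he0 : e 0 = 0) (ρ : ℕ → F₁)
    (h : ∀ n, 1 ≤ n → n + 1 ≤ N → ∀ v ∈ V,
      ⟪A ((κ ^ 2)⁻¹ • (e (n + 1) - (2 : ℝ) • e n + e (n - 1))), A v⟫ + ⟪B (e n), B v⟫ +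
        a * ⟪A (cq γ κ (centralDiff κ 0 e) n), A v⟫ = ⟪ρ n, A v⟫)
    {n : ℕ} (hn : 1 ≤ n) (hnN : n ≤ N) :
    ‖A (κ⁻¹ • (e n - e (n - 1)))‖ ≤
        2 * (‖A (κ⁻¹ • e 1)‖ + 2 * (κ * ∑ j ∈ Finset.Ico 1 N, ‖ρ j‖)) ∧
      ‖B ((2 : ℝ)⁻¹ • (e n + e (n - 1)))‖ ≤
        2 * (‖A (κ⁻¹ • e 1)‖ + 2 * (κ * ∑ j ∈ Finset.Ico 1 N, ‖ρ j‖)) := by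
  set E := energy A B κ e with hE
  set R := κ * ∑ j ∈ Finset.Ico 1 N, ‖ρ j‖ with hR
  have hR0 : 0 ≤ R := by positivity
  have hlow : ∀ n, 1 ≤ n → n ≤ N → 1 / 4 * ‖A (κ⁻¹ • (e n - e (n - 1)))‖ ^ 2 +
      1 / 2 * ‖B ((2 : ℝ)⁻¹ • (e n + e (n - 1)))‖ ^ 2 ≤ E n := fun n h1 h2 =>
    le_energy A B hκ e n (hcfl _ (V.sub_mem (he n h2) (he (n - 1) (by omega))))
  obtain ⟨m, hm, hmax⟩ := Finset.exists_max_image (Finset.Icc 1 N) E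
    ⟨n, Finset.mem_Icc.2 ⟨hn, hnN⟩⟩
  obtain ⟨hm1, hmN⟩ := Finset.mem_Icc.1 hm
  have hE0 : 0 ≤ E m := le_trans (by positivity) (hlow m hm1 hmN)
  set M := √(E m) with hM
  have hM0 : 0 ≤ M := Real.sqrt_nonneg _
  have hM2 : M ^ 2 = E m := Real.sq_sqrt hE0
  have hD : ∀ n, 1 ≤ n → n ≤ N → ‖A (κ⁻¹ • (e n - e (n - 1)))‖ ≤ 2 * M := by
    intro n h1 h2
    refine le_of_sq_le_sq ?_ (by positivity)
    have := hlow n h1 h2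
    have := hmax n (Finset.mem_Icc.2 ⟨h1, h2⟩)
    have := sq_nonneg ‖B ((2 : ℝ)⁻¹ • (e n + e (n - 1)))‖
    rw [mul_pow, hM2]; linarith
  have hbd : ∀ n, 1 ≤ n → n + 1 ≤ N → ‖A (centralDiff κ 0 e n)‖ ≤ 2 * M := by
    intro n h1 h2
    have hn0 : n ≠ 0 := by omega
    have e1 : A (centralDiff κ 0 e n) = (2 : ℝ)⁻¹ • (A (κ⁻¹ • (e (n + 1) - e (n + 1 - 1))) +
        A (κ⁻¹ • (e n - e (n - 1)))) := by
      simp only [centralDiff, hn0, if_false, Nat.add_sub_cancel, ← map_add, ← map_smul]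
      congr 1
      rw [mul_inv]; module
    rw [e1, norm_smul]
    have h3 := norm_add_le (A (κ⁻¹ • (e (n + 1) - e (n + 1 - 1)))) (A (κ⁻¹ • (e n - e (n - 1))))
    have h4 := hD (n + 1) (by omega) h2
    have h5 := hD n h1 (by omega)
    rw [Real.norm_of_nonneg (by norm_num)]
    linarith
  -- summing the energy identity up to the step at which the energy is largest
  have hsum : E m - E 1 + κ * (a * ∑ n ∈ Finset.Ico 1 m,
      ⟪A (cq γ κ (centralDiff κ 0 e) n), A (centralDiff κ 0 e n)⟫) =
      κ * ∑ n ∈ Finset.Ico 1 m, ⟪ρ n, A (centralDiff κ 0 e n)⟫ := by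
    rw [← Finset.sum_Ico_sub E hm1, Finset.mul_sum, Finset.mul_sum, Finset.mul_sum,
      ← Finset.sum_add_distrib]
    refine Finset.sum_congr rfl fun k hk => ?_
    obtain ⟨hk1, hkm⟩ := Finset.mem_Ico.1 hk
    refine energy_succ_sub A B hκ e hk1 (h k hk1 (by omega) _ ?_)
    have hk0 : k ≠ 0 := by omega
    simp only [centralDiff, hk0, if_false]
    exact V.smul_mem _ (V.sub_mem (he _ (by omega)) (he _ (by omega)))
  have hdamp : 0 ≤ ∑ n ∈ Finset.Ico 1 m,
      ⟪A (cq γ κ (centralDiff κ 0 e) n), A (centralDiff κ 0 e n)⟫ := by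
    have := sum_inner_cq_nonneg hγ hγ' hκ (g := fun n => A (centralDiff κ 0 e n))
      (by simp [centralDiff]) (m - 1)
    rw [Nat.sub_add_cancel hm1] at this
    simpa only [map_cq] using this
  have hρ : κ * ∑ n ∈ Finset.Ico 1 m, ⟪ρ n, A (centralDiff κ 0 e n)⟫ ≤ R * (2 * M) := by
    have h1 : ∑ n ∈ Finset.Ico 1 m, ⟪ρ n, A (centralDiff κ 0 e n)⟫ ≤
        ∑ n ∈ Finset.Ico 1 N, ‖ρ n‖ * (2 * M) := by
      calc ∑ n ∈ Finset.Ico 1 m, ⟪ρ n, A (centralDiff κ 0 e n)⟫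
          ≤ ∑ n ∈ Finset.Ico 1 m, ‖ρ n‖ * (2 * M) := by
            refine Finset.sum_le_sum fun k hk => ?_
            obtain ⟨hk1, hkm⟩ := Finset.mem_Ico.1 hk
            refine (real_inner_le_norm _ _).trans ?_
            gcongr
            exact hbd k hk1 (by omega)
        _ ≤ _ := Finset.sum_le_sum_of_subset_of_nonneg (Finset.Ico_subset_Ico le_rfl hmN)
            fun _ _ _ => by positivity
    rw [← Finset.sum_mul] at h1
    calc _ ≤ κ * ((∑ n ∈ Finset.Ico 1 N, ‖ρ n‖) * (2 * M)) := by gcongr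
      _ = _ := by rw [hR]; ring
  have hE1 : E 1 = 1 / 2 * ‖A (κ⁻¹ • e 1)‖ ^ 2 := by
    simp [hE, energy, he0]
  have hE1m : E 1 ≤ E m := hmax 1 (Finset.mem_Icc.2 ⟨le_rfl, hn.trans hnN⟩)
  set s := ‖A (κ⁻¹ • e 1)‖ with hs
  have hs0 : 0 ≤ s := norm_nonneg _
  -- a quadratic inequality for the square root of the largest energy
  have hMle : M ≤ s + 2 * R := by
    have h1 : M ^ 2 ≤ 1 / 2 * s ^ 2 + R * (2 * M) := by
      have : 0 ≤ κ * (a * ∑ n ∈ Finset.Ico 1 m,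
        ⟪A (cq γ κ (centralDiff κ 0 e) n), A (centralDiff κ 0 e n)⟫) := by positivity
      rw [hM2]; linarith
    by_contra hlt
    have h2 : s + 2 * R < M := not_le.1 hlt
    nlinarith [mul_nonneg hs0 hR0]
  constructor
  · have := hD n hn hnN
    linarith
  · refine (le_of_sq_le_sq ?_ (by positivity : 0 ≤ 2 * M)).trans (by linarith)
    have h1 := hlow n hn hnN
    have h2 := hmax n (Finset.mem_Icc.2 ⟨hn, hnN⟩)
    have h3 := sq_nonneg ‖A (κ⁻¹ • (e n - e (n - 1)))‖
    rw [mul_pow, hM2]; linarith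

end Energy

end FracWave

/-! ### Consistency -/

namespace FracWave

/-- The part of the error bound that does not involve the projections:
`C₀ ((c₃ + c₄) κ^{1+α} + (1 + c₂ + c₃ + c₄) κ²)`. -/
noncomputable def timeError (α C₀ : ℝ) (c : Fin 5 → ℝ) (κ : ℝ) : ℝ :=
  C₀ * ((c 3 + c 4) * κ ^ (1 + α) + (1 + c 2 + c 3 + c 4) * κ ^ 2)

/-- All temporal consistency errors are `O(κ^{1+α})`, with a constant proportional to `C₀ (c₃ + c₄)`,
up to `O(κ²)`. The sum of the bounds of the fourth derivative is a Riemann sum of `t^{α-2}` that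
starts at the first grid point. -/
lemma exists_stepBounds_timeError {T α : ℝ} (hT : 0 < T) (hα : 0 < α) :
    ∃ K > 0, ∀ (d : ℕ) (Ω : Set (Euc d)) (γ C₀ κ : ℝ) (c : Fin 5 → ℝ) (u : ℝ → H10 Ω) (N : ℕ),
      0 < C₀ → (∀ k, 0 ≤ c k) → (α ≠ 1 ∨ c 4 = 0) → 0 < κ → κ ≤ 1 → N * κ = T → γ < 1 →
      SmoothnessAssumption T γ α C₀ c u →
      ∃ (η M : ℝ) (S : ℕ → ℝ), StepBounds T κ η S (fun k => timeDeriv T k u) ∧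
        (∀ t ∈ Icc 0 T, ‖timeDeriv T 2 u t‖ ≤ M) ∧ (∀ j, 0 ≤ S j) ∧
        κ * η ≤ K * timeError α C₀ c κ ∧ κ ^ 2 * M ≤ K * timeError α C₀ c κ ∧
        κ * ∑ j ∈ Finset.Ico 1 N, κ ^ 2 * S j ≤ K * timeError α C₀ c κ ∧
        κ ^ (2 - γ) * η ≤ K * timeError α C₀ c κ := by
  obtain ⟨K, hK, h⟩ := exists_stepBounds hT hα
  -- at `α = 1` the singular part of the fourth derivative is absent
  obtain ⟨C, hC, hsum⟩ : ∃ C > 0, α ≠ 1 → ∀ N : ℕ,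
      ∑ n ∈ Finset.Ico 1 N, (n : ℝ) ^ (α - 2) ≤ C * ((N : ℝ) ^ (α - 2 + 1) + 1) := by
    by_cases h1 : α = 1
    · exact ⟨1, one_pos, fun h => absurd h1 h⟩
    · obtain ⟨C, hC, hs⟩ := exists_sum_Ico_rpow_le (s := α - 2) (fun h => h1 (by linarith))
      exact ⟨C, hC, fun _ => hs⟩
  have hTα : 0 < T ^ (α - 1) := by positivity
  refine ⟨K * (1 + T + C * T ^ (α - 1) + C), by positivity, ?_⟩
  intro d Ω γ C₀ κ c u N hC₀ hc h41 hκ hκ1 hN hγ hu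
  obtain ⟨hb, hM⟩ := h d Ω γ C₀ κ c u hC₀ hc hκ hu
  have hc2 := hc 2
  have hc3 := hc 3
  have hc4 := hc 4
  have hκα : 0 < κ ^ (1 + α) := by positivity
  have hκ2 : 0 < κ ^ 2 := by positivity
  set Θ := timeError α C₀ c κ with hΘ
  have hΘe : Θ = C₀ * ((c 3 + c 4) * κ ^ (1 + α) + (1 + c 2 + c 3 + c 4) * κ ^ 2) := rfl
  have hΘ0 : 0 ≤ Θ := by rw [hΘe]; positivity
  have hL : K * Θ ≤ K * (1 + T + C * T ^ (α - 1) + C) * Θ := by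
    have : 0 ≤ K * (T + C * T ^ (α - 1) + C) * Θ := by positivity
    nlinarith
  refine ⟨_, _, _, hb, hM, fun j => by positivity, le_trans ?_ hL, le_trans ?_ hL, ?_,
    le_trans ?_ hL⟩
  · have e : κ * κ ^ α = κ ^ (1 + α) := by rw [Real.rpow_add hκ, Real.rpow_one]
    calc κ * (K * (C₀ * (κ + c 3 * (κ ^ α + κ))))
        = K * (C₀ * (c 3 * (κ * κ ^ α) + (1 + c 3) * κ ^ 2)) := by ring
      _ ≤ K * Θ := by
        rw [e, hΘe]
        gcongr K * (C₀ * (?_ * _ + ?_ * _)) <;> linarith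
  · calc κ ^ 2 * (K * (C₀ * (1 + c 2))) = K * (C₀ * (0 * κ ^ (1 + α) + (1 + c 2) * κ ^ 2)) := by
          ring
      _ ≤ K * Θ := by
        rw [hΘe]
        gcongr K * (C₀ * (?_ * _ + ?_ * _)) <;> linarith
  · have e1 : ∀ j ∈ Finset.Ico 1 N, κ ^ 2 * (K * (C₀ * (1 + c 4 * (j * κ) ^ (α - 2)))) =
        K * C₀ * κ ^ 2 + K * C₀ * c 4 * (κ ^ 2 * κ ^ (α - 2)) * (j : ℝ) ^ (α - 2) := by
      intro j hj
      rw [Real.mul_rpow (by positivity) hκ.le]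
      ring
    have e2 : κ * (κ ^ 2 * κ ^ (α - 2)) = κ ^ (1 + α) := by
      rw [← Real.rpow_natCast κ 2, ← Real.rpow_add hκ, ← Real.rpow_one_add' hκ.le]
      · congr 1; push_cast; ring
      · push_cast; intro h; linarith
    have e3 : κ * (∑ j ∈ Finset.Ico 1 N, K * C₀ * κ ^ 2) ≤ K * C₀ * T * κ ^ 2 := by
      rw [Finset.sum_const, Nat.card_Ico, nsmul_eq_mul]
      have : (((N - 1 : ℕ) : ℝ)) ≤ N := by exact_mod_cast Nat.sub_le N 1
      calc κ * (((N - 1 : ℕ) : ℝ) * (K * C₀ * κ ^ 2)) ≤ κ * (N * (K * C₀ * κ ^ 2)) := by gcongr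
        _ = K * C₀ * (N * κ) * κ ^ 2 := by ring
        _ = _ := by rw [hN]
    have e4 : K * C₀ * c 4 * κ ^ (1 + α) * ∑ j ∈ Finset.Ico 1 N, (j : ℝ) ^ (α - 2) ≤
        K * C₀ * c 4 * (C * (T ^ (α - 1) * κ ^ 2 + κ ^ (1 + α))) := by
      rcases h41 with h1 | h1
      · have e5 : κ ^ (1 + α) * (N : ℝ) ^ (α - 2 + 1) = T ^ (α - 1) * κ ^ 2 := by
          rw [← hN, Real.mul_rpow (by positivity) hκ.le, show 1 + α = (α - 1) + 2 by ring,
            Real.rpow_add hκ, Real.rpow_two, show α - 2 + 1 = α - 1 by ring]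
          ring
        calc _ ≤ K * C₀ * c 4 * κ ^ (1 + α) * (C * ((N : ℝ) ^ (α - 2 + 1) + 1)) := by
              gcongr
              exact hsum h1 N
          _ = K * C₀ * c 4 * (C * (κ ^ (1 + α) * (N : ℝ) ^ (α - 2 + 1) + κ ^ (1 + α))) := by ring
          _ = _ := by rw [e5]
      · simp [h1]
    rw [Finset.sum_congr rfl e1, Finset.sum_add_distrib, mul_add]
    have e6 : κ * (K * C₀ * c 4 * (κ ^ 2 * κ ^ (α - 2)) *
        ∑ j ∈ Finset.Ico 1 N, (j : ℝ) ^ (α - 2)) =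
        K * C₀ * c 4 * κ ^ (1 + α) * ∑ j ∈ Finset.Ico 1 N, (j : ℝ) ^ (α - 2) := by
      rw [← e2]; ring
    rw [← Finset.mul_sum _ _ (K * C₀ * c 4 * (κ ^ 2 * κ ^ (α - 2))), e6]
    have i1 : C₀ * κ ^ 2 ≤ Θ := by
      have : 0 ≤ C₀ * ((c 3 + c 4) * κ ^ (1 + α) + (c 2 + c 3 + c 4) * κ ^ 2) := by positivity
      rw [hΘe]; linarith
    have i2 : C₀ * c 4 * κ ^ 2 ≤ Θ := by
      have : 0 ≤ C₀ * ((c 3 + c 4) * κ ^ (1 + α) + (1 + c 2 + c 3) * κ ^ 2) := by positivity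
      rw [hΘe]; linarith
    have i3 : C₀ * c 4 * κ ^ (1 + α) ≤ Θ := by
      have : 0 ≤ C₀ * (c 3 * κ ^ (1 + α) + (1 + c 2 + c 3 + c 4) * κ ^ 2) := by positivity
      rw [hΘe]; linarith
    calc _ ≤ K * C₀ * T * κ ^ 2 + K * C₀ * c 4 * (C * (T ^ (α - 1) * κ ^ 2 + κ ^ (1 + α))) :=
          add_le_add e3 e4
      _ = K * T * (C₀ * κ ^ 2) + K * C * T ^ (α - 1) * (C₀ * c 4 * κ ^ 2) +
          K * C * (C₀ * c 4 * κ ^ (1 + α)) := by ring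
      _ ≤ K * T * Θ + K * C * T ^ (α - 1) * Θ + K * C * Θ := by gcongr
      _ ≤ _ := by
          have : 0 ≤ K * Θ := by positivity
          linarith
  · have e1 : κ ^ (2 - γ) * κ ≤ κ ^ 2 := by
      calc κ ^ (2 - γ) * κ ≤ κ ^ (1 : ℝ) * κ := by
            refine mul_le_mul_of_nonneg_right ?_ hκ.le
            exact Real.rpow_le_rpow_of_exponent_ge hκ hκ1 (by linarith)
        _ = κ ^ 2 := by rw [Real.rpow_one]; ring
    have e2 : κ ^ (2 - γ) * κ ^ α ≤ κ ^ (1 + α) := by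
      rw [← Real.rpow_add hκ]
      exact Real.rpow_le_rpow_of_exponent_ge hκ hκ1 (by linarith)
    calc κ ^ (2 - γ) * (K * (C₀ * (κ + c 3 * (κ ^ α + κ))))
        = K * (C₀ * (c 3 * (κ ^ (2 - γ) * κ ^ α) + (1 + c 3) * (κ ^ (2 - γ) * κ))) := by ring
      _ ≤ K * (C₀ * ((c 3 + c 4) * κ ^ (1 + α) + (1 + c 2 + c 3 + c 4) * κ ^ 2)) := by
        gcongr K * (C₀ * (?_ * ?_ + ?_ * ?_)) <;> linarith
      _ = K * Θ := by rw [hΘe]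

/-- For `γ < 0` both Caputo derivatives are the Riemann–Liouville integral of `u'` of order `-γ`. -/
lemma caputo_of_neg {X : Type} [NormedAddCommGroup X] [NormedSpace ℝ X] {T γ : ℝ} (hγ : -1 < γ)
    (hγ' : γ < 0) (u : ℝ → X) (t : ℝ) :
    caputo T γ (timeDeriv T 1 u) t = rlIntegral (-γ) (timeDeriv T 1 u) t ∧
    caputo T (γ + 1) u t = rlIntegral (-γ) (timeDeriv T 1 u) t := by
  have hc : ⌈γ + 1⌉₊ = 1 := (Nat.ceil_eq_iff one_ne_zero).2 ⟨by norm_num; linarith, by norm_num; linarith⟩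
  refine ⟨by simp [caputo, hγ'], ?_⟩
  have h1 : ¬ γ + 1 < 0 := by linarith
  have h2 : ¬ γ = 0 := by linarith
  simp only [caputo, h1, hc, if_false]
  have h3 : ¬ γ + 1 = ((1 : ℕ) : ℝ) := by push_cast; intro h; linarith
  rw [if_neg h3]
  congr 1
  push_cast; ring

/-- For `γ > 0` both Caputo derivatives are the Riemann–Liouville integral of `u''` of order
`1 - γ`. -/
lemma caputo_of_pos {X : Type} [NormedAddCommGroup X] [NormedSpace ℝ X] {T γ : ℝ} (hγ : 0 < γ)
    (hγ' : γ < 1) (u : ℝ → X) (t : ℝ) :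
    caputo T γ (timeDeriv T 1 u) t = rlIntegral (1 - γ) (timeDeriv T 2 u) t ∧
    caputo T (γ + 1) u t = rlIntegral (1 - γ) (timeDeriv T 2 u) t := by
  have hc : ⌈γ⌉₊ = 1 := (Nat.ceil_eq_iff one_ne_zero).2 ⟨by norm_num; linarith, by norm_num; linarith⟩
  have hc' : ⌈γ + 1⌉₊ = 2 := (Nat.ceil_eq_iff two_ne_zero).2 ⟨by norm_num; linarith, by norm_num; linarith⟩
  have h1 : ¬ γ < 0 := by linarith
  have h2 : ¬ γ + 1 < 0 := by linarith
  have h3 : ¬ γ = ((1 : ℕ) : ℝ) := by push_cast; intro h; linarith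
  have h4 : ¬ γ + 1 = ((2 : ℕ) : ℝ) := by push_cast; intro h; linarith
  constructor
  · simp only [caputo, h1, hc, if_false]
    rw [if_neg h3]
    have e : timeDeriv T 1 (timeDeriv T 1 u) = timeDeriv T 2 u := by
      funext t
      rw [timeDeriv, iteratedDerivWithin_one, timeDeriv, iteratedDerivWithin_succ]
      rfl
    rw [e]; push_cast; rfl
  · simp only [caputo, h2, hc', if_false]
    rw [if_neg h4]
    congr 1
    push_cast; ring

/-- If the truncation error is a multiple of `G 0` plus a remainder, the multiple may be expressed
through `G κ`, at the cost of the increment of `G`. -/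
lemma sum_ritz_truncation_le {d : ℕ} {Ω : Set (Euc d)} {P : ℝ} (hP0 : 0 < P)
    (hP : ∀ w : H10 Ω, ‖toL2 w‖ ≤ P * ‖grad w‖) (V : Submodule ℝ (H10 Ω)) [FiniteDimensional ℝ V]
    {G : ℝ → H10 Ω} {κ δ B e C : ℝ} {N : ℕ} {err τ : ℕ → H10 Ω} {ε : ℕ → ℝ} (hκ : 0 < κ)
    (hC : 0 ≤ C) (he : 0 ≤ e) (hB : 0 ≤ B) (herr : ∀ n ∈ Finset.Ico 1 N, err n = ε n • G 0 + τ n)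
    (hG : ‖G κ - G 0‖ ≤ δ) (hε : κ * ∑ n ∈ Finset.Ico 1 N, |ε n| ≤ C * e) (heδ : e * δ ≤ B)
    (hτ : κ * ∑ n ∈ Finset.Ico 1 N, ‖τ n‖ ≤ C * (2 * B)) :
    κ * ∑ n ∈ Finset.Ico 1 N, ‖toL2 (ritz V (err n))‖ ≤
      C * (1 + 3 * P) * (‖toL2 (ritz V (G κ))‖ * e + B) := by
  have hpt : ∀ n ∈ Finset.Ico 1 N, ‖toL2 (ritz V (err n))‖ ≤
      |ε n| * (‖toL2 (ritz V (G κ))‖ + P * δ) + P * ‖τ n‖ := by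
    intro n hn
    have e1 : err n = ε n • (G κ - (G κ - G 0)) + τ n := by rw [herr n hn]; module
    have e2 : toL2 (ritz V (err n)) = ε n • (toL2 (ritz V (G κ)) - toL2 (ritz V (G κ - G 0))) +
        toL2 (ritz V (τ n)) := by
      rw [e1]
      have h1 : ∀ w, ritz V w = ritzL V hP w := fun _ => rfl
      simp only [h1, map_add, map_smul, map_sub (ritzL V hP) (G κ) (G κ - G 0), toL2_add,
        toL2_smul, toL2_sub]
    rw [e2]
    refine (norm_add_le _ _).trans (add_le_add ?_ ?_)
    · rw [norm_smul, Real.norm_eq_abs]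
      gcongr
      refine (norm_sub_le _ _).trans (add_le_add le_rfl ?_)
      exact (norm_toL2_ritz_le hP0.le hP _).trans (by gcongr)
    · exact norm_toL2_ritz_le hP0.le hP _
  have hδ : 0 ≤ δ := (norm_nonneg _).trans hG
  calc κ * ∑ n ∈ Finset.Ico 1 N, ‖toL2 (ritz V (err n))‖
      ≤ κ * ∑ n ∈ Finset.Ico 1 N,
        (|ε n| * (‖toL2 (ritz V (G κ))‖ + P * δ) + P * ‖τ n‖) := by
        gcongr with n hn
        exact hpt n hn
    _ = (κ * ∑ n ∈ Finset.Ico 1 N, |ε n|) * (‖toL2 (ritz V (G κ))‖ + P * δ) +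
        P * (κ * ∑ n ∈ Finset.Ico 1 N, ‖τ n‖) := by
        rw [Finset.sum_add_distrib, ← Finset.sum_mul, ← Finset.mul_sum]; ring
    _ ≤ (C * e) * (‖toL2 (ritz V (G κ))‖ + P * δ) + P * (C * (2 * B)) := by gcongr
    _ = C * (‖toL2 (ritz V (G κ))‖ * e) + C * P * (e * δ) + 2 * (C * P * B) := by ring
    _ ≤ C * (‖toL2 (ritz V (G κ))‖ * e) + C * P * B + 2 * (C * P * B) := by gcongr
    _ ≤ _ := by
        have h1 : 0 ≤ C * P * (‖toL2 (ritz V (G κ))‖ * e) := by positivity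
        have h2 : 0 ≤ C * B := by positivity
        linarith

/-- The truncation error of the damping term, after the Ritz projection. -/
lemma exists_sum_damping_truncation_le {d : ℕ} {Ω : Set (Euc d)} {γ : ℝ} (hγ : -1 < γ)
    (hγ' : γ < 1) (hγ₀ : γ ≠ 0) {T : ℝ} (hT : 0 < T) {P : ℝ} (hP0 : 0 < P)
    (hP : ∀ w : H10 Ω, ‖toL2 w‖ ≤ P * ‖grad w‖) :
    ∃ C > 0, ∀ (V : Submodule ℝ (H10 Ω)) (u : ℝ → H10 Ω) (κ η M B : ℝ) (S : ℕ → ℝ) (N : ℕ),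
      FiniteDimensional ℝ V → 0 < κ → κ ≤ 1 → N * κ = T →
      StepBounds T κ η S (fun k => timeDeriv T k u) →
      (∀ t ∈ Icc 0 T, ‖timeDeriv T 2 u t‖ ≤ M) → (∀ j, 0 ≤ S j) →
      κ * η ≤ B → κ ^ 2 * M ≤ B → κ * ∑ j ∈ Finset.Ico 1 N, κ ^ 2 * S j ≤ B →
      κ ^ (2 - γ) * η ≤ B →
      κ * ∑ n ∈ Finset.Ico 1 N, ‖toL2 (ritz V (caputo T γ (timeDeriv T 1 u) (n * κ) -
        cq γ κ (centralDiff κ (timeDeriv T 1 u 0) fun j => u (j * κ)) n))‖ ≤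
        C * (dampingError V T γ κ u + B) := by
  have hu0 : ∀ u : ℝ → H10 Ω, timeDeriv T 0 u = u := fun u => by
    funext t; simp [timeDeriv]
  rcases lt_or_gt_of_ne hγ₀ with hs | hs
  · obtain ⟨C, hC, h⟩ := exists_cq_truncation_of_neg hγ hs hT
    refine ⟨C * (1 + 3 * P), by positivity, ?_⟩
    intro V u κ η M B S N hV hκ hκ1 hN hb hM hS h1 h2 h3 h4
    obtain ⟨ε, τ, herr, hε, hτ⟩ := h (H10 Ω) (fun k => timeDeriv T k u) κ η M S N hκ hκ1 hN hb hM
    have hM0 : 0 ≤ M := (norm_nonneg _).trans (hM 0 ⟨le_rfl, hT.le⟩)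
    have hκT : 0 + κ ≤ T := by
      rcases Nat.eq_zero_or_pos N with h0 | h0
      · rw [h0] at hN; simp at hN; linarith
      · have : (1 : ℝ) ≤ N := by exact_mod_cast h0
        rw [zero_add, ← hN]; nlinarith
    have hG : ‖timeDeriv T 1 u κ - timeDeriv T 1 u 0‖ ≤ M * κ :=
      norm_sub_le_of_hasDerivWithinAt (L := κ) (by linarith) hM0
        (hb.window (k := 1) (by norm_num) le_rfl hκT)
        (fun t ht => hM t ⟨ht.1, ht.2.trans hκT⟩) (t := κ) ⟨hκ.le, by linarith⟩
    have hB : 0 ≤ B := le_trans (by positivity) h2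
    simp only [hu0] at herr
    have := sum_ritz_truncation_le hP0 hP V hκ hC.le hκ.le hB herr hG hε
      (by linarith [show κ * (M * κ) = κ ^ 2 * M by ring])
      (hτ.trans (by gcongr; linarith))
    simp only [(caputo_of_neg hγ hs u _).1, dampingError, hs, if_true]
    exact this
  · obtain ⟨C, hC, h⟩ := exists_cq_truncation_of_pos hs hγ' hT
    refine ⟨C * (1 + 3 * P), by positivity, ?_⟩
    intro V u κ η M B S N hV hκ hκ1 hN hb hM hS h1 h2 h3 h4
    obtain ⟨ε, τ, herr, hε, hτ⟩ := h (H10 Ω) (fun k => timeDeriv T k u) κ η S N hκ hκ1 hN hS hb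
    have hκT : κ ≤ T := by
      rcases Nat.eq_zero_or_pos N with h0 | h0
      · rw [h0] at hN; simp at hN; linarith
      · have : (1 : ℝ) ≤ N := by exact_mod_cast h0
        rw [← hN]; nlinarith
    have hG : ‖timeDeriv T 2 u κ - timeDeriv T 2 u 0‖ ≤ η :=
      hb.osc 0 κ le_rfl hκ.le hκT (by linarith)
    have hη : 0 ≤ η := (norm_nonneg _).trans hG
    have hB : 0 ≤ B := le_trans (by positivity) h1
    simp only [hu0] at herr
    have := sum_ritz_truncation_le hP0 hP V (e := κ ^ (2 - γ)) hκ hC.le (by positivity) hB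
      herr hG hε h4 (hτ.trans (by gcongr; linarith))
    simp only [(caputo_of_pos hs hγ' u _).1, dampingError, not_lt.2 hs.le, if_false]
    exact this

/-- The truncation error of the second difference quotients. -/
lemma sum_second_difference_le {X : Type} [NormedAddCommGroup X] [NormedSpace ℝ X] {T κ η : ℝ}
    {S : ℕ → ℝ} {u : ℕ → ℝ → X} (hκ : 0 < κ) (hη : 0 ≤ η) (hS : ∀ j, 0 ≤ S j)
    (h : StepBounds T κ η S u) {N : ℕ} (hN : N * κ = T) :
    κ * ∑ n ∈ Finset.Ico 1 N, ‖u 2 (n * κ) - (κ ^ 2)⁻¹ • (u 0 ((n + 1 : ℕ) * κ) -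
      (2 : ℝ) • u 0 (n * κ) + u 0 ((n - 1 : ℕ) * κ))‖ ≤
      52 * (κ * η + κ * ∑ j ∈ Finset.Ico 1 N, κ ^ 2 * S j) := by
  have hpt : ∀ n ∈ Finset.Ico 1 N, ‖u 2 (n * κ) - (κ ^ 2)⁻¹ • (u 0 ((n + 1 : ℕ) * κ) -
      (2 : ℝ) • u 0 (n * κ) + u 0 ((n - 1 : ℕ) * κ))‖ ≤
      52 * (if n = 1 then η else κ ^ 2 * S (n - 1)) := by
    intro n hn
    obtain ⟨hn1, hnN⟩ := Finset.mem_Ico.1 hn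
    obtain ⟨i, rfl⟩ : ∃ i, n = i + 1 := ⟨n - 1, by omega⟩
    have e1 : ((i + 1 : ℕ) : ℝ) * κ = i * κ + κ := by push_cast; ring
    have e2 : ((i + 1 + 1 : ℕ) : ℝ) * κ = i * κ + 2 * κ := by push_cast; ring
    have hb : (i : ℝ) * κ + 2 * κ ≤ T := by
      rw [← e2, ← hN]; gcongr; omega
    rw [Nat.add_sub_cancel, e1, e2]
    rcases i with _ | i
    · simp only [Nat.cast_zero, zero_mul, if_true, Nat.zero_add] at hb ⊢
      have := norm_second_deriv_sub_le_of_osc hκ hη (h.window (k := 0) (by norm_num) le_rfl hb)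
        (h.window (k := 1) (by norm_num) le_rfl hb) (h.osc_window le_rfl hb (by linarith))
      linarith
    · have ha : 0 < ((i + 1 : ℕ) : ℝ) * κ := by positivity
      have := norm_second_deriv_sub_le_of_deriv hκ (hS (i + 1))
        (h.window' (k := 0) (by norm_num) ha hb)
        (h.window' (k := 1) (by norm_num) ha hb)
        (h.window' (k := 2) (by norm_num) ha hb)
        (h.window' (k := 3) (by norm_num) ha hb)
        (h.fourth_window (by omega) hb (by linarith))
      simpa using this
  have hsum : ∑ n ∈ Finset.Ico 1 N, (if n = 1 then η else κ ^ 2 * S (n - 1)) ≤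
      η + ∑ j ∈ Finset.Ico 1 N, κ ^ 2 * S j := by
    have hSn : ∀ j, 0 ≤ κ ^ 2 * S j := fun j => mul_nonneg (by positivity) (hS j)
    rcases N with _ | _ | N
    · simpa using hη
    · simpa using hη
    · rw [sum_Ico_one_succ, sum_Ico_one_succ, Finset.sum_range_succ', Finset.sum_range_succ]
      have := hSn (N + 1)
      simp
      linarith
  calc _ ≤ κ * ∑ n ∈ Finset.Ico 1 N, 52 * (if n = 1 then η else κ ^ 2 * S (n - 1)) := by
        gcongr with n hn
        exact hpt n hn
    _ ≤ κ * (52 * (η + ∑ j ∈ Finset.Ico 1 N, κ ^ 2 * S j)) := by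
        rw [← Finset.mul_sum]; gcongr
    _ = _ := by ring

end FracWave

/-! ### The error equation -/

namespace FracWave

/-! #### Algebraic identities for the discrete error -/

section Algebra
variable {H : Type} [AddCommGroup H] [Module ℝ H] (R : H →ₗ[ℝ] H)

lemma initial_error_eq {κ : ℝ} (hκ : 0 < κ) (u₀ v₀ w₀ p z : H) :
    κ⁻¹ • (R (u₀ + κ • v₀) + (κ ^ 2 / 2) • p - R z) =
      (κ / 2) • (p - R w₀) - κ⁻¹ • R (z - (u₀ + κ • v₀ + (κ ^ 2 / 2) • w₀)) := by
  simp only [map_add, map_sub, map_smul]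
  have e2 : κ / 2 = κ⁻¹ * (κ ^ 2 / 2) := by field_simp
  rw [e2]
  module

lemma sub_proj_eq (x y : H) : x - R y = R (x - y) - (R x - x) := by
  rw [map_sub]; module

lemma velocity_error_eq (s : ℝ) (U₁ U₀ x₁ x₀ y : H) :
    s • (U₁ - U₀) - y =
      s • ((U₁ - R x₁) - (U₀ - R x₀)) + R (s • (x₁ - x₀) - y) + (R y - y) := by
  simp only [map_sub, map_smul]; module

lemma average_error_eq (s : ℝ) (U₁ U₀ x₁ x₀ y : H) :
    s • (U₁ + U₀) - y =
      s • ((U₁ - R x₁) + (U₀ - R x₀)) + R (s • (x₁ + x₀) - y) + (R y - y) := by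
  simp only [map_sub, map_add, map_smul]; module

/-- Subtracting the weak equation from the scheme, for a general projection `R`. -/
lemma scheme_sub_weak_eq {F₁ F₂ : Type} [NormedAddCommGroup F₁] [InnerProductSpace ℝ F₁]
    [NormedAddCommGroup F₂] [InnerProductSpace ℝ F₂] (A : H →ₗ[ℝ] F₁) (B : H →ₗ[ℝ] F₂)
    {γ κ a : ℝ} {x U e : ℕ → H} {v₀ w c v : H} {y : F₁} (he : ∀ n, e n = U n - R (x n)) {n : ℕ}
    (hR : ⟪B (R (x n)), B v⟫ = ⟪B (x n), B v⟫)
    (h₁ : ⟪A ((κ ^ 2)⁻¹ • (U (n + 1) - (2 : ℝ) • U n + U (n - 1))), A v⟫ + ⟪B (U n), B v⟫ +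
      a * ⟪A (cq γ κ (centralDiff κ (R v₀) U) n), A v⟫ = ⟪y, A v⟫)
    (h₂ : ⟪A w, A v⟫ + ⟪B (x n), B v⟫ + a * ⟪A c, A v⟫ = ⟪y, A v⟫) :
    ⟪A ((κ ^ 2)⁻¹ • (e (n + 1) - (2 : ℝ) • e n + e (n - 1))), A v⟫ + ⟪B (e n), B v⟫ +
      a * ⟪A (cq γ κ (centralDiff κ 0 e) n), A v⟫ =
      ⟪A (w - R ((κ ^ 2)⁻¹ • (x (n + 1) - (2 : ℝ) • x n + x (n - 1)))) +
        a • A (c - R (cq γ κ (centralDiff κ v₀ x) n)), A v⟫ := by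
  have e1 : (κ ^ 2)⁻¹ • (U (n + 1) - (2 : ℝ) • U n + U (n - 1)) =
      (κ ^ 2)⁻¹ • (e (n + 1) - (2 : ℝ) • e n + e (n - 1)) +
        R ((κ ^ 2)⁻¹ • (x (n + 1) - (2 : ℝ) • x n + x (n - 1))) := by
    simp only [he, map_smul, map_add, map_sub]
    module
  have e2 : cq γ κ (centralDiff κ (R v₀) U) n = cq γ κ (centralDiff κ 0 e) n +
      R (cq γ κ (centralDiff κ v₀ x) n) := by
    rw [map_cq]
    have e3 : ∀ j, centralDiff κ (R v₀) U j = centralDiff κ 0 e j + R (centralDiff κ v₀ x j) := by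
      intro j
      by_cases hj : j = 0
      · simp [centralDiff, hj]
      · simp only [centralDiff, hj, if_false, he, map_smul, map_sub]
        module
    simp only [cq, ← Finset.sum_add_distrib, e3]
    refine Finset.sum_congr rfl fun j _ => ?_
    module
  have e4 : B (U n) = B (e n) + B (R (x n)) := by
    rw [he, map_sub, sub_add_cancel]
  rw [e1, e2, e4, map_add, map_add, inner_add_left, inner_add_left, inner_add_left] at h₁
  rw [inner_add_left, map_sub A w, map_sub A c, inner_smul_left, inner_sub_left,
    inner_sub_left, RCLike.conj_to_real]
  linear_combination h₁ - h₂ - hR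

end Algebra

section Window
variable {X : Type} [NormedAddCommGroup X] [NormedSpace ℝ X] {T κ η : ℝ} {S : ℕ → ℝ}
  {u : ℕ → ℝ → X}

lemma StepBounds.taylor_zero_le (h : StepBounds T κ η S u) (hκ : 0 < κ) (hκT : κ ≤ T) :
    ‖u 0 κ - (u 0 0 + κ • u 1 0 + (κ ^ 2 / 2) • u 2 0)‖ ≤ η * κ * κ := by
  have hκT' : 0 + κ ≤ T := by rwa [zero_add]
  have := norm_taylor_two_le (a := 0) (b := 0 + κ) (L := κ) (by linarith) hκ.le
    (h.osc_nonneg (hκ.le.trans hκT) hκ.le)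
    (h.window (k := 0) (by norm_num) le_rfl hκT')
    (h.window (k := 1) (by norm_num) le_rfl hκT')
    (h.osc_window le_rfl hκT' (by linarith)) (t := κ) ⟨hκ.le, by linarith⟩
  simpa only [sub_zero] using this

lemma StepBounds.midpoint_deriv_le (h : StepBounds T κ η S u) (hκ : 0 < κ) {a : ℝ} (ha : 0 ≤ a)
    (haT : a + κ ≤ T) :
    ‖κ⁻¹ • (u 0 (a + κ) - u 0 a) - u 1 (a + κ / 2)‖ ≤ 2 * (κ * η) :=
  norm_midpoint_deriv_le hκ (h.osc_nonneg (by linarith) hκ.le)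
    (h.window (k := 0) (by norm_num) ha haT) (h.window (k := 1) (by norm_num) ha haT)
    (h.osc_window ha haT (by linarith))

lemma StepBounds.midpoint_average_le (h : StepBounds T κ η S u) (hκ : 0 < κ) {M : ℝ}
    (hM : ∀ t ∈ Icc 0 T, ‖u 2 t‖ ≤ M) {a : ℝ} (ha : 0 ≤ a) (haT : a + κ ≤ T) :
    ‖(2 : ℝ)⁻¹ • (u 0 (a + κ) + u 0 a) - u 0 (a + κ / 2)‖ ≤ 2 * (κ ^ 2 * M) :=
  norm_midpoint_average_le hκ ((norm_nonneg _).trans (hM 0 ⟨le_rfl, by linarith⟩))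
    (h.window (k := 0) (by norm_num) ha haT) (h.window (k := 1) (by norm_num) ha haT)
    (fun t ht => hM t ⟨ha.trans ht.1, ht.2.trans haT⟩)

end Window

lemma timeDeriv_zero {X : Type} [NormedAddCommGroup X] [NormedSpace ℝ X] (T : ℝ) (u : ℝ → X) :
    timeDeriv T 0 u = u := by
  funext t; simp [timeDeriv]

section ErrorEquation
variable {d : ℕ} {Ω : Set (Euc d)} {P : ℝ} {V : Submodule ℝ (H10 Ω)} [FiniteDimensional ℝ V]

/-- `∂_t^{γ+1} u = ∂_t^γ ∂_t u`. -/
lemma caputo_add_one {X : Type} [NormedAddCommGroup X] [NormedSpace ℝ X] {T γ : ℝ} (hγ : -1 < γ)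
    (hγ' : γ < 1) (hγ₀ : γ ≠ 0) (u : ℝ → X) (t : ℝ) :
    caputo T (γ + 1) u t = caputo T γ (timeDeriv T 1 u) t := by
  rcases lt_or_gt_of_ne hγ₀ with h | h
  · rw [(caputo_of_neg hγ h u t).1, (caputo_of_neg hγ h u t).2]
  · rw [(caputo_of_pos h hγ' u t).1, (caputo_of_pos h hγ' u t).2]

/-- The residual of the Ritz projection of the exact solution in the discrete scheme. -/
noncomputable def residual (V : Submodule ℝ (H10 Ω)) (T γ a κ : ℝ) (u : ℝ → H10 Ω) (n : ℕ) :
    L2 ℝ Ω :=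
  toL2 (timeDeriv T 2 u (n * κ) - ritz V ((κ ^ 2)⁻¹ • (u ((n + 1 : ℕ) * κ) - (2 : ℝ) • u (n * κ) +
    u ((n - 1 : ℕ) * κ)))) +
  a • toL2 (caputo T γ (timeDeriv T 1 u) (n * κ) -
    ritz V (cq γ κ (centralDiff κ (timeDeriv T 1 u 0) fun j => u (j * κ)) n))

/-- The discrete error solves the scheme with the residual as right-hand side. -/
lemma error_equation (hP : ∀ w : H10 Ω, ‖toL2 w‖ ≤ P * ‖grad w‖) {T γ a κ : ℝ} {N : ℕ}
    {f : ℝ → L2 ℝ Ω} {u₀ v₀ : H10 Ω} {u : ℝ → H10 Ω} {U : ℕ → H10 Ω} (hγ : -1 < γ) (hγ' : γ < 1)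
    (hγ₀ : γ ≠ 0) (hκ : 0 < κ) (hN : N * κ = T) (hu : IsWeakSolution T γ a f u₀ v₀ u)
    (hU : IsFullyDiscrete V γ a κ N f u₀ v₀ (timeDeriv T 2 u 0) U) {e : ℕ → H10 Ω}
    (he : ∀ n, e n = U n - ritz V (u (n * κ))) {n : ℕ} (hn : 1 ≤ n) (hnN : n + 1 ≤ N) {v : H10 Ω}
    (hv : v ∈ V) :
    ⟪toL2 ((κ ^ 2)⁻¹ • (e (n + 1) - (2 : ℝ) • e n + e (n - 1))), toL2 v⟫ + ⟪grad (e n), grad v⟫ +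
      a * ⟪toL2 (cq γ κ (centralDiff κ 0 e) n), toL2 v⟫ =
      ⟪residual V T γ a κ u n, toL2 v⟫ := by
  have hn0 : (0 : ℝ) < n := by exact_mod_cast hn
  have ht : (n : ℝ) * κ ∈ Ioc 0 T :=
    ⟨by positivity, by rw [← hN]; gcongr; omega⟩
  have h1 := hU.step n hn hnN v hv
  have h2 := hu.weak_eq _ ht v
  rw [caputo_add_one hγ hγ' hγ₀] at h2
  have h3 := scheme_sub_weak_eq (ritzL V hP) (toL2L Ω) (gradL Ω) (x := fun n => u (n * κ))
    (v₀ := timeDeriv T 1 u 0) (y := f (n * κ)) he ((ritz_spec V (u (n * κ))).2 v hv)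
    (by rw [hu.init_deriv]; exact h1) h2
  exact h3

set_option maxHeartbeats 1000000 in
/-- The error of the first step: the Taylor expansion at `0`, and the difference of the two
projections of the initial acceleration. -/
lemma norm_initial_error_le (hP0 : 0 < P) (hP : ∀ w : H10 Ω, ‖toL2 w‖ ≤ P * ‖grad w‖)
    {T γ a κ η : ℝ} {S : ℕ → ℝ} {N : ℕ} {f : ℝ → L2 ℝ Ω} {u₀ v₀ : H10 Ω} {u : ℝ → H10 Ω}
    {U : ℕ → H10 Ω} (hκ : 0 < κ) (hκT : κ ≤ T)
    (hb : StepBounds T κ η S (fun k => timeDeriv T k u)) (hu : IsWeakSolution T γ a f u₀ v₀ u)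
    (hU : IsFullyDiscrete V γ a κ N f u₀ v₀ (timeDeriv T 2 u 0) U) :
    ‖toL2 (κ⁻¹ • (U 1 - ritz V (u κ)))‖ ≤
      κ / 2 * projErr V (timeDeriv T 2 u 0) + P * (κ * η) := by
  have htay := hb.taylor_zero_le hκ hκT
  simp only [timeDeriv_zero, hu.init, hu.init_deriv] at htay
  generalize timeDeriv T 2 u 0 = w₀ at htay hU ⊢
  have hinit := hU.init_one
  have e1 : κ⁻¹ • (U 1 - ritz V (u κ)) =
      (κ / 2) • (l2Proj V (toL2 w₀) - ritz V w₀) -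
        κ⁻¹ • ritz V (u κ - (u₀ + κ • v₀ + (κ ^ 2 / 2) • w₀)) := by
    rw [hinit]
    exact initial_error_eq (ritzL V hP) hκ u₀ v₀ w₀ (l2Proj V (toL2 w₀)) (u κ)
  generalize u κ - (u₀ + κ • v₀ + (κ ^ 2 / 2) • w₀) = r at htay e1
  rw [e1, toL2_sub, toL2_smul, toL2_smul]
  refine (norm_sub_le _ _).trans (add_le_add ?_ ?_)
  · rw [norm_smul, Real.norm_of_nonneg (by positivity)]
    gcongr
    exact norm_toL2_l2Proj_sub_ritz_le w₀
  · rw [norm_smul, Real.norm_of_nonneg (by positivity), inv_mul_le_iff₀ hκ]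
    have h1 : ‖toL2 (ritz V r)‖ ≤ P * ‖r‖ := norm_toL2_ritz_le hP0.le hP r
    calc ‖toL2 (ritz V r)‖ ≤ P * (η * κ * κ) := h1.trans (by gcongr)
      _ = κ * (P * (κ * η)) := by ring

set_option maxHeartbeats 1000000 in
/-- The residuals split into projection errors and truncation errors in time. -/
lemma sum_residual_le (hP0 : 0 < P) (hP : ∀ w : H10 Ω, ‖toL2 w‖ ≤ P * ‖grad w‖)
    {T γ a κ D Z : ℝ} {N : ℕ} {u : ℝ → H10 Ω} (hκ : 0 < κ) (ha : 0 ≤ a)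
    (hZ : κ * ∑ n ∈ Finset.Ico 1 N, ‖timeDeriv T 2 u (n * κ) -
      (κ ^ 2)⁻¹ • (u ((n + 1 : ℕ) * κ) - (2 : ℝ) • u (n * κ) + u ((n - 1 : ℕ) * κ))‖ ≤ Z)
    (hD : κ * ∑ n ∈ Finset.Ico 1 N, ‖toL2 (ritz V (caputo T γ (timeDeriv T 1 u) (n * κ) -
        cq γ κ (centralDiff κ (timeDeriv T 1 u 0) fun j => u (j * κ)) n))‖ ≤ D) :
    κ * ∑ n ∈ Finset.Ico 1 N, ‖residual V T γ a κ u n‖ ≤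
      κ * ∑ n ∈ Finset.Ico 1 N, projErr V (timeDeriv T 2 u (n * κ)) + P * Z +
      a * (κ * ∑ n ∈ Finset.Ico 1 N, projErr V (caputo T γ (timeDeriv T 1 u) (n * κ)) + D) := by
  have hsub : ∀ x y : H10 Ω, ‖toL2 (x - ritz V y)‖ ≤ projErr V x + ‖toL2 (ritz V (x - y))‖ := by
    intro x y
    have e : x - ritz V y = ritz V (x - y) - (ritz V x - x) := sub_proj_eq (ritzL V hP) x y
    rw [e, toL2_sub, add_comm]
    exact norm_sub_le _ _
  have hpt : ∀ n ∈ Finset.Ico 1 N, ‖residual V T γ a κ u n‖ ≤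
      projErr V (timeDeriv T 2 u (n * κ)) + P * ‖timeDeriv T 2 u (n * κ) -
      (κ ^ 2)⁻¹ • (u ((n + 1 : ℕ) * κ) - (2 : ℝ) • u (n * κ) + u ((n - 1 : ℕ) * κ))‖ +
      a * (projErr V (caputo T γ (timeDeriv T 1 u) (n * κ)) +
        ‖toL2 (ritz V (caputo T γ (timeDeriv T 1 u) (n * κ) -
        cq γ κ (centralDiff κ (timeDeriv T 1 u 0) fun j => u (j * κ)) n))‖) := by
    intro n _
    rw [residual]
    refine (norm_add_le _ _).trans (add_le_add ?_ ?_)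
    · exact (hsub _ _).trans (add_le_add le_rfl (norm_toL2_ritz_le hP0.le hP _))
    · rw [norm_smul, Real.norm_of_nonneg ha]
      exact mul_le_mul_of_nonneg_left (hsub _ _) ha
  calc _ ≤ _ := mul_le_mul_of_nonneg_left (Finset.sum_le_sum hpt) hκ.le
    _ = _ := by
        rw [Finset.sum_add_distrib, Finset.sum_add_distrib, ← Finset.mul_sum, ← Finset.mul_sum,
          Finset.sum_add_distrib]
    _ ≤ _ := by
        generalize ∑ n ∈ Finset.Ico 1 N, projErr V (timeDeriv T 2 u (n * κ)) = s₁
        generalize ∑ n ∈ Finset.Ico 1 N, projErr V (caputo T γ (timeDeriv T 1 u) (n * κ)) = s₂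
        have h1 := mul_le_mul_of_nonneg_left hZ hP0.le
        have h2 := mul_le_mul_of_nonneg_left hD ha
        linarith

set_option maxHeartbeats 1000000 in
/-- The error at the midpoints in terms of the discrete error `e = U - R_h u`. -/
lemma midpoint_error_le (hP0 : 0 < P) (hP : ∀ w : H10 Ω, ‖toL2 w‖ ≤ P * ‖grad w‖)
    {T κ η M Q : ℝ} {S : ℕ → ℝ} {N : ℕ} {u : ℝ → H10 Ω} {U e : ℕ → H10 Ω} (hκ : 0 < κ)
    (hN : N * κ = T) (hb : StepBounds T κ η S (fun k => timeDeriv T k u))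
    (hM : ∀ t ∈ Icc 0 T, ‖timeDeriv T 2 u t‖ ≤ M)
    (he : ∀ n, e n = U n - ritz V (u (n * κ))) {n : ℕ} (hn : 1 ≤ n) (hnN : n ≤ N)
    (h₁ : ‖toL2 (κ⁻¹ • (e n - e (n - 1)))‖ ≤ Q)
    (h₂ : ‖grad ((2 : ℝ)⁻¹ • (e n + e (n - 1)))‖ ≤ Q) :
    ‖toL2 (κ⁻¹ • (U n - U (n - 1)) - timeDeriv T 1 u (n * κ - κ / 2))‖ ≤
      Q + P * (2 * (κ * η)) + projErr V (timeDeriv T 1 u (n * κ - κ / 2)) ∧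
    ‖toL2 ((2 : ℝ)⁻¹ • (U n + U (n - 1)) - u (n * κ - κ / 2))‖ ≤
      P * Q + P * (2 * (κ ^ 2 * M)) + projErr V (u (n * κ - κ / 2)) ∧
    ‖(2 : ℝ)⁻¹ • (U n + U (n - 1)) - u (n * κ - κ / 2)‖ ≤
      (P + 1) * Q + (P + 1) * (2 * (κ ^ 2 * M)) +
        ‖ritz V (u (n * κ - κ / 2)) - u (n * κ - κ / 2)‖ := by
  set a : ℝ := ((n - 1 : ℕ) : ℝ) * κ with ha
  have ha0 : 0 ≤ a := by positivity
  have e1 : (n : ℝ) * κ = a + κ := by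
    rw [ha, Nat.cast_sub hn]; push_cast; ring
  have hb' : a + κ ≤ T := by rw [← e1, ← hN]; gcongr
  have e2 : (n : ℝ) * κ - κ / 2 = a + κ / 2 := by rw [e1]; ring
  have k1 := hb.midpoint_deriv_le hκ ha0 hb'
  have k2 := hb.midpoint_average_le hκ hM ha0 hb'
  simp only [timeDeriv_zero] at k1 k2
  have f1 : κ⁻¹ • (U n - U (n - 1)) - timeDeriv T 1 u (a + κ / 2) =
      κ⁻¹ • (e n - e (n - 1)) + ritz V (κ⁻¹ • (u (a + κ) - u a) - timeDeriv T 1 u (a + κ / 2)) +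
        (ritz V (timeDeriv T 1 u (a + κ / 2)) - timeDeriv T 1 u (a + κ / 2)) := by
    rw [he, he, e1, ← ha]
    exact velocity_error_eq (ritzL V hP) κ⁻¹ (U n) (U (n - 1)) (u (a + κ)) (u a) _
  have f2 : (2 : ℝ)⁻¹ • (U n + U (n - 1)) - u (a + κ / 2) =
      (2 : ℝ)⁻¹ • (e n + e (n - 1)) + ritz V ((2 : ℝ)⁻¹ • (u (a + κ) + u a) - u (a + κ / 2)) +
        (ritz V (u (a + κ / 2)) - u (a + κ / 2)) := by
    rw [he, he, e1, ← ha]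
    exact average_error_eq (ritzL V hP) (2 : ℝ)⁻¹ (U n) (U (n - 1)) (u (a + κ)) (u a) _
  rw [e2]
  refine ⟨?_, ?_, ?_⟩
  · rw [f1, toL2_add, toL2_add]
    refine norm_add₃_le.trans (add_le_add (add_le_add h₁ ?_) le_rfl)
    exact (norm_toL2_ritz_le hP0.le hP _).trans (by gcongr)
  · rw [f2, toL2_add, toL2_add]
    refine norm_add₃_le.trans (add_le_add (add_le_add ?_ ?_) le_rfl)
    · exact (hP _).trans (by gcongr)
    · exact (norm_toL2_ritz_le hP0.le hP _).trans (by gcongr)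
  · rw [f2]
    refine norm_add₃_le.trans (add_le_add (add_le_add ?_ ?_) le_rfl)
    · exact (norm_le_of_poincare hP0.le hP _).trans (by gcongr)
    · exact (norm_ritz_le hP0.le hP _).trans (by gcongr)

end ErrorEquation

end FracWave

namespace FracWave

/-! ### The error bound -/

lemma spaceError_nonneg {d : ℕ} {Ω : Set (Euc d)} (V : Submodule ℝ (H10 Ω)) (T γ : ℝ) {κ : ℝ}
    (hκ : 0 ≤ κ) (N : ℕ) (u : ℝ → H10 Ω) : 0 ≤ spaceError V T γ κ N u :=
  add_nonneg (add_nonneg (add_nonneg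
    (mul_nonneg hκ (Finset.sum_nonneg fun _ _ => norm_nonneg _)) (norm_nonneg _))
    (mul_nonneg (by positivity) (norm_nonneg _)))
    (mul_nonneg hκ (Finset.sum_nonneg fun _ _ => norm_nonneg _))

lemma dampingError_nonneg {d : ℕ} {Ω : Set (Euc d)} (V : Submodule ℝ (H10 Ω)) (T γ : ℝ) {κ : ℝ}
    (hκ : 0 ≤ κ) (u : ℝ → H10 Ω) : 0 ≤ dampingError V T γ κ u := by
  rw [dampingError]
  split_ifs
  · exact mul_nonneg (norm_nonneg _) hκ
  · exact mul_nonneg (norm_nonneg _) (Real.rpow_nonneg hκ _)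

/-- The CFL condition turns the inverse inequality into the bound that the energy needs. -/
lemma cfl_bound {d : ℕ} {Ω : Set (Euc d)} {V : Submodule ℝ (H10 Ω)} {h Cinv κ : ℝ} (hh : 0 < h)
    (hC : 0 < Cinv) (hV : InverseInequality V h Cinv) (hcfl : κ ≤ √2 * h / Cinv)
    {v : H10 Ω} (hv : v ∈ V) : κ * ‖grad v‖ ≤ √2 * ‖toL2 v‖ := by
  calc κ * ‖grad v‖ ≤ (√2 * h / Cinv) * (Cinv * h⁻¹ * ‖toL2 v‖) := by
        gcongr
        exact hV v hv
    _ = √2 * ‖toL2 v‖ := by field_simp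

/-- The arithmetic that combines the bounds of the initial error and of the residuals. -/
lemma initial_add_residual_le {P a D w z B s₁ s₂ s₃ s₄ s₅ x y : ℝ} (hP : 0 ≤ P) (ha : 0 ≤ a)
    (hD : 0 ≤ D) (hB : 0 ≤ B) (p1 : 0 ≤ s₁) (p2 : 0 ≤ s₂) (p3 : 0 ≤ s₃) (p4 : 0 ≤ s₄) (p5 : 0 ≤ s₅)
    (h1 : w ≤ B) (h2 : z ≤ B) (hx : x ≤ s₄ + P * w)
    (hy : y ≤ s₁ + P * (52 * (w + z)) + a * (s₂ + D * (s₅ + B))) :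
    2 * (x + 2 * y) ≤ 2 * (1 + P + 2 * (1 + 104 * P + a * (1 + D))) *
      (s₁ + s₃ + s₄ + s₂ + s₅ + B) := by
  have hE : 0 ≤ s₁ + s₃ + s₄ + s₂ + s₅ + B := by positivity
  have q1 : x ≤ (1 + P) * (s₁ + s₃ + s₄ + s₂ + s₅ + B) := by
    have : P * w ≤ P * B := by gcongr
    have : 0 ≤ P * (s₁ + s₃ + s₄ + s₂ + s₅) := by positivity
    linarith
  have q2 : y ≤ (1 + 104 * P + a * (1 + D)) * (s₁ + s₃ + s₄ + s₂ + s₅ + B) := by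
    have r1 : P * (52 * (w + z)) ≤ P * (52 * (B + B)) := by gcongr
    have r2 : 104 * P * B ≤ 104 * P * (s₁ + s₃ + s₄ + s₂ + s₅ + B) := by
      gcongr; linarith
    have r3 : a * (s₂ + D * (s₅ + B)) ≤ a * (1 + D) * (s₁ + s₃ + s₄ + s₂ + s₅ + B) := by
      rw [mul_assoc]
      gcongr
      have : 0 ≤ D * (s₁ + s₃ + s₄ + s₂) := by positivity
      linarith
    linarith
  linarith

/-- The arithmetic that combines the discrete error with the midpoint errors. -/
lemma discrete_add_midpoint_le {P D K E A Θ w w' x y z px py pz s₁ s₂ : ℝ} (hP : 0 ≤ P)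
    (hD : 0 ≤ D) (hK : 0 ≤ K) (hE : 0 ≤ E) (hA : 0 ≤ A) (hΘ : 0 ≤ Θ) (hw : w ≤ K * Θ)
    (hw' : w' ≤ K * Θ) (hs : (1 + P) * (D * (1 + K) + 4 * K) * Θ = s₁ + s₂)
    (hx : x ≤ D * (E + A + K * Θ) + P * (2 * w) + px)
    (hy : y ≤ P * (D * (E + A + K * Θ)) + P * (2 * w') + py)
    (hz : z ≤ (P + 1) * (D * (E + A + K * Θ)) + (P + 1) * (2 * w') + pz) :
    x + y ≤ (1 + P) * (D * (1 + K) + 4 * K) * E + px + py +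
      (1 + P) * (D * (1 + K) + 4 * K) * A + s₁ + s₂ ∧
    z ≤ (1 + P) * (D * (1 + K) + 4 * K) * E + pz +
      (1 + P) * (D * (1 + K) + 4 * K) * A + s₁ + s₂ := by
  have q0 : D * (E + A + K * Θ) ≤ D * (1 + K) * (E + A + Θ) := by
    rw [mul_assoc]
    gcongr
    have : 0 ≤ K * (E + A) := by positivity
    linarith
  have q1 : (1 + P) * (D * (E + A + K * Θ)) + (1 + P) * (4 * (K * Θ)) ≤
      (1 + P) * (D * (1 + K) + 4 * K) * (E + A + Θ) := by
    have : (1 + P) * (D * (E + A + K * Θ)) ≤ (1 + P) * (D * (1 + K) * (E + A + Θ)) := by gcongr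
    have : 0 ≤ (1 + P) * (4 * K) * (E + A) := by positivity
    linarith
  have q2 : P * (2 * w) ≤ P * (2 * (K * Θ)) := by gcongr
  have q3 : P * (2 * w') ≤ P * (2 * (K * Θ)) := by gcongr
  have q5 : 0 ≤ K * Θ := by positivity
  have q6 : 0 ≤ P * (K * Θ) := by positivity
  constructor <;> linarith

set_option maxHeartbeats 1000000 in
/-- The discrete error `U - R_h u` in the energy norm. -/
lemma exists_discrete_error_le {d : ℕ} {Ω : Set (Euc d)} {γ : ℝ} (hγ : -1 < γ) (hγ' : γ < 1)
    (hγ₀ : γ ≠ 0) {a : ℝ} (ha : 0 ≤ a) {T : ℝ} (hT : 0 < T) {P : ℝ} (hP0 : 0 < P)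
    (hP : ∀ w : H10 Ω, ‖toL2 w‖ ≤ P * ‖grad w‖) :
    ∃ C > 0, ∀ (V : Submodule ℝ (H10 Ω)) (f : ℝ → L2 ℝ Ω) (u₀ v₀ : H10 Ω) (u : ℝ → H10 Ω)
      (κ η M B : ℝ) (S : ℕ → ℝ) (N : ℕ) (U : ℕ → H10 Ω),
      FiniteDimensional ℝ V → 0 < κ → κ ≤ 1 → N * κ = T →
      (∀ v ∈ V, κ * ‖grad v‖ ≤ √2 * ‖toL2 v‖) →
      IsWeakSolution T γ a f u₀ v₀ u → IsFullyDiscrete V γ a κ N f u₀ v₀ (timeDeriv T 2 u 0) U →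
      StepBounds T κ η S (fun k => timeDeriv T k u) →
      (∀ t ∈ Icc 0 T, ‖timeDeriv T 2 u t‖ ≤ M) → (∀ j, 0 ≤ S j) →
      κ * η ≤ B → κ ^ 2 * M ≤ B → κ * ∑ j ∈ Finset.Ico 1 N, κ ^ 2 * S j ≤ B →
      κ ^ (2 - γ) * η ≤ B →
      ∀ n, 1 ≤ n → n ≤ N →
        ‖toL2 (κ⁻¹ • ((U n - ritz V (u (n * κ))) -
          (U (n - 1) - ritz V (u ((n - 1 : ℕ) * κ)))))‖ ≤
          C * (spaceError V T γ κ N u + dampingError V T γ κ u + B) ∧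
        ‖grad ((2 : ℝ)⁻¹ • ((U n - ritz V (u (n * κ))) +
          (U (n - 1) - ritz V (u ((n - 1 : ℕ) * κ)))))‖ ≤
          C * (spaceError V T γ κ N u + dampingError V T γ κ u + B) := by
  obtain ⟨D, hD, hdamp⟩ := exists_sum_damping_truncation_le hγ hγ' hγ₀ hT hP0 hP
  refine ⟨2 * (1 + P + 2 * (1 + 104 * P + a * (1 + D))), by positivity, ?_⟩
  intro V f u₀ v₀ u κ η M B S N U hV hκ hκ1 hN hcfl hu hU hb hM hS h1 h2 h3 h4 n hn hnN
  have hη : 0 ≤ η := hb.osc_nonneg hT.le hκ.le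
  have hB : 0 ≤ B := le_trans (by positivity) h1
  have hκT : κ ≤ T := by
    have : (1 : ℝ) ≤ N := by exact_mod_cast hn.trans hnN
    rw [← hN]; nlinarith
  have hinit := norm_initial_error_le hP0 hP hκ hκT hb hu hU
  have hZ := sum_second_difference_le hκ hη hS hb hN
  simp only [timeDeriv_zero] at hZ
  have hres := sum_residual_le hP0 hP hκ ha hZ
    (hdamp V u κ η M B S N hV hκ hκ1 hN hb hM hS h1 h2 h3 h4)
  have hstab := energy_stability (toL2L Ω) (gradL Ω) hγ hγ' hκ ha V hcfl (N := N)
    (e := fun n => U n - ritz V (u (n * κ)))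
    (fun n hn => V.sub_mem (hU.mem n hn) (ritz_spec V _).1)
    (by simp [hU.init_zero, hu.init]) (residual V T γ a κ u)
    (fun n hn hnN v hv => error_equation hP hγ hγ' hγ₀ hκ hN hu hU (fun _ => rfl) hn hnN hv) hn hnN
  have e1 : ‖toL2L Ω (κ⁻¹ • (U 1 - ritz V (u ((1 : ℕ) * κ))))‖ =
      ‖toL2 (κ⁻¹ • (U 1 - ritz V (u κ)))‖ := by
    rw [Nat.cast_one, one_mul]; rfl
  rw [e1] at hstab
  have hbound : 2 * (‖toL2 (κ⁻¹ • (U 1 - ritz V (u κ)))‖ +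
      2 * (κ * ∑ j ∈ Finset.Ico 1 N, ‖residual V T γ a κ u j‖)) ≤
      2 * (1 + P + 2 * (1 + 104 * P + a * (1 + D))) *
        (spaceError V T γ κ N u + dampingError V T γ κ u + B) := by
    have p1 : 0 ≤ κ * ∑ n ∈ Finset.Ico 1 N, projErr V (timeDeriv T 2 u (n * κ)) :=
      mul_nonneg hκ.le (Finset.sum_nonneg fun _ _ => norm_nonneg _)
    have p2 : 0 ≤ κ * ∑ n ∈ Finset.Ico 1 N, projErr V (caputo T γ (timeDeriv T 1 u) (n * κ)) :=
      mul_nonneg hκ.le (Finset.sum_nonneg fun _ _ => norm_nonneg _)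
    have p3 : 0 ≤ projErr V (timeDeriv T 1 u 0) := norm_nonneg _
    have p4 : 0 ≤ κ / 2 * projErr V (timeDeriv T 2 u 0) :=
      mul_nonneg (by positivity) (norm_nonneg _)
    have p5 := dampingError_nonneg V T γ hκ.le u
    exact initial_add_residual_le hP0.le ha hD.le hB p1 p2 p3 p4 p5 h1 h3 hinit hres
  exact ⟨hstab.1.trans hbound, hstab.2.trans hbound⟩

end FracWave

set_option maxHeartbeats 1000000 in
theorem mainTheorem1 (d : ℕ) (hd : 1 ≤ d) (Ω : Set (FracWave.Euc d)) (hΩ : IsOpen Ω)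
    (hΩb : Bornology.IsBounded Ω) (γ : ℝ) (hγ₁ : -1 < γ) (hγ₂ : γ < 1) (hγ₀ : γ ≠ 0)
    (α₀ : ℝ) (hα₀ : 0 < α₀) (T : ℝ) (hT : 0 < T) (α : ℝ) :
    ∃ C > 0, ∃ κbar > 0,
      ∀ (C₀ : ℝ) (c : Fin 5 → ℝ), 0 < C₀ → (∀ k, 0 ≤ c k) → (α ≠ 1 ∨ c 4 = 0) →
      ∃ Ct > 0,
      ∀ (h Cinv : ℝ) (V : Submodule ℝ (FracWave.H10 Ω)), 0 < h → 0 < Cinv →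
        FiniteDimensional ℝ V → FracWave.InverseInequality V h Cinv →
      ∀ (f : ℝ → FracWave.L2 ℝ Ω) (u₀ v₀ : FracWave.H10 Ω) (u : ℝ → FracWave.H10 Ω),
        FracWave.IsWeakSolution T γ (FracWave.aCoeff α₀ γ) f u₀ v₀ u →
        FracWave.SmoothnessAssumption T γ α C₀ c u →
      ∀ (N : ℕ) (κ : ℝ), 0 < κ → κ < κbar → N * κ = T → κ ≤ √2 * h / Cinv →
      ∀ U : ℕ → FracWave.H10 Ω,
        FracWave.IsFullyDiscrete V γ (FracWave.aCoeff α₀ γ) κ N f u₀ v₀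
          (FracWave.timeDeriv T 2 u 0) U →
      ∀ n : ℕ, 1 ≤ n → n ≤ N →
        ‖FracWave.toL2 (κ⁻¹ • (U n - U (n - 1)) - FracWave.timeDeriv T 1 u (n * κ - κ / 2))‖
            + ‖FracWave.toL2 ((2 : ℝ)⁻¹ • (U n + U (n - 1)) - u (n * κ - κ / 2))‖
          ≤ C * FracWave.spaceError V T γ κ N u
            + FracWave.projErr V (FracWave.timeDeriv T 1 u (n * κ - κ / 2))
            + FracWave.projErr V (u (n * κ - κ / 2))
            + C * FracWave.dampingError V T γ κ u
            + C * C₀ * (c 3 + c 4) * κ ^ (1 + α) + Ct * κ ^ 2 ∧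
        ‖(2 : ℝ)⁻¹ • (U n + U (n - 1)) - u (n * κ - κ / 2)‖
          ≤ C * FracWave.spaceError V T γ κ N u
            + ‖FracWave.ritz V (u (n * κ - κ / 2)) - u (n * κ - κ / 2)‖
            + C * FracWave.dampingError V T γ κ u
            + C * C₀ * (c 3 + c 4) * κ ^ (1 + α) + Ct * κ ^ 2 := by
  -- the exponent condition forces `α > 0`
  rcases le_or_gt α 0 with hα | hα
  · refine ⟨1, one_pos, 1, one_pos, fun C₀ c _ _ _ => ⟨1, one_pos, ?_⟩⟩
    intro h Cinv V _ _ _ _ f u₀ v₀ u _ hu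
    exact absurd (hu.exponent_pos' hγ₂ hγ₀) (not_lt.2 hα)
  obtain ⟨P, hP0, hP⟩ := FracWave.exists_poincare hd hΩb
  obtain ⟨K, hK, hsmooth⟩ := FracWave.exists_stepBounds_timeError hT hα
  obtain ⟨D, hD, hdisc⟩ := FracWave.exists_discrete_error_le hγ₁ hγ₂ hγ₀
    (FracWave.aCoeff_nonneg hα₀ hγ₁ hγ₂ hγ₀) hT hP0 hP
  have hC : 0 < (1 + P) * (D * (1 + K) + 4 * K) := by positivity
  refine ⟨(1 + P) * (D * (1 + K) + 4 * K), hC, 1, one_pos, ?_⟩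
  intro C₀ c hC₀ hc h41
  have hc2 := hc 2
  have hc3 := hc 3
  have hc4 := hc 4
  refine ⟨(1 + P) * (D * (1 + K) + 4 * K) * (C₀ * (1 + c 2 + c 3 + c 4)), by positivity, ?_⟩
  intro h Cinv V hh hCinv hV hinv f u₀ v₀ u hw hu N κ hκ hκ1 hN hcfl U hU n hn hnN
  obtain ⟨η, M, S, hb, hM, hS, h1, h2, h3, h4⟩ :=
    hsmooth d Ω γ C₀ κ c u N hC₀ hc h41 hκ hκ1.le hN hγ₂ hu
  obtain ⟨hd1, hd2⟩ := hdisc V f u₀ v₀ u κ η M _ S N U hV hκ hκ1.le hN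
    (fun v hv => FracWave.cfl_bound hh hCinv hinv hcfl hv) hw hU hb hM hS h1 h2 h3 h4 n hn hnN
  obtain ⟨m1, m2, m3⟩ := FracWave.midpoint_error_le (V := V) hP0 hP hκ hN hb hM
    (e := fun n => U n - FracWave.ritz V (u (n * κ))) (fun _ => rfl) hn hnN hd1 hd2
  have hΘ : FracWave.timeError α C₀ c κ =
    C₀ * ((c 3 + c 4) * κ ^ (1 + α) + (1 + c 2 + c 3 + c 4) * κ ^ 2) := rfl
  have hΘ0 : 0 ≤ FracWave.timeError α C₀ c κ := by rw [hΘ]; positivity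
  have p1 := FracWave.spaceError_nonneg V T γ hκ.le N u
  have p2 := FracWave.dampingError_nonneg V T γ hκ.le u
  have hsplit : (1 + P) * (D * (1 + K) + 4 * K) * FracWave.timeError α C₀ c κ =
      (1 + P) * (D * (1 + K) + 4 * K) * C₀ * (c 3 + c 4) * κ ^ (1 + α) +
      (1 + P) * (D * (1 + K) + 4 * K) * (C₀ * (1 + c 2 + c 3 + c 4)) * κ ^ 2 := by
    rw [hΘ]; ring
  exact FracWave.discrete_add_midpoint_le hP0.le hD.le hK.le p1 p2 hΘ0 h1 h2 hsplit m1 m2 m3
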